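/- Let $r_0\ge 1$, $a\ge 0$, and let $p_i\ge 1$, $r_i\ge 1$ ($1\le i\le a$) be integers. Put $$\Gamma=\mathbb Z^{r_0}\times\mathbb Z_{p_1}^{r_1}\times\dots\times\mathbb Z_{p_a}^{r_a},\qquad r=r_0+r_1+\dots+r_a ,$$ where $\mathbb Z_p=\mathbb Z/p\mathbb Z$, and let $\varepsilon_1,\dots,\varepsilon_r$ be the canonical generators of $\Gamma$ ($\varepsilon_j$ is $1$ in the $j$-th component and $0$ elsewhere). Let $X_0$ be the metric Cayley graph with vertex set $\Gamma$ and one edge of length $1$ from $\gamma$ to $\gamma+\varepsilon_j$ for each $\gamma\in\Gamma$, $1\le j\le r$ (so $X_0$ is $2r$-regular, with double edges if some $p_i=2$ and loops if some $p_i=1$). Let $\Delta_{X_0}$ be the Kirchhoff Laplacian in $L^2(X_0)=\bigoplus_e L^2([0,1])$: it acts as $u_e\mapsto -u_e''$ on each edge $e$, and its domain consists of all $u\in L^2(X_0)$ with $u_e\in H^2(0,1)$, $(u_e'')_e\in L^2(X_0)$, that are continuous at the vertices and whose outgoing derivatives sum to $0$ at each vertex. For a character $\chi\in\hat\Gamma$,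 $\chi(\varepsilon_j)=e^{i\theta_j}$, let $\Delta^\theta$ be the operator $(u_j)_j\mapsto(-u_j'')_j$ in $\bigoplus_{j=1}^r L^2([0,1])$ whose domain consists of all $(u_j)$ with $u_j\in H^2(0,1)$ such that, for some common value $c\in\mathbb C$, $$u_j(0)=c,\quad e^{-i\theta_j}u_j(1)=c\quad (1\le j\le r),\qquad \sum_{k=1}^r\bigl(e^{-i\theta_k}u_k'(1)-u_k'(0)\bigr)=0 .$$ Let $\lambda_k^\theta$, $k=0,1,2,\dots$, be the eigenvalues of $\Delta^\theta$ in ascending order, repeated according to multiplicity, and call $B_k=\{\lambda_k^\theta:\chi\in\hat\Gamma\}$ the $k$-th band. A spectral gap of $\Delta_{X_0}$ is an open interval $(s,t)$ with $0<s<t$ which does not meet $\operatorname{spec}\Delta_{X_0}$ and whose end points both lie in $\operatorname{spec}\Delta_{X_0}$. 1. Suppose that at least one of the orders $p_1,\dots,p_a$ is odd. Then for every $\ell=0,1,2,\dots$ there are spectral gaps $(\alpha_\ell,(2\ell+1)^2\pi^2)$ and $((2\ell+1)^2\pi^2,\beta_\ell)$ of $\Delta_{X_0}$ immediately below and immediately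 above $(2\ell+1)^2\pi^2$. The lengths $(2\ell+1)^2\pi^2-\alpha_\ell$ and $\beta_\ell-(2\ell+1)^2\pi^2$ are strictly increasing in $\ell$ and tend to $\infty$ as $\ell\to\infty$. Moreover, for every $\ell$ exactly $r-1$ of the bands $B_k$ are equal to the single point $\{(2\ell+1)^2\pi^2\}$, and for every $\chi\in\hat\Gamma$ the number $(2\ell+1)^2\pi^2$ is an eigenvalue of $\Delta^\theta$ of multiplicity exactly $r-1$. 2. If all orders $p_1,\dots,p_a$ are even (in particular if $a=0$), then $\operatorname{spec}\Delta_{X_0}=[0,\infty)$. -/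

import Mathlib

open MeasureTheory

/-! ### Unbounded operators: spectrum, eigenspaces, gaps -/

namespace LinearPMap

variable {H : Type*} [NormedAddCommGroup H] [NormedSpace ℂ H]

/-- `z` is in the resolvent set of the unbounded operator `T` if `T - z` is a bijection from the
domain of `T` onto `H` with bounded everywhere defined inverse `R`. -/
def IsResolventPoint (T : H →ₗ.[ℂ] H) (z : ℂ) : Prop :=
  ∃ R : H →L[ℂ] H,
    (∀ f : H, ∃ h : R f ∈ T.domain, T ⟨R f, h⟩ - z • R f = f) ∧
    (∀ u : T.domain, R (T u - z • (u : H)) = u)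

/-- The spectrum of an unbounded operator, as a subset of `ℂ`. -/
def unboundedSpectrum (T : H →ₗ.[ℂ] H) : Set ℂ := {z | ¬ T.IsResolventPoint z}

/-- The eigenspace `ker (T - z)`. -/
def eigenspaceAt (T : H →ₗ.[ℂ] H) (z : ℂ) : Submodule ℂ H where
  carrier := {f | ∃ h : f ∈ T.domain, T ⟨f, h⟩ = z • f}
  zero_mem' := ⟨T.domain.zero_mem, by
    have : (⟨0, T.domain.zero_mem⟩ : T.domain) = 0 := rfl
    rw [this, T.map_zero, smul_zero]⟩
  add_mem' := by
    rintro f g ⟨hf, ef⟩ ⟨hg, eg⟩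
    refine ⟨T.domain.add_mem hf hg, ?_⟩
    have : (⟨f + g, T.domain.add_mem hf hg⟩ : T.domain) = ⟨f, hf⟩ + ⟨g, hg⟩ := rfl
    rw [this, T.map_add, ef, eg, smul_add]
  smul_mem' := by
    rintro c f ⟨hf, ef⟩
    refine ⟨T.domain.smul_mem c hf, ?_⟩
    have : (⟨c • f, T.domain.smul_mem c hf⟩ : T.domain) = c • ⟨f, hf⟩ := rfl
    rw [this, T.map_smul, ef, smul_comm]

/-- The number of eigenvalues `≤ t`, counted with multiplicity. -/
noncomputable def eigenvalueCount (T : H →ₗ.[ℂ] H) (t : ℝ) : Cardinal :=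
  Module.rank ℂ (⨆ s : Set.Iic t, T.eigenspaceAt ((s : ℝ) : ℂ) : Submodule ℂ H)

/-- For a nonnegative self-adjoint operator with purely discrete spectrum: the `k`-th eigenvalue
(`k = 0, 1, 2, …`) in the ascending enumeration that repeats each eigenvalue according to its
multiplicity, i.e. the least `t` such that more than `k` eigenvalues are `≤ t`. -/
noncomputable def orderedEigenvalue (T : H →ₗ.[ℂ] H) (k : ℕ) : ℝ :=
  sInf {t : ℝ | (k : Cardinal) < T.eigenvalueCount t}

end LinearPMap

/-- `(a, b)`, with `0 < a < b`, is a (maximal open) spectral gap of the set `S`: it does not meet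
`S`, and both end points belong to `S`. -/
def IsSpectralGap (S : Set ℂ) (a b : ℝ) : Prop :=
  0 < a ∧ a < b ∧ (a : ℂ) ∈ S ∧ (b : ℂ) ∈ S ∧ ∀ x ∈ Set.Ioo a b, (x : ℂ) ∉ S

/-! ### Metric graphs with unit edges and their Laplacians -/

/-- A locally finite oriented graph with vertex set `V` and edge set `E`; multiple edges and loops
are allowed. As a metric graph, each edge `e` is the interval `[0,1]`, with `0` attached to
`src e` and `1` attached to `tgt e`. -/
structure UnitGraph (V E : Type*) where
  src : E → V
  tgt : E → V
  finite_src : ∀ v, {e | src e = v}.Finite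
  finite_tgt : ∀ v, {e | tgt e = v}.Finite

/-- `L²([0,1])`. -/
abbrev EdgeL2 : Type := Lp ℂ 2 (volume.restrict (Set.Icc (0 : ℝ) 1))

/-- `L²` of a metric graph with edge set `E` and unit edges: the Hilbert sum `⨁ₑ L²([0,1])`. -/
abbrev GraphL2 (E : Type*) : Type _ := lp (fun _ : E => EdgeL2) 2

/-- `f` belongs to `H²(0,1)` with `-f'' = g`; here `u` is the `C¹([0,1])` representative of `f`,
and `w` is its derivative, which is absolutely continuous with derivative `-g`. -/
structure IsH2Rep (f g : EdgeL2) (u w : ℝ → ℂ) : Prop where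
  ae_eq : f =ᵐ[volume.restrict (Set.Icc (0 : ℝ) 1)] u
  deriv_fst : ∀ x ∈ Set.Icc (0 : ℝ) 1, HasDerivWithinAt u (w x) (Set.Icc 0 1) x
  deriv_snd : ∀ x ∈ Set.Icc (0 : ℝ) 1, w x = w 0 - ∫ t in (0 : ℝ)..x, g t

theorem EdgeL2.intervalIntegrable (g : EdgeL2) {x : ℝ} (hx : x ∈ Set.Icc (0 : ℝ) 1) :
    IntervalIntegrable g volume 0 x := by
  have h : IntegrableOn g (Set.Icc (0 : ℝ) 1) volume :=
    (Lp.memLp g).integrable (by norm_num)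
  rw [intervalIntegrable_iff, Set.uIoc_of_le hx.1]
  exact h.mono_set fun y hy => ⟨hy.1.le, hy.2.trans hx.2⟩

theorem EdgeL2.integral_congr {g g' : ℝ → ℂ} {x : ℝ} (hx : x ∈ Set.Icc (0 : ℝ) 1)
    (h : g =ᵐ[volume.restrict (Set.Icc (0 : ℝ) 1)] g') :
    ∫ t in (0 : ℝ)..x, g t = ∫ t in (0 : ℝ)..x, g' t := by
  rw [intervalIntegral.integral_of_le hx.1, intervalIntegral.integral_of_le hx.1]
  have hs : Set.Ioc 0 x ⊆ Set.Icc (0 : ℝ) 1 := fun y hy => ⟨hy.1.le, hy.2.trans hx.2⟩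
  exact integral_congr_ae (ae_restrict_of_ae_restrict_of_subset hs h)

namespace IsH2Rep

theorem zero : IsH2Rep 0 0 (fun _ => 0) (fun _ => 0) where
  ae_eq := Lp.coeFn_zero _ _ _
  deriv_fst := fun x _ => hasDerivWithinAt_const x _ 0
  deriv_snd := fun x hx => by
    rw [EdgeL2.integral_congr hx (Lp.coeFn_zero _ _ _)]; simp

theorem add {f g f' g' : EdgeL2} {u w u' w' : ℝ → ℂ} (h : IsH2Rep f g u w)
    (h' : IsH2Rep f' g' u' w') : IsH2Rep (f + f') (g + g') (u + u') (w + w') where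
  ae_eq := (Lp.coeFn_add f f').trans (h.ae_eq.add h'.ae_eq)
  deriv_fst := fun x hx => (h.deriv_fst x hx).add (h'.deriv_fst x hx)
  deriv_snd := fun x hx => by
    rw [EdgeL2.integral_congr hx (Lp.coeFn_add g g')]
    simp only [Pi.add_apply]
    rw [intervalIntegral.integral_add (g.intervalIntegrable hx) (g'.intervalIntegrable hx),
      h.deriv_snd x hx, h'.deriv_snd x hx]
    ring

theorem smul {f g : EdgeL2} {u w : ℝ → ℂ} (c : ℂ) (h : IsH2Rep f g u w) :
    IsH2Rep (c • f) (c • g) (c • u) (c • w) where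
  ae_eq := (Lp.coeFn_smul c f).trans (h.ae_eq.const_smul c)
  deriv_fst := fun x hx => (h.deriv_fst x hx).const_smul c
  deriv_snd := fun x hx => by
    rw [EdgeL2.integral_congr hx (Lp.coeFn_smul c g)]
    simp only [Pi.smul_apply, smul_eq_mul]
    rw [intervalIntegral.integral_const_mul, h.deriv_snd x hx]
    ring

/-- The second derivative is determined by the function. -/
theorem eq_zero {g : EdgeL2} {u w : ℝ → ℂ} (h : IsH2Rep 0 g u w) : g = 0 := by
  have hu : Set.EqOn u (fun _ => 0) (Set.Icc 0 1) := by
    refine Measure.eqOn_Icc_of_ae_eq volume zero_ne_one ?_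
      (fun x hx => (h.deriv_fst x hx).continuousWithinAt) continuousOn_const
    exact h.ae_eq.symm.trans (Lp.coeFn_zero _ _ _)
  have hw : ∀ x ∈ Set.Icc (0 : ℝ) 1, w x = 0 := fun x hx =>
    (uniqueDiffOn_Icc zero_lt_one x hx).eq_deriv _ (h.deriv_fst x hx)
      ((hasDerivWithinAt_const x _ (0 : ℂ)).congr hu (hu hx))
  have hI : ∀ x ∈ Set.Icc (0 : ℝ) 1, ∫ t in (0 : ℝ)..x, g t = 0 := fun x hx => by
    have := h.deriv_snd x hx
    rw [hw x hx, hw 0 ⟨le_rfl, zero_le_one⟩] at this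
    simpa using this.symm
  have hd := (g.intervalIntegrable (x := 1) ⟨zero_le_one, le_rfl⟩).ae_hasDerivAt_integral
  refine Lp.ext ((?_ : g =ᵐ[_] fun _ => (0 : ℂ)).trans (Lp.coeFn_zero _ _ _).symm)
  suffices hs : ∀ᵐ x ∂(volume.restrict (Set.Ioo (0 : ℝ) 1)), g x = 0 by
    have hm : volume.restrict (Set.Icc (0 : ℝ) 1) = volume.restrict (Set.Ioo (0 : ℝ) 1) :=
      restrict_Ioo_eq_restrict_Icc.symm
    exact hm.absolutelyContinuous.ae_le hs
  rw [ae_restrict_iff' measurableSet_Ioo]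
  filter_upwards [hd] with x hx hx'
  have hxm : x ∈ Set.uIcc (0 : ℝ) 1 := by
    rw [Set.uIcc_of_le zero_le_one]; exact Set.Ioo_subset_Icc_self hx'
  have h1 := hx hxm 0 Set.left_mem_uIcc
  refine h1.unique ((hasDerivAt_const x (0 : ℂ)).congr_of_eventuallyEq ?_)
  filter_upwards [isOpen_Ioo.mem_nhds hx'] with y hy
  exact hI y (Set.Ioo_subset_Icc_self hy)

end IsH2Rep

namespace UnitGraph

variable {V E : Type*} (G : UnitGraph V E) (z : E → Circle)

/-- Vertex conditions with phases `z e`, for a function with edge components `u e` and edge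
derivatives `w e = (u e)'`: the values `u e 0` and `(z e)⁻¹ * u e 1` at the edge ends meeting at
a vertex `v` have a common value `φ v`, and the sum of the derivatives
`(z e)⁻¹ * (u e)' 1` over the edges arriving at `v` equals the sum of the derivatives
`(u e)' 0` over the edges leaving `v`. For `z = 1` these are continuity and the usual Kirchhoff
condition. -/
structure VertexConditions (u w : E → ℝ → ℂ) : Prop where
  continuity : ∃ φ : V → ℂ, ∀ e,
    u e 0 = φ (G.src e) ∧ (z e : ℂ)⁻¹ * u e 1 = φ (G.tgt e)
  kirchhoff : ∀ v : V,
    (∑ᶠ (e : E) (_ : e ∈ {e | G.tgt e = v}), (z e : ℂ)⁻¹ * w e 1)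
      - (∑ᶠ (e : E) (_ : e ∈ {e | G.src e = v}), w e 0) = 0

/-- The graph of the operator `f ↦ (-fₑ'')ₑ` on the square integrable functions `f` with
`fₑ ∈ H²(0,1)`, `(fₑ'')ₑ ∈ L²`, and the vertex conditions with phases `z`. -/
def laplacianGraph : Submodule ℂ (GraphL2 E × GraphL2 E) where
  carrier := {p | ∃ u w : E → ℝ → ℂ,
    (∀ e, IsH2Rep (p.1 e) (p.2 e) (u e) (w e)) ∧ G.VertexConditions z u w}
  zero_mem' := ⟨fun _ _ => 0, fun _ _ => 0, fun _ => IsH2Rep.zero,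
    ⟨fun _ => 0, by simp⟩, by simp⟩
  add_mem' := by
    rintro p q ⟨u, w, h, ⟨φ, hφ⟩, hk⟩ ⟨u', w', h', ⟨φ', hφ'⟩, hk'⟩
    refine ⟨u + u', w + w', fun e => (h e).add (h' e), ⟨φ + φ', fun e => ⟨?_, ?_⟩⟩, fun v => ?_⟩
    · simp [(hφ e).1, (hφ' e).1]
    · simp [mul_add, (hφ e).2, (hφ' e).2]
    · simp only [Pi.add_apply, mul_add]
      rw [finsum_mem_add_distrib (G.finite_tgt v), finsum_mem_add_distrib (G.finite_src v)]
      linear_combination hk v + hk' v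
  smul_mem' := by
    rintro c p ⟨u, w, h, ⟨φ, hφ⟩, hk⟩
    refine ⟨c • u, c • w, fun e => (h e).smul c, ⟨c • φ, fun e => ⟨?_, ?_⟩⟩, fun v => ?_⟩
    · simp [(hφ e).1]
    · simp only [Pi.smul_apply, smul_eq_mul, ← (hφ e).2]; ring
    · simp only [Pi.smul_apply, smul_eq_mul, mul_left_comm _ c]
      rw [← mul_finsum_mem, ← mul_finsum_mem]
      linear_combination c * hk v

/-- The operator `f ↦ (-fₑ'')ₑ` with the vertex conditions with phases `z`. -/
noncomputable def twistedLaplacian : GraphL2 E →ₗ.[ℂ] GraphL2 E :=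
  (G.laplacianGraph z).toLinearPMap

theorem twistedLaplacian_graph : (G.twistedLaplacian z).graph = G.laplacianGraph z := by
  refine Submodule.toLinearPMap_graph_eq _ ?_
  rintro ⟨f, g⟩ ⟨u, w, h, -⟩ (rfl : f = 0)
  exact lp.ext (funext fun e => (h e).eq_zero)

/-- The Laplacian with Kirchhoff conditions on the metric graph `G`. -/
noncomputable def kirchhoffLaplacian : GraphL2 E →ₗ.[ℂ] GraphL2 E :=
  G.twistedLaplacian 1

end UnitGraph

/-! ### The Cayley graph and its Floquet decomposition -/

/-- The (oriented, metric) Cayley graph of the abelian group `Γ` with respect to the finite family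
of generators `gen`: one edge from `γ` to `γ + gen j` for each `γ` and `j`. -/
def cayleyGraph {Γ ι : Type*} [AddCommGroup Γ] [Finite ι] (gen : ι → Γ) :
    UnitGraph Γ (Γ × ι) where
  src e := e.1
  tgt e := e.1 + gen e.2
  finite_src v := by
    refine (Set.finite_range fun j : ι => (v, j)).subset ?_
    rintro ⟨γ, j⟩ (rfl : γ = v)
    exact ⟨j, rfl⟩
  finite_tgt v := by
    refine (Set.finite_range fun j : ι => (v - gen j, j)).subset ?_
    rintro ⟨γ, j⟩ (rfl : γ + gen j = v)
    exact ⟨j, by simp⟩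

/-- The quotient of the Cayley graph by the group: one vertex, and one loop for each generator. -/
def bouquet (ι : Type*) [Finite ι] : UnitGraph Unit ι where
  src _ := ()
  tgt _ := ()
  finite_src _ := Set.toFinite _
  finite_tgt _ := Set.toFinite _

/-- For a character `χ` of `Γ`, with `χ (gen j) = exp (i θ_j)`: the operator `-d²/dx²` on the
quotient, i.e. on functions `(u_j)` on `[0,1]`, with the `θ`-periodic conditions `u_j 0 = c`,
`exp (-i θ_j) u_j 1 = c` for all `j` and some common `c`, and
`∑ j, (exp (-i θ_j) u_j' 1 - u_j' 0) = 0`. -/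
noncomputable def floquetLaplacian {Γ ι : Type*} [AddCommGroup Γ] [Finite ι] (gen : ι → Γ)
    (χ : AddChar Γ Circle) : GraphL2 ι →ₗ.[ℂ] GraphL2 ι :=
  (bouquet ι).twistedLaplacian fun j => χ (gen j)

/-- The `k`-th band, `k = 0, 1, 2, …`: the set of all `k`-th eigenvalues of the Floquet operators
as `χ` ranges over the dual group. -/
noncomputable def spectralBand {Γ ι : Type*} [AddCommGroup Γ] [Finite ι] (gen : ι → Γ) (k : ℕ) :
    Set ℝ :=
  Set.range fun χ : AddChar Γ Circle => (floquetLaplacian gen χ).orderedEigenvalue k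

/-- The group `ℤ^{r₀} × (ℤ/p₁)^{r₁} × ⋯ × (ℤ/p_a)^{r_a}`. -/
abbrev FGAbelian (r₀ : ℕ) {a : ℕ} (p m : Fin a → ℕ) : Type :=
  (Fin r₀ → ℤ) × ((i : Fin a) → Fin (m i) → ZMod (p i))

/-- The index set of the `r = r₀ + r₁ + ⋯ + r_a` canonical generators. -/
abbrev GenIndex (r₀ : ℕ) {a : ℕ} (m : Fin a → ℕ) : Type :=
  Fin r₀ ⊕ ((i : Fin a) × Fin (m i))

/-- The canonical generators: `1` at one component and `0` at all the others. -/
def canonicalGen (r₀ : ℕ) {a : ℕ} (p m : Fin a → ℕ) : GenIndex r₀ m → FGAbelian r₀ p m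
  | Sum.inl k => (Pi.single k 1, 0)
  | Sum.inr ⟨i, k⟩ => (0, Pi.single i (Pi.single k 1))

/-! ### Integration against square integrable functions on the unit interval -/

/-! Write λ = w². If sin w ≠ 0 (or w = 0), a solution of -u'' = w² u on an edge is determined by its
two end values, and the Kirchhoff condition on the vertex values φ becomes (A - 2r cos w) φ = 0,
where A = ∑ⱼ (Tⱼ + Tⱼ*) is the adjacency operator on ℓ²(Γ) and Tⱼ is translation by the j-th
generator. This passes to resolvents: if A - 2r cos w is invertible, then w² is a resolvent point
(`isResolventPoint_of_isUnit`), and a resolvent point yields a left inverse of A - 2r cos w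
(`exists_leftInverse_of_isResolventPoint`). No direct integral decomposition is used.

The spectrum of A is bounded below by adding operator inequalities. A generator of odd order p
contributes at least -2cos(π/p), because its translation is unitary with spectrum among the p-th
roots of unity; any other generator contributes at least -2 (`minRootRe_le_translation_add`,
`neg_two_le_translation_add`). So A ≥ 2rc with c = `minDispersion`, and c > -1 as soon as one order
is odd. Conversely, a character χ with r cos k = ∑ Re χ(εⱼ) puts k² in the spectrum: damped by
t^length with t near 1, it is an approximate eigenvector of A
(`not_exists_leftInverse_shiftedAdjacency`).

Part 1, gaps: near k = (2ℓ+1)π one has cos k < c exactly for |k - (2ℓ+1)π| < δ = arccos(-c). The end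
points of this interval give spectrum since c is attained by a character, and the centre is an
eigenvalue with an eigenfunction supported on a 4-cycle (`not_isResolventPoint_odd_mul_pi_sq`). The
gap lengths are affine in ℓ with slope 4πδ. Part 1, bands: on the bouquet the eigenvalue problem is
linear algebra in the common value and the r slopes. No character takes the value -1 on a generator
of odd order, so the multiplicity at (2ℓ+1)²π² is always r - 1, and the number of eigenvalues below
it is 2rℓ + 1 for every character (`rankOn_Iio_odd`). Hence the same r - 1 indices give flat bands.

Part 2: when all orders are even, torsion generators may take the values ±1 and free ones any phase,
so ∑ Re χ(εⱼ) fills [-r, r]. Every k² with sin k ≠ 0 is then in the spectrum, and closedness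
supplies the rest. -/

instance isProbabilityMeasure_restrict_Icc_zero_one :
    IsProbabilityMeasure (volume.restrict (Set.Icc (0 : ℝ) 1)) :=
  ⟨by simp⟩

theorem EdgeL2.integrableOn (g : EdgeL2) : IntegrableOn g (Set.Icc (0 : ℝ) 1) volume :=
  (Lp.memLp g).integrable (by norm_num)

theorem intervalIntegrable_of_integrableOn_Icc {q : ℝ → ℂ}
    (hq : IntegrableOn q (Set.Icc (0 : ℝ) 1) volume) {x y : ℝ} (hx : x ∈ Set.Icc (0 : ℝ) 1)
    (hy : y ∈ Set.Icc (0 : ℝ) 1) : IntervalIntegrable q volume x y := by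
  rw [intervalIntegrable_iff]
  refine hq.mono_set fun t ht => ?_
  rcases Set.mem_uIoc.1 ht with h | h
  · exact ⟨hx.1.trans h.1.le, h.2.trans hy.2⟩
  · exact ⟨hy.1.trans h.1.le, h.2.trans hx.2⟩

theorem EdgeL2.integrableOn_mul (g : EdgeL2) {h : ℝ → ℂ} (hh : Continuous h) :
    IntegrableOn (fun t => h t * g t) (Set.Icc (0 : ℝ) 1) volume :=
  g.integrableOn.continuousOn_mul hh.continuousOn isCompact_Icc

/-- The unit interval is a probability space, so the L¹ norm is dominated by the L² norm. -/
theorem EdgeL2.integral_norm_le (g : EdgeL2) :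
    ∫ t in Set.Icc (0 : ℝ) 1, ‖g t‖ ≤ ‖g‖ := by
  rw [Lp.norm_def, integral_norm_eq_lintegral_enorm (Lp.aestronglyMeasurable g),
    ← eLpNorm_one_eq_lintegral_enorm]
  exact ENNReal.toReal_mono (Lp.eLpNorm_ne_top g)
    (eLpNorm_le_eLpNorm_of_exponent_le (by norm_num) (Lp.aestronglyMeasurable g))

theorem exists_norm_integral_mul_le {h : ℝ → ℂ} (hh : Continuous h) :
    ∃ K : ℝ, 0 ≤ K ∧ ∀ (g : EdgeL2), ∀ x ∈ Set.Icc (0 : ℝ) 1,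
      ‖∫ t in (0 : ℝ)..x, h t * g t‖ ≤ K * ‖g‖ := by
  obtain ⟨K, hK⟩ := (isCompact_Icc (a := (0 : ℝ)) (b := 1)).exists_bound_of_continuousOn
    hh.continuousOn
  have hK0 : 0 ≤ K := (norm_nonneg _).trans (hK 0 ⟨le_rfl, zero_le_one⟩)
  refine ⟨K, hK0, fun g x hx => ?_⟩
  have hsub : Set.Ioc 0 x ⊆ Set.Icc (0 : ℝ) 1 := fun y hy => ⟨hy.1.le, hy.2.trans hx.2⟩
  have hint : IntegrableOn (fun t => K * ‖g t‖) (Set.Icc (0 : ℝ) 1) volume :=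
    g.integrableOn.norm.const_mul K
  calc ‖∫ t in (0 : ℝ)..x, h t * g t‖ ≤ ∫ t in (0 : ℝ)..x, ‖h t * g t‖ :=
        intervalIntegral.norm_integral_le_integral_norm hx.1
    _ = ∫ t in Set.Ioc 0 x, ‖h t * g t‖ := intervalIntegral.integral_of_le hx.1
    _ ≤ ∫ t in Set.Ioc 0 x, K * ‖g t‖ := by
        refine setIntegral_mono_on ((g.integrableOn_mul hh).mono_set hsub).norm
          (hint.mono_set hsub) measurableSet_Ioc fun t ht => ?_
        rw [norm_mul]
        exact mul_le_mul_of_nonneg_right (hK t (hsub ht)) (norm_nonneg _)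
    _ ≤ ∫ t in Set.Icc (0 : ℝ) 1, K * ‖g t‖ :=
        setIntegral_mono_set hint (ae_of_all _ fun t => mul_nonneg hK0 (norm_nonneg _))
          hsub.eventuallyLE
    _ = K * ∫ t in Set.Icc (0 : ℝ) 1, ‖g t‖ := integral_const_mul _ _
    _ ≤ K * ‖g‖ := mul_le_mul_of_nonneg_left g.integral_norm_le hK0

theorem EdgeL2.integral_mul_add {h : ℝ → ℂ} (hh : Continuous h) (g g' : EdgeL2) {x : ℝ}
    (hx : x ∈ Set.Icc (0 : ℝ) 1) :
    ∫ t in (0 : ℝ)..x, h t * (g + g') t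
      = (∫ t in (0 : ℝ)..x, h t * g t) + ∫ t in (0 : ℝ)..x, h t * g' t := by
  have h0 : (0 : ℝ) ∈ Set.Icc (0 : ℝ) 1 := ⟨le_rfl, zero_le_one⟩
  rw [← intervalIntegral.integral_add
    (intervalIntegrable_of_integrableOn_Icc (g.integrableOn_mul hh) h0 hx)
    (intervalIntegrable_of_integrableOn_Icc (g'.integrableOn_mul hh) h0 hx)]
  refine EdgeL2.integral_congr hx ?_
  filter_upwards [Lp.coeFn_add g g'] with t ht
  rw [ht, Pi.add_apply, mul_add]

theorem EdgeL2.integral_mul_smul {h : ℝ → ℂ} (c : ℂ) (g : EdgeL2) {x : ℝ}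
    (hx : x ∈ Set.Icc (0 : ℝ) 1) :
    ∫ t in (0 : ℝ)..x, h t * (c • g) t = c * ∫ t in (0 : ℝ)..x, h t * g t := by
  rw [← intervalIntegral.integral_const_mul]
  refine EdgeL2.integral_congr hx ?_
  filter_upwards [Lp.coeFn_smul c g] with t ht
  rw [ht, Pi.smul_apply, smul_eq_mul, mul_left_comm]

/-- Integration against a continuous function is a bounded functional. -/
theorem exists_clm_integral_mul {h : ℝ → ℂ} (hh : Continuous h) :
    ∃ τ : EdgeL2 →L[ℂ] ℂ, ∀ g : EdgeL2, τ g = ∫ t in (0 : ℝ)..1, h t * g t := by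
  obtain ⟨K, -, hK⟩ := exists_norm_integral_mul_le hh
  have h1 : (1 : ℝ) ∈ Set.Icc (0 : ℝ) 1 := ⟨zero_le_one, le_rfl⟩
  exact ⟨LinearMap.mkContinuous
    { toFun := fun g : EdgeL2 => ∫ t in (0 : ℝ)..1, h t * g t
      map_add' := fun g g' => EdgeL2.integral_mul_add hh g g' h1
      map_smul' := fun c g => EdgeL2.integral_mul_smul c g h1 } K fun g => hK g 1 h1,
    fun g => rfl⟩

theorem memLp_of_continuousOn {u : ℝ → ℂ} (hu : ContinuousOn u (Set.Icc 0 1)) :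
    MemLp u 2 (volume.restrict (Set.Icc (0 : ℝ) 1)) := by
  obtain ⟨K, hK⟩ := isCompact_Icc.exists_bound_of_continuousOn hu
  refine MemLp.of_bound (hu.aestronglyMeasurable measurableSet_Icc) K ?_
  filter_upwards [ae_restrict_mem measurableSet_Icc] with t ht using hK t ht

/-- The element of `L²([0,1])` given by a continuous function. -/
noncomputable def EdgeL2.ofContinuous (u : ℝ → ℂ) (hu : ContinuousOn u (Set.Icc 0 1)) : EdgeL2 :=
  (memLp_of_continuousOn hu).toLp u

theorem EdgeL2.coeFn_ofContinuous (u : ℝ → ℂ) (hu : ContinuousOn u (Set.Icc 0 1)) :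
    EdgeL2.ofContinuous u hu =ᵐ[volume.restrict (Set.Icc (0 : ℝ) 1)] u :=
  MemLp.coeFn_toLp _

/-- A linear map into the continuous functions, pointwise bounded by the norm of the argument,
defines a bounded operator on `L²([0,1])`. -/
theorem exists_clm_of_pointwise_bound (Λ : EdgeL2 → ℝ → ℂ)
    (hadd : ∀ g g', ∀ x ∈ Set.Icc (0 : ℝ) 1, Λ (g + g') x = Λ g x + Λ g' x)
    (hsmul : ∀ (c : ℂ) g, ∀ x ∈ Set.Icc (0 : ℝ) 1, Λ (c • g) x = c * Λ g x)
    (hcont : ∀ g, ContinuousOn (Λ g) (Set.Icc 0 1)) (K : ℝ) (hK0 : 0 ≤ K)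
    (hK : ∀ g, ∀ x ∈ Set.Icc (0 : ℝ) 1, ‖Λ g x‖ ≤ K * ‖g‖) :
    ∃ D : EdgeL2 →L[ℂ] EdgeL2,
      ∀ g, D g =ᵐ[volume.restrict (Set.Icc (0 : ℝ) 1)] Λ g := by
  refine ⟨LinearMap.mkContinuous
    { toFun := fun g => EdgeL2.ofContinuous (Λ g) (hcont g)
      map_add' := fun g g' => ?_
      map_smul' := fun c g => ?_ } K fun g => ?_, fun g => EdgeL2.coeFn_ofContinuous _ (hcont g)⟩
  · refine Lp.ext ?_
    filter_upwards [ae_restrict_mem measurableSet_Icc, EdgeL2.coeFn_ofContinuous _ (hcont (g + g')),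
      EdgeL2.coeFn_ofContinuous _ (hcont g), EdgeL2.coeFn_ofContinuous _ (hcont g'),
      Lp.coeFn_add (EdgeL2.ofContinuous _ (hcont g)) (EdgeL2.ofContinuous _ (hcont g'))]
      with x hx h1 h2 h3 h4
    rw [h1, h4, Pi.add_apply, h2, h3, hadd g g' x hx]
  · refine Lp.ext ?_
    filter_upwards [ae_restrict_mem measurableSet_Icc, EdgeL2.coeFn_ofContinuous _ (hcont (c • g)),
      EdgeL2.coeFn_ofContinuous _ (hcont g),
      Lp.coeFn_smul c (EdgeL2.ofContinuous _ (hcont g))] with x hx h1 h2 h4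
    rw [h1, RingHom.id_apply, h4, Pi.smul_apply, h2, hsmul c g x hx, smul_eq_mul]
  · have := Lp.norm_le_of_ae_bound (f := EdgeL2.ofContinuous (Λ g) (hcont g))
      (mul_nonneg hK0 (norm_nonneg g)) (by
        filter_upwards [ae_restrict_mem measurableSet_Icc,
          EdgeL2.coeFn_ofContinuous _ (hcont g)] with x hx h1
        rw [h1]; exact hK g x hx)
    have h1 : measureUnivNNReal (volume.restrict (Set.Icc (0 : ℝ) 1)) = 1 := by
      simp [measureUnivNNReal]
    simpa [h1] using this

theorem continuousOn_integral_of_integrableOn {q : ℝ → ℂ}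
    (hq : IntegrableOn q (Set.Icc (0 : ℝ) 1) volume) :
    ContinuousOn (fun y => ∫ t in (0 : ℝ)..y, q t) (Set.Icc 0 1) := by
  have := intervalIntegral.continuousOn_primitive_interval (μ := volume) (f := q) (a := 0) (b := 1)
    (by rwa [Set.uIcc_of_le zero_le_one])
  rwa [Set.uIcc_of_le zero_le_one] at this

/-- Integration by parts of a continuously differentiable function against an absolutely
continuous one, in differentiated form. -/
theorem hasDerivWithinAt_mul_integral_sub {F F' q : ℝ → ℂ} (hF : ∀ x, HasDerivAt F (F' x) x)
    (hF' : Continuous F') (hq : IntegrableOn q (Set.Icc (0 : ℝ) 1) volume) {x : ℝ}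
    (hx : x ∈ Set.Icc (0 : ℝ) 1) :
    HasDerivWithinAt (fun y => F y * (∫ t in (0 : ℝ)..y, q t) - ∫ t in (0 : ℝ)..y, F t * q t)
      (F' x * ∫ t in (0 : ℝ)..x, q t) (Set.Icc 0 1) x := by
  obtain ⟨K, hK⟩ := (isCompact_Icc (a := (0 : ℝ)) (b := 1)).exists_bound_of_continuousOn
    hF'.continuousOn
  have hFc : Continuous F := continuous_iff_continuousAt.2 fun y => (hF y).continuousAt
  have hlip : ∀ a ∈ Set.Icc (0 : ℝ) 1, ∀ b ∈ Set.Icc (0 : ℝ) 1, ‖F b - F a‖ ≤ K * ‖b - a‖ :=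
    fun a ha b hb => (convex_Icc (0 : ℝ) 1).norm_image_sub_le_of_norm_hasDerivWithin_le
      (fun y _ => (hF y).hasDerivWithinAt) hK ha hb
  have hFq : IntegrableOn (fun t => F t * q t) (Set.Icc (0 : ℝ) 1) volume :=
    hq.continuousOn_mul hFc.continuousOn isCompact_Icc
  have h0 : (0 : ℝ) ∈ Set.Icc (0 : ℝ) 1 := ⟨le_rfl, zero_le_one⟩
  have hN : Filter.Tendsto (fun y => K * |∫ t in x..y, ‖q t‖|)
      (nhdsWithin x (Set.Icc 0 1)) (nhds 0) := by
    have hc : ContinuousOn (fun y => ∫ t in x..y, ‖q t‖) (Set.Icc (0 : ℝ) 1) := by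
      have := intervalIntegral.continuousOn_primitive_interval' (μ := volume)
        (f := fun t => ‖q t‖) (a := x) (b₁ := 0) (b₂ := 1)
        (intervalIntegrable_of_integrableOn_Icc hq h0 ⟨zero_le_one, le_rfl⟩).norm
        (by rwa [Set.uIcc_of_le zero_le_one])
      rwa [Set.uIcc_of_le zero_le_one] at this
    have := ((hc x hx).abs.const_mul K).tendsto
    simpa [ContinuousWithinAt] using this
  -- Since |F y - F t| ≤ K |y - x| for t between x and y, the difference quotient is at most K |∫ₓʸ
  -- ‖q‖|, which tends to 0. This works at every point x, although q is merely integrable.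
  have hG : HasDerivWithinAt (fun y => ∫ t in x..y, (F y - F t) * q t) 0 (Set.Icc 0 1) x := by
    rw [hasDerivWithinAt_iff_tendsto]
    refine squeeze_zero' (Filter.Eventually.of_forall fun y => by positivity) ?_ hN
    filter_upwards [self_mem_nhdsWithin] with y hy
    have hb : ‖∫ t in x..y, (F y - F t) * q t‖ ≤ |∫ t in x..y, K * ‖y - x‖ * ‖q t‖| := by
      refine intervalIntegral.norm_integral_le_abs_of_norm_le ?_
        ((intervalIntegrable_of_integrableOn_Icc hq hx hy).norm.const_mul _)
      refine ae_restrict_of_forall_mem measurableSet_uIoc fun t ht => ?_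
      have htI : t ∈ Set.Icc (0 : ℝ) 1 := by
        rcases Set.mem_uIoc.1 ht with h | h
        · exact ⟨hx.1.trans h.1.le, h.2.trans hy.2⟩
        · exact ⟨hy.1.trans h.1.le, h.2.trans hx.2⟩
      rw [norm_mul]
      refine mul_le_mul_of_nonneg_right ((hlip t htI y hy).trans ?_) (norm_nonneg _)
      have hK0 : 0 ≤ K := (norm_nonneg _).trans (hK 0 h0)
      refine mul_le_mul_of_nonneg_left ?_ hK0
      rw [Real.norm_eq_abs, Real.norm_eq_abs]
      rcases Set.mem_uIoc.1 ht with h | h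
      · rw [abs_of_nonneg (by linarith), abs_of_nonneg (by linarith)]; linarith
      · rw [abs_of_nonpos (by linarith), abs_of_nonpos (by linarith)]; linarith
    rw [intervalIntegral.integral_const_mul, abs_mul, abs_mul, abs_of_nonneg
      ((norm_nonneg _).trans (hK 0 h0)), abs_of_nonneg (norm_nonneg (y - x))] at hb
    simp only [intervalIntegral.integral_same, sub_zero, smul_zero]
    rcases eq_or_ne y x with rfl | hne
    · simp
    · have hpos : 0 < ‖y - x‖ := norm_pos_iff.2 (sub_ne_zero.2 hne)
      rw [inv_mul_le_iff₀ hpos]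
      calc _ ≤ _ := hb
        _ = _ := by ring
  have hmain := (((hF x).hasDerivWithinAt (s := Set.Icc 0 1)).mul_const
    (∫ t in (0 : ℝ)..x, q t)).add (hG.sub_const (∫ t in (0 : ℝ)..x, F t * q t))
  rw [add_zero] at hmain
  refine hmain.congr_of_mem (fun y hy => ?_) hx
  have e1 : ∫ t in x..y, (F y - F t) * q t
      = F y * (∫ t in x..y, q t) - ∫ t in x..y, F t * q t := by
    rw [← intervalIntegral.integral_const_mul, ← intervalIntegral.integral_sub
      ((intervalIntegrable_of_integrableOn_Icc hq hx hy).const_mul _)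
      (intervalIntegrable_of_integrableOn_Icc hFq hx hy)]
    simp only [sub_mul]
  have e2 := intervalIntegral.integral_add_adjacent_intervals
    (intervalIntegrable_of_integrableOn_Icc hq h0 hx)
    (intervalIntegrable_of_integrableOn_Icc hq hx hy)
  have e3 := intervalIntegral.integral_add_adjacent_intervals
    (intervalIntegrable_of_integrableOn_Icc hFq h0 hx)
    (intervalIntegrable_of_integrableOn_Icc hFq hx hy)
  simp only [Pi.add_apply]
  rw [e1, ← e2, ← e3]
  ring

/-! ### The equation `-u'' = w² u + g` on the unit interval -/

/-- The solution of `-u'' = w² u` with `u 0 = 1` and `u' 0 = 0`. -/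
noncomputable def cosSol (w : ℂ) (x : ℝ) : ℂ := Complex.cos (w * x)

open Classical in
/-- The solution of `-u'' = w² u` with `u 0 = 0` and `u' 0 = 1`. -/
noncomputable def sinSol (w : ℂ) (x : ℝ) : ℂ := if w = 0 then x else Complex.sin (w * x) / w

theorem hasDerivAt_cosSol (w : ℂ) (x : ℝ) :
    HasDerivAt (cosSol w) (-(w ^ 2 * sinSol w x)) x := by
  have h : HasDerivAt (fun y : ℝ => w * (y : ℂ)) (w * 1) x :=
    (Complex.ofRealCLM.hasDerivAt (x := x)).const_mul w
  have h2 : HasDerivAt (cosSol w) (-Complex.sin (w * x) * (w * 1)) x :=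
    (Complex.hasDerivAt_cos _).comp x h
  refine h2.congr_deriv ?_
  unfold sinSol
  split_ifs with hw
  · simp [hw]
  · field_simp

theorem hasDerivAt_sinSol (w : ℂ) (x : ℝ) : HasDerivAt (sinSol w) (cosSol w x) x := by
  unfold sinSol cosSol
  by_cases hw : w = 0
  · simp only [hw, if_true, zero_mul, Complex.cos_zero]
    exact Complex.ofRealCLM.hasDerivAt (x := x)
  · simp only [hw, if_false]
    have h : HasDerivAt (fun y : ℝ => w * (y : ℂ)) (w * 1) x :=
      (Complex.ofRealCLM.hasDerivAt (x := x)).const_mul w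
    have h2 : HasDerivAt (fun y : ℝ => Complex.sin (w * y)) (Complex.cos (w * x) * (w * 1)) x :=
      (Complex.hasDerivAt_sin _).comp x h
    refine (h2.div_const w).congr_deriv ?_
    field_simp

theorem continuous_cosSol (w : ℂ) : Continuous (cosSol w) :=
  continuous_iff_continuousAt.2 fun x => (hasDerivAt_cosSol w x).continuousAt

theorem continuous_sinSol (w : ℂ) : Continuous (sinSol w) :=
  continuous_iff_continuousAt.2 fun x => (hasDerivAt_sinSol w x).continuousAt

theorem cosSol_zero (w : ℂ) : cosSol w 0 = 1 := by simp [cosSol]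

theorem sinSol_zero (w : ℂ) : sinSol w 0 = 0 := by simp [sinSol]

theorem cosSol_one (w : ℂ) : cosSol w 1 = Complex.cos w := by simp [cosSol]

theorem sinSol_one_eq_zero_iff (w : ℂ) : sinSol w 1 = 0 ↔ w ≠ 0 ∧ Complex.sin w = 0 := by
  unfold sinSol
  split_ifs with hw <;> simp [hw]

theorem cosSol_sq_add (w : ℂ) (x : ℝ) : cosSol w x ^ 2 + w ^ 2 * sinSol w x ^ 2 = 1 := by
  unfold sinSol cosSol
  split_ifs with hw
  · simp [hw]
  · field_simp
    rw [add_comm]; exact Complex.sin_sq_add_cos_sq _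

/-- Solutions of `-u'' = w² u` are determined by their initial values. -/
theorem IsH2Rep.eq_cosSol_sinSol {f : EdgeL2} {w : ℂ} {u v : ℝ → ℂ}
    (h : IsH2Rep f (w ^ 2 • f) u v) {x : ℝ} (hx : x ∈ Set.Icc (0 : ℝ) 1) :
    u x = u 0 * cosSol w x + v 0 * sinSol w x ∧
      v x = -(w ^ 2 * (u 0 * sinSol w x)) + v 0 * cosSol w x := by
  have h0 : (0 : ℝ) ∈ Set.Icc (0 : ℝ) 1 := ⟨le_rfl, zero_le_one⟩
  have huc : ContinuousOn u (Set.Icc 0 1) := fun y hy => (h.deriv_fst y hy).continuousWithinAt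
  have hui : IntegrableOn u (Set.Icc (0 : ℝ) 1) volume := huc.integrableOn_Icc
  have hv : ∀ y ∈ Set.Icc (0 : ℝ) 1, v y = v 0 - w ^ 2 * ∫ t in (0 : ℝ)..y, u t := by
    intro y hy
    rw [h.deriv_snd y hy, ← intervalIntegral.integral_const_mul]
    congr 1
    refine EdgeL2.integral_congr hy ?_
    filter_upwards [h.ae_eq, Lp.coeFn_smul (w ^ 2) f] with t h1 h2
    rw [h2, Pi.smul_apply, h1, smul_eq_mul]
  have hv' : ∀ y ∈ Set.Icc (0 : ℝ) 1,
      HasDerivWithinAt v (-(w ^ 2 * u y)) (Set.Icc 0 1) y := by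
    intro y hy
    have hd : HasDerivWithinAt (fun b => ∫ t in (0 : ℝ)..b, u t) (u y) (Set.Icc 0 1) y := by
      have : Fact (y ∈ Set.Icc (0 : ℝ) 1) := ⟨hy⟩
      exact intervalIntegral.integral_hasDerivWithinAt_right
        (intervalIntegrable_of_integrableOn_Icc hui h0 hy)
        (huc.stronglyMeasurableAtFilter_nhdsWithin measurableSet_Icc y) (huc y hy)
    refine (((hd.const_mul (w ^ 2)).const_sub (v 0)).congr_of_mem (fun z hz => hv z hz) hy)
  have hconst : ∀ (F : ℝ → ℂ), (∀ y ∈ Set.Icc (0 : ℝ) 1,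
      HasDerivWithinAt F 0 (Set.Icc 0 1) y) → F x = F 0 := by
    intro F hF
    refine (convex_Icc (0 : ℝ) 1).is_const_of_fderivWithin_eq_zero (𝕜 := ℝ)
      (fun y hy => (hF y hy).differentiableWithinAt) (fun y hy => ?_) hx h0
    rw [(hF y hy).hasFDerivWithinAt.fderivWithin (uniqueDiffOn_Icc zero_lt_one y hy)]
    ext; simp
  -- The Wronskians of u with the two fundamental solutions are constant; with cos² + w² sin² = 1
  -- the resulting 2×2 system is solved for u x and v x.
  have e1 := hconst (fun y => u y * cosSol w y - v y * sinSol w y) fun y hy => by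
    refine (((h.deriv_fst y hy).mul (hasDerivAt_cosSol w y).hasDerivWithinAt).sub
      ((hv' y hy).mul (hasDerivAt_sinSol w y).hasDerivWithinAt)).congr_deriv ?_
    ring
  have e2 := hconst (fun y => w ^ 2 * (u y * sinSol w y) + v y * cosSol w y) fun y hy => by
    refine ((((h.deriv_fst y hy).mul (hasDerivAt_sinSol w y).hasDerivWithinAt).const_mul
      (w ^ 2)).add ((hv' y hy).mul (hasDerivAt_cosSol w y).hasDerivWithinAt)).congr_deriv ?_
    ring
  simp only [cosSol_zero, sinSol_zero, mul_one, mul_zero, sub_zero, zero_add] at e1 e2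
  have e3 := cosSol_sq_add w x
  constructor
  · linear_combination cosSol w x * e1 + sinSol w x * e2 - u x * e3
  · linear_combination cosSol w x * e2 - w ^ 2 * sinSol w x * e1 - v x * e3

/-- Twice continuously differentiable functions are in `H²(0,1)`. -/
theorem IsH2Rep.of_hasDerivAt {f g : EdgeL2} {u v v' : ℝ → ℂ}
    (hf : f =ᵐ[volume.restrict (Set.Icc (0 : ℝ) 1)] u)
    (hg : g =ᵐ[volume.restrict (Set.Icc (0 : ℝ) 1)] v')
    (hu : ∀ x, HasDerivAt u (v x) x) (hv : ∀ x, HasDerivAt v (-v' x) x)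
    (hv' : Continuous v') : IsH2Rep f g u v where
  ae_eq := hf
  deriv_fst x _ := (hu x).hasDerivWithinAt
  deriv_snd x hx := by
    have := intervalIntegral.integral_eq_sub_of_hasDerivAt (a := 0) (b := x)
      (fun y _ => hv y) (hv'.neg.intervalIntegrable 0 x)
    rw [EdgeL2.integral_congr hx hg]
    rw [intervalIntegral.integral_neg] at this
    linear_combination -this

/-- The element of `L²([0,1])` given by `cosSol`. -/
noncomputable def cosEdge (w : ℂ) : EdgeL2 :=
  EdgeL2.ofContinuous (cosSol w) (continuous_cosSol w).continuousOn

/-- The element of `L²([0,1])` given by `sinSol`. -/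
noncomputable def sinEdge (w : ℂ) : EdgeL2 :=
  EdgeL2.ofContinuous (sinSol w) (continuous_sinSol w).continuousOn

theorem isH2Rep_cosEdge (w : ℂ) :
    IsH2Rep (cosEdge w) (w ^ 2 • cosEdge w) (cosSol w) (fun x => -(w ^ 2 * sinSol w x)) := by
  have h := EdgeL2.coeFn_ofContinuous (cosSol w) (continuous_cosSol w).continuousOn
  refine IsH2Rep.of_hasDerivAt (v' := fun x => w ^ 2 * cosSol w x) h ?_ (hasDerivAt_cosSol w)
    (fun x => ((hasDerivAt_sinSol w x).const_mul (w ^ 2)).neg)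
    ((continuous_cosSol w).const_mul _)
  filter_upwards [h, Lp.coeFn_smul (w ^ 2) (cosEdge w)] with x h1 h2
  rw [h2, Pi.smul_apply, smul_eq_mul, cosEdge, h1]

theorem isH2Rep_sinEdge (w : ℂ) :
    IsH2Rep (sinEdge w) (w ^ 2 • sinEdge w) (sinSol w) (cosSol w) := by
  have h := EdgeL2.coeFn_ofContinuous (sinSol w) (continuous_sinSol w).continuousOn
  refine IsH2Rep.of_hasDerivAt (v' := fun x => w ^ 2 * sinSol w x) h ?_ (hasDerivAt_sinSol w)
    (hasDerivAt_cosSol w) ((continuous_sinSol w).const_mul _)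
  filter_upwards [h, Lp.coeFn_smul (w ^ 2) (sinEdge w)] with x h1 h2
  rw [h2, Pi.smul_apply, smul_eq_mul, sinEdge, h1]

theorem IsH2Rep.congr {f g f' g' : EdgeL2} {u v u' v' : ℝ → ℂ} (h : IsH2Rep f g u v)
    (hf : f' = f) (hg : g' = g) (hu : u' = u) (hv : v' = v) : IsH2Rep f' g' u' v' := by
  subst hf hg hu hv; exact h

theorem isH2Rep_cosEdge_add_sinEdge (w a b : ℂ) :
    IsH2Rep (a • cosEdge w + b • sinEdge w) (w ^ 2 • (a • cosEdge w + b • sinEdge w))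
      (fun x => a * cosSol w x + b * sinSol w x)
      (fun x => -(w ^ 2 * (a * sinSol w x)) + b * cosSol w x) := by
  refine (((isH2Rep_cosEdge w).smul a).add ((isH2Rep_sinEdge w).smul b)).congr rfl ?_ ?_ ?_
  · rw [smul_add, smul_comm _ a, smul_comm _ b]
  · rfl
  · ext x; simp only [Pi.add_apply, Pi.smul_apply, smul_eq_mul]; ring

/-- The `H²` representative is unique on the interval. -/
theorem IsH2Rep.unique {f g g' : EdgeL2} {u v u' v' : ℝ → ℂ} (h : IsH2Rep f g u v)
    (h' : IsH2Rep f g' u' v') {x : ℝ} (hx : x ∈ Set.Icc (0 : ℝ) 1) : u x = u' x ∧ v x = v' x := by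
  have hu : Set.EqOn u u' (Set.Icc 0 1) :=
    Measure.eqOn_Icc_of_ae_eq volume zero_ne_one (h.ae_eq.symm.trans h'.ae_eq)
      (fun x hx => (h.deriv_fst x hx).continuousWithinAt)
      (fun x hx => (h'.deriv_fst x hx).continuousWithinAt)
  exact ⟨hu hx, (uniqueDiffOn_Icc zero_lt_one x hx).eq_deriv _ (h.deriv_fst x hx)
    ((h'.deriv_fst x hx).congr hu (hu hx))⟩

/-- The coefficients are the value and the slope at 0 of the representative, which is unique. -/
theorem cosEdge_sinEdge_eq_zero {w a b : ℂ} (h : a • cosEdge w + b • sinEdge w = 0) :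
    a = 0 ∧ b = 0 := by
  have h1 := isH2Rep_cosEdge_add_sinEdge w a b
  rw [h, smul_zero] at h1
  have := h1.unique IsH2Rep.zero (x := 0) ⟨le_rfl, zero_le_one⟩
  simpa [cosSol_zero, sinSol_zero] using this

/-- The function in `L²([0,1])` is determined by its representative. -/
theorem IsH2Rep.eq_combination {f : EdgeL2} {w : ℂ} {u v : ℝ → ℂ}
    (h : IsH2Rep f (w ^ 2 • f) u v) : f = u 0 • cosEdge w + v 0 • sinEdge w := by
  refine Lp.ext ?_
  filter_upwards [h.ae_eq, (isH2Rep_cosEdge_add_sinEdge w (u 0) (v 0)).ae_eq,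
    ae_restrict_mem measurableSet_Icc] with x h1 h2 hx
  rw [h1, h2, (h.eq_cosSol_sinSol hx).1]

/-- The Dirichlet resolvent on an edge, with the derivatives at the end points. -/
theorem exists_dirichlet_resolvent {w : ℂ} (hs : sinSol w 1 ≠ 0) :
    ∃ (D : EdgeL2 →L[ℂ] EdgeL2) (τ₀ τ₁ : EdgeL2 →L[ℂ] ℂ), ∀ g, ∃ u v,
      IsH2Rep (D g) (w ^ 2 • D g + g) u v ∧ u 0 = 0 ∧ u 1 = 0 ∧ v 0 = τ₀ g ∧ v 1 = τ₁ g := by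
  have hC := continuous_cosSol w
  have hS := continuous_sinSol w
  have h0 : (0 : ℝ) ∈ Set.Icc (0 : ℝ) 1 := ⟨le_rfl, zero_le_one⟩
  have h1 : (1 : ℝ) ∈ Set.Icc (0 : ℝ) 1 := ⟨zero_le_one, le_rfl⟩
  set IC : EdgeL2 → ℝ → ℂ := fun g x => ∫ t in (0 : ℝ)..x, cosSol w t * g t with hIC
  set IS : EdgeL2 → ℝ → ℂ := fun g x => ∫ t in (0 : ℝ)..x, sinSol w t * g t with hIS
  obtain ⟨TC, hTC⟩ := exists_clm_integral_mul hC
  obtain ⟨TS, hTS⟩ := exists_clm_integral_mul hS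
  -- Variation of constants: U is the particular solution with zero initial data plus a multiple of
  -- `sinSol`. The slope τ₀ is the one that makes U vanish at 1, and τ₁ is the resulting slope
  -- there.
  set τ₀ : EdgeL2 →L[ℂ] ℂ := TC - (cosSol w 1 / sinSol w 1) • TS with hτ₀
  set τ₁ : EdgeL2 →L[ℂ] ℂ := -((1 / sinSol w 1) • TS) with hτ₁
  set U : EdgeL2 → ℝ → ℂ := fun g x =>
    -(sinSol w x * IC g x) + cosSol w x * IS g x + τ₀ g * sinSol w x with hU
  set V : EdgeL2 → ℝ → ℂ := fun g x =>
    -(cosSol w x * IC g x) - w ^ 2 * (sinSol w x * IS g x) + τ₀ g * cosSol w x with hV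
  have hICc : ∀ g, ContinuousOn (IC g) (Set.Icc 0 1) := fun g =>
    continuousOn_integral_of_integrableOn (g.integrableOn_mul hC)
  have hISc : ∀ g, ContinuousOn (IS g) (Set.Icc 0 1) := fun g =>
    continuousOn_integral_of_integrableOn (g.integrableOn_mul hS)
  have hUc : ∀ g, ContinuousOn (U g) (Set.Icc 0 1) := fun g =>
    ((hS.continuousOn.mul (hICc g)).neg.add (hC.continuousOn.mul (hISc g))).add
      (continuousOn_const.mul hS.continuousOn)
  have hUd : ∀ g, ∀ x ∈ Set.Icc (0 : ℝ) 1,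
      HasDerivWithinAt (U g) (V g x) (Set.Icc 0 1) x := by
    intro g x hx
    have d1 := hasDerivWithinAt_mul_integral_sub (hasDerivAt_sinSol w) hC
      (g.integrableOn_mul hC) hx
    have d2 := hasDerivWithinAt_mul_integral_sub (hasDerivAt_cosSol w)
      (hS.const_mul (w ^ 2)).neg (g.integrableOn_mul hS) hx
    have d3 := ((hasDerivAt_sinSol w x).const_mul (τ₀ g)).hasDerivWithinAt (s := Set.Icc 0 1)
    refine (((d1.neg.add d2).add d3).congr_deriv ?_).congr_of_mem (fun y hy => ?_) hx
    · simp only [hV, hIC, hIS]; ring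
    -- The integrals of cos·sin·g left over by the two integrations by parts cancel.
    · have : ∀ t, cosSol w t * (sinSol w t * g t) = sinSol w t * (cosSol w t * g t) :=
        fun t => by ring
      simp only [hU, hIC, hIS, Pi.add_apply, Pi.neg_apply, this]
      ring
  obtain ⟨KC, hKC0, hKC⟩ := exists_norm_integral_mul_le hC
  obtain ⟨KS, hKS0, hKS⟩ := exists_norm_integral_mul_le hS
  obtain ⟨MC, hMC⟩ := (isCompact_Icc (a := (0 : ℝ)) (b := 1)).exists_bound_of_continuousOn
    hC.continuousOn
  obtain ⟨MS, hMS⟩ := (isCompact_Icc (a := (0 : ℝ)) (b := 1)).exists_bound_of_continuousOn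
    hS.continuousOn
  have hMC0 : 0 ≤ MC := (norm_nonneg _).trans (hMC 0 h0)
  have hMS0 : 0 ≤ MS := (norm_nonneg _).trans (hMS 0 h0)
  obtain ⟨D, hD⟩ := exists_clm_of_pointwise_bound U
    (fun g g' x hx => by
      simp only [hU, hIC, hIS, map_add, EdgeL2.integral_mul_add hC g g' hx,
        EdgeL2.integral_mul_add hS g g' hx]
      ring)
    (fun c g x hx => by
      simp only [hU, hIC, hIS, map_smul, EdgeL2.integral_mul_smul c g hx, smul_eq_mul]
      ring)
    hUc (MS * KC + MC * KS + ‖τ₀‖ * MS) (by positivity)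
    (fun g x hx => by
      have a1 : ‖sinSol w x * IC g x‖ ≤ MS * (KC * ‖g‖) := by
        rw [norm_mul]; exact mul_le_mul (hMS x hx) (hKC g x hx) (norm_nonneg _) hMS0
      have a2 : ‖cosSol w x * IS g x‖ ≤ MC * (KS * ‖g‖) := by
        rw [norm_mul]; exact mul_le_mul (hMC x hx) (hKS g x hx) (norm_nonneg _) hMC0
      have a3 : ‖τ₀ g * sinSol w x‖ ≤ ‖τ₀‖ * ‖g‖ * MS := by
        rw [norm_mul]
        exact mul_le_mul (τ₀.le_opNorm g) (hMS x hx) (norm_nonneg _) (by positivity)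
      calc ‖U g x‖ ≤ ‖sinSol w x * IC g x‖ + ‖cosSol w x * IS g x‖ + ‖τ₀ g * sinSol w x‖ := by
            refine (norm_add_le _ _).trans (add_le_add ((norm_add_le _ _).trans ?_) le_rfl)
            rw [norm_neg]
        _ ≤ _ := add_le_add (add_le_add a1 a2) a3
        _ = _ := by ring)
  refine ⟨D, τ₀, τ₁, fun g => ⟨U g, V g, ⟨hD g, hUd g, fun x hx => ?_⟩, ?_, ?_, ?_, ?_⟩⟩
  · have hq := (g.integrableOn_mul hC)
    have hq' := (g.integrableOn_mul hS)
    have hint : ∫ t in (0 : ℝ)..x, (w ^ 2 • D g + g) t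
        = w ^ 2 * (∫ t in (0 : ℝ)..x, U g t) + (∫ t in (0 : ℝ)..x, cosSol w t * (cosSol w t * g t))
          + w ^ 2 * ∫ t in (0 : ℝ)..x, sinSol w t * (sinSol w t * g t) := by
      have i1 := intervalIntegrable_of_integrableOn_Icc
        (hq.continuousOn_mul hC.continuousOn isCompact_Icc) h0 hx
      have i2 := intervalIntegrable_of_integrableOn_Icc
        (hq'.continuousOn_mul hS.continuousOn isCompact_Icc) h0 hx
      have i3 := intervalIntegrable_of_integrableOn_Icc (hUc g).integrableOn_Icc h0 hx
      rw [← intervalIntegral.integral_const_mul, ← intervalIntegral.integral_const_mul,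
        ← intervalIntegral.integral_add (i3.const_mul _) i1,
        ← intervalIntegral.integral_add ((i3.const_mul _).add i1) (i2.const_mul _)]
      refine EdgeL2.integral_congr hx ?_
      filter_upwards [Lp.coeFn_add (w ^ 2 • D g) g, Lp.coeFn_smul (w ^ 2) (D g), hD g]
        with t t1 t2 t3
      rw [t1, Pi.add_apply, t2, Pi.smul_apply, t3, smul_eq_mul]
      linear_combination -(g t) * cosSol_sq_add w t
    -- V need not be differentiable everywhere, since g is only square integrable. Adding the
    -- primitive of (cos² + w² sin²) g = g removes the rough part and leaves a C¹ function, to which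
    -- the fundamental theorem applies.
    have key : ∀ y ∈ Set.Icc (0 : ℝ) 1, HasDerivWithinAt (fun y => V g y
        + (∫ t in (0 : ℝ)..y, cosSol w t * (cosSol w t * g t))
        + w ^ 2 * ∫ t in (0 : ℝ)..y, sinSol w t * (sinSol w t * g t))
        (-(w ^ 2 * U g y)) (Set.Icc 0 1) y := by
      intro y hy
      have d1 := hasDerivWithinAt_mul_integral_sub (hasDerivAt_cosSol w)
        (hS.const_mul (w ^ 2)).neg hq hy
      have d2 := hasDerivWithinAt_mul_integral_sub (hasDerivAt_sinSol w) hC hq' hy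
      have d3 := ((hasDerivAt_cosSol w y).const_mul (τ₀ g)).hasDerivWithinAt (s := Set.Icc 0 1)
      refine (((d1.neg.sub (d2.const_mul (w ^ 2))).add d3).congr_deriv ?_).congr_of_mem
        (fun z hz => ?_) hy
      · simp only [hU, hIC, hIS]; ring
      · simp only [hV, hIC, hIS, Pi.add_apply, Pi.neg_apply, Pi.sub_apply]
        ring
    have hcU : ContinuousOn (fun y => -(w ^ 2 * U g y)) (Set.Icc 0 1) :=
      (continuousOn_const.mul (hUc g)).neg
    have hftc := intervalIntegral.integral_eq_sub_of_hasDeriv_right_of_le hx.1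
      (fun y hy => ((key y ⟨hy.1, hy.2.trans hx.2⟩).continuousWithinAt).mono
        (Set.Icc_subset_Icc_right hx.2))
      (fun y hy => (((key y ⟨hy.1.le, hy.2.le.trans hx.2⟩).hasDerivAt
        (Icc_mem_nhds hy.1 (hy.2.trans_le hx.2))).hasDerivWithinAt))
      (intervalIntegrable_of_integrableOn_Icc hcU.integrableOn_Icc h0 hx)
    rw [intervalIntegral.integral_neg, intervalIntegral.integral_const_mul] at hftc
    simp only [intervalIntegral.integral_same, mul_zero, add_zero] at hftc
    rw [hint]
    linear_combination -hftc
  · simp [hU, hIC, hIS, sinSol_zero]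
  · simp only [hU, hIC, hIS, hτ₀, sub_apply, smul_apply,
      hTC, hTS, smul_eq_mul]
    field_simp
    ring
  · simp [hV, hIC, hIS, sinSol_zero, cosSol_zero]
  · simp only [hV, hIC, hIS, hτ₀, hτ₁, sub_apply,
      neg_apply, smul_apply, hTC, hTS, smul_eq_mul]
    field_simp
    linear_combination -(∫ t in (0 : ℝ)..1, sinSol w t * g t) * cosSol_sq_add w 1

/-- A function with prescribed jump of the derivative at `0` and all other boundary values zero,
together with a functional recovering the value at `0` of solutions of `-u'' = w² u`. -/
theorem exists_bump (w : ℂ) : ∃ (β h : EdgeL2) (Q : EdgeL2 →L[ℂ] ℂ) (u v : ℝ → ℂ),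
    IsH2Rep β (w ^ 2 • β + h) u v ∧ u 0 = 0 ∧ u 1 = 0 ∧ v 0 = 1 ∧ v 1 = 0 ∧
      ∀ a b : ℂ, Q (a • cosEdge w + b • sinEdge w) = a := by
  -- The cubic with u(0) = u(1) = u'(1) = 0 and u'(0) = 1. Below, v = u' and k = -u'' - w² u.
  set u : ℝ → ℂ := fun x => x * (1 - x) ^ 2 with hu
  set v : ℝ → ℂ := fun x => 1 - 4 * x + 3 * (x : ℂ) ^ 2 with hv
  set k : ℝ → ℂ := fun x => 4 - 6 * x - w ^ 2 * u x with hk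
  have dx : ∀ x : ℝ, HasDerivAt (fun y : ℝ => (y : ℂ)) 1 x := fun x =>
    Complex.ofRealCLM.hasDerivAt (x := x)
  have du : ∀ x, HasDerivAt u (v x) x := fun x => by
    refine ((dx x).mul (((dx x).const_sub 1).pow 2)).congr_deriv ?_
    simp only [hv, Pi.pow_apply]; push_cast; ring
  have dv : ∀ x : ℝ, HasDerivAt v (-(4 - 6 * (x : ℂ))) x := fun x => by
    refine ((((dx x).const_mul 4).const_sub 1).add (((dx x).pow 2).const_mul 3)).congr_deriv ?_
    push_cast; ring
  have hcu : Continuous u := continuous_iff_continuousAt.2 fun x => (du x).continuousAt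
  have hck : Continuous k := by fun_prop
  obtain ⟨Q, hQ⟩ := exists_clm_integral_mul hck
  have hβ := EdgeL2.coeFn_ofContinuous u hcu.continuousOn
  have hh := EdgeL2.coeFn_ofContinuous k hck.continuousOn
  refine ⟨EdgeL2.ofContinuous u hcu.continuousOn, EdgeL2.ofContinuous k hck.continuousOn, Q, u, v,
    IsH2Rep.of_hasDerivAt (v' := fun x => 4 - 6 * (x : ℂ)) hβ ?_ du dv (by fun_prop), by simp [hu], by simp [hu], by simp [hv],
    by norm_num [hv], fun a b => ?_⟩
  · filter_upwards [hβ, hh, Lp.coeFn_add (w ^ 2 • EdgeL2.ofContinuous u hcu.continuousOn)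
      (EdgeL2.ofContinuous k hck.continuousOn), Lp.coeFn_smul (w ^ 2)
      (EdgeL2.ofContinuous u hcu.continuousOn)] with x h1 h2 h3 h4
    rw [h3, Pi.add_apply, h4, Pi.smul_apply, h1, h2, smul_eq_mul, hk]
    ring
  · have hrep := isH2Rep_cosEdge_add_sinEdge w a b
    set p : ℝ → ℂ := fun x => a * cosSol w x + b * sinSol w x with hp
    set q : ℝ → ℂ := fun x => -(w ^ 2 * (a * sinSol w x)) + b * cosSol w x with hq
    have dp : ∀ x, HasDerivAt p (q x) x := fun x => by
      refine (((hasDerivAt_cosSol w x).const_mul a).add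
        ((hasDerivAt_sinSol w x).const_mul b)).congr_deriv ?_
      simp only [hq]; ring
    have dq : ∀ x, HasDerivAt q (-(w ^ 2 * p x)) x := fun x => by
      refine (((((hasDerivAt_sinSol w x).const_mul a).const_mul (w ^ 2)).neg).add
        ((hasDerivAt_cosSol w x).const_mul b)).congr_deriv ?_
      simp only [hp]; ring
    have hcp : Continuous p := continuous_iff_continuousAt.2 fun x => (dp x).continuousAt
    -- Green's identity: for a solution p with derivative q, ∫ k p is the boundary term of q u - p
    -- v, and the boundary values of u and v reduce it to p(0).
    have hd : ∀ x, HasDerivAt (fun y => q y * u y - p y * v y) (k x * p x) x := fun x => by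
      refine (((dq x).mul (du x)).sub ((dp x).mul (dv x))).congr_deriv ?_
      simp only [hk]; ring
    rw [hQ, EdgeL2.integral_congr (g' := fun t => k t * p t) ⟨zero_le_one, le_rfl⟩ (by
      filter_upwards [hrep.ae_eq] with x hx
      rw [hx]), intervalIntegral.integral_eq_sub_of_hasDerivAt (fun x _ => hd x)
        ((hck.mul hcp).intervalIntegrable 0 1)]
    simp only [hp, hq, hu, hv, cosSol_zero, sinSol_zero]
    push_cast
    ring

/-! ### Bounded operators between spaces of square summable families -/

section lpOperators

theorem lp_sum_sq_le {α F : Type*} [NormedAddCommGroup F] (f : lp (fun _ : α => F) 2)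
    (s : Finset α) : ∑ a ∈ s, ‖f a‖ ^ 2 ≤ ‖f‖ ^ 2 := by
  have := lp.sum_rpow_le_norm_rpow (p := 2) (by norm_num) f s
  simpa using this

theorem memℓp_two_of_sum_le {β F : Type*} [NormedAddCommGroup F] {f : β → F} {C : ℝ}
    (h : ∀ s : Finset β, ∑ b ∈ s, ‖f b‖ ^ 2 ≤ C) : Memℓp f 2 := by
  refine memℓp_gen' (C := C) fun s => ?_
  simpa using h s

theorem lp_sum_apply {α F κ : Type*} [NormedAddCommGroup F] (s : Finset κ)
    (f : κ → lp (fun _ : α => F) 2) (a : α) : (∑ i ∈ s, f i) a = ∑ i ∈ s, f i a := by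
  rw [lp.coeFn_sum, Finset.sum_apply]

variable {α β F F' : Type*} [NormedAddCommGroup F] [NormedSpace ℂ F] [NormedAddCommGroup F']
  [NormedSpace ℂ F']

/-- A bounded operator between spaces of square summable families from its components. -/
noncomputable def lpMk (Λ : lp (fun _ : α => F) 2 →ₗ[ℂ] (β → F')) (C : ℝ) (hC : 0 ≤ C)
    (h : ∀ f, ∀ s : Finset β, ∑ b ∈ s, ‖Λ f b‖ ^ 2 ≤ (C * ‖f‖) ^ 2) :
    lp (fun _ : α => F) 2 →L[ℂ] lp (fun _ : β => F') 2 :=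
  LinearMap.mkContinuous
    { toFun := fun f => ⟨Λ f, memℓp_two_of_sum_le (h f)⟩
      map_add' := fun f g => lp.ext (by
        show (Λ (f + g) : β → F') = Λ f + Λ g
        rw [map_add])
      map_smul' := fun c f => lp.ext (by
        show (Λ (c • f) : β → F') = c • Λ f
        rw [map_smul]) } C
    (fun f => lp.norm_le_of_forall_sum_le (by norm_num) (mul_nonneg hC (norm_nonneg f))
      fun s => by simpa using h f s)

theorem norm_lpMk_le (Λ : lp (fun _ : α => F) 2 →ₗ[ℂ] (β → F')) (C : ℝ) (hC : 0 ≤ C)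
    (h : ∀ f, ∀ s : Finset β, ∑ b ∈ s, ‖Λ f b‖ ^ 2 ≤ (C * ‖f‖) ^ 2) : ‖lpMk Λ C hC h‖ ≤ C :=
  LinearMap.mkContinuous_norm_le _ hC _

/-- A uniformly bounded family of operators acts componentwise. -/
noncomputable def lpMap (L : α → F →L[ℂ] F') (K : ℝ) (hK : ∀ a, ‖L a‖ ≤ K) :
    lp (fun _ : α => F) 2 →L[ℂ] lp (fun _ : α => F') 2 :=
  lpMk { toFun := fun f a => L a (f a)
         map_add' := fun f g => by ext a; simp
         -- The absolute value is needed because K may be negative when the index type is empty.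
         map_smul' := fun c f => by ext a; simp } |K| (abs_nonneg K) fun f s => by
    calc ∑ a ∈ s, ‖L a (f a)‖ ^ 2 ≤ ∑ a ∈ s, |K| ^ 2 * ‖f a‖ ^ 2 := by
          refine Finset.sum_le_sum fun a _ => ?_
          rw [← mul_pow]
          refine pow_le_pow_left₀ (norm_nonneg _) ((L a).le_of_opNorm_le ?_ _) 2
          exact (hK a).trans (le_abs_self K)
      _ = |K| ^ 2 * ∑ a ∈ s, ‖f a‖ ^ 2 := (Finset.mul_sum _ _ _).symm
      _ ≤ |K| ^ 2 * ‖f‖ ^ 2 := mul_le_mul_of_nonneg_left (lp_sum_sq_le f s) (by positivity)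
      _ = (|K| * ‖f‖) ^ 2 := (mul_pow _ _ _).symm

/-- Composition with a map `σ` whose fibres are enumerated by a finite type. -/
noncomputable def lpComp {ι : Type*} [Fintype ι] (σ : α → β) (κ : α → ι)
    (h : Function.Injective fun a => (σ a, κ a)) :
    lp (fun _ : β => F) 2 →L[ℂ] lp (fun _ : α => F) 2 :=
  lpMk { toFun := fun f a => f (σ a)
         map_add' := fun f g => by ext a; simp
         map_smul' := fun c f => by ext a; simp } (Real.sqrt (Fintype.card ι))
    (Real.sqrt_nonneg _) fun f s => by
    classical
    -- Sum over the fibres of σ. On a fibre κ is injective, so each value of f is repeated at most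
    -- `Fintype.card ι` times.
    calc ∑ a ∈ s, ‖f (σ a)‖ ^ 2
        = ∑ b ∈ s.image σ, ∑ a ∈ s with σ a = b, ‖f (σ a)‖ ^ 2 :=
          (Finset.sum_fiberwise_of_maps_to (fun a ha => Finset.mem_image_of_mem σ ha) _).symm
      _ ≤ ∑ b ∈ s.image σ, (Fintype.card ι : ℝ) * ‖f b‖ ^ 2 := by
          refine Finset.sum_le_sum fun b _ => ?_
          rw [Finset.sum_congr rfl (g := fun _ => ‖f b‖ ^ 2) fun a ha => by
            rw [(Finset.mem_filter.1 ha).2], Finset.sum_const, nsmul_eq_mul]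
          refine mul_le_mul_of_nonneg_right ?_ (by positivity)
          refine Nat.cast_le.2 (Finset.card_le_card_of_injOn κ (fun a _ => Finset.mem_univ _) ?_)
          intro a ha a' ha' haa
          simp only [Finset.coe_filter, Set.mem_ofPred_eq] at ha ha'
          exact h (Prod.ext (ha.2.trans ha'.2.symm) haa)
      _ = (Fintype.card ι : ℝ) * ∑ b ∈ s.image σ, ‖f b‖ ^ 2 := (Finset.mul_sum _ _ _).symm
      _ ≤ (Fintype.card ι : ℝ) * ‖f‖ ^ 2 :=
          mul_le_mul_of_nonneg_left (lp_sum_sq_le f _) (Nat.cast_nonneg _)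
      _ = (Real.sqrt (Fintype.card ι) * ‖f‖) ^ 2 := by
          rw [mul_pow, Real.sq_sqrt (Nat.cast_nonneg _)]

theorem norm_lpComp_le {ι : Type*} [Fintype ι] (σ : α → β) (κ : α → ι)
    (h : Function.Injective fun a => (σ a, κ a)) :
    ‖(lpComp σ κ h : lp (fun _ : β => F) 2 →L[ℂ] lp (fun _ : α => F) 2)‖
      ≤ Real.sqrt (Fintype.card ι) :=
  norm_lpMk_le _ _ (Real.sqrt_nonneg _) _

/-- Composition with an injective map. -/
noncomputable def lpCompInj (σ : α → β) (h : Function.Injective σ) :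
    lp (fun _ : β => F) 2 →L[ℂ] lp (fun _ : α => F) 2 :=
  lpComp σ (fun _ => ()) fun _ _ hab => h (congrArg Prod.fst hab)

end lpOperators

/-! ### The adjacency operator of a Cayley graph -/

section Adjacency

variable {Γ ι : Type*} [AddCommGroup Γ] [Fintype ι] (gen : ι → Γ)

/-- Translation by `g` on `ℓ²(Γ)`. -/
noncomputable def translation (g : Γ) : lp (fun _ : Γ => ℂ) 2 →L[ℂ] lp (fun _ : Γ => ℂ) 2 :=
  lpCompInj (fun γ => γ + g) (add_left_injective g)

@[simp]
theorem translation_apply (g : Γ) (φ : lp (fun _ : Γ => ℂ) 2) (γ : Γ) :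
    translation g φ γ = φ (γ + g) := rfl

theorem translation_mul (g h : Γ) : translation g * translation h = translation (g + h) := by
  refine ContinuousLinearMap.ext fun φ => lp.ext (funext fun γ => ?_)
  simp [add_assoc]

theorem translation_zero : translation (0 : Γ) = 1 := by
  refine ContinuousLinearMap.ext fun φ => lp.ext (funext fun γ => ?_)
  simp

theorem translation_pow (g : Γ) (n : ℕ) : translation g ^ n = translation (n • g) := by
  induction n with
  | zero => rw [pow_zero, zero_smul, translation_zero]
  | succ n ih => rw [pow_succ, ih, translation_mul, succ_nsmul]

theorem adjoint_translation (g : Γ) :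
    ContinuousLinearMap.adjoint (translation g) = translation (-g) := by
  symm
  rw [ContinuousLinearMap.eq_adjoint_iff]
  intro φ ψ
  rw [lp.inner_eq_tsum, lp.inner_eq_tsum, ← (Equiv.addRight g).tsum_eq]
  simp

theorem norm_translation_le (g : Γ) : ‖translation g‖ ≤ 1 := by
  have h : ‖translation g‖ ≤ Real.sqrt (Fintype.card Unit) :=
    norm_lpComp_le (F := ℂ) (fun γ => γ + g) (fun _ => ())
      fun _ _ hab => add_left_injective g (congrArg Prod.fst hab)
  simpa using h

/-- The adjacency operator of the Cayley graph. -/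
noncomputable def adjacencyOp : lp (fun _ : Γ => ℂ) 2 →L[ℂ] lp (fun _ : Γ => ℂ) 2 :=
  ∑ j, (translation (gen j) + translation (-gen j))

theorem adjacencyOp_apply (φ : lp (fun _ : Γ => ℂ) 2) (γ : Γ) :
    adjacencyOp gen φ γ = ∑ j, (φ (γ + gen j) + φ (γ - gen j)) := by
  rw [adjacencyOp, sum_apply, lp_sum_apply]
  simp [sub_eq_add_neg]

theorem isSelfAdjoint_translation_add (g : Γ) :
    IsSelfAdjoint (translation g + translation (-g)) := by
  rw [IsSelfAdjoint, star_add, ContinuousLinearMap.star_eq_adjoint,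
    ContinuousLinearMap.star_eq_adjoint, adjoint_translation, adjoint_translation, neg_neg,
    add_comm]

theorem isSelfAdjoint_adjacencyOp : IsSelfAdjoint (adjacencyOp gen) :=
  isSelfAdjoint_sum _ fun j _ => isSelfAdjoint_translation_add (gen j)

theorem norm_adjacencyOp_le : ‖adjacencyOp gen‖ ≤ 2 * Fintype.card ι := by
  refine (norm_sum_le_of_le _ (n := fun _ => (2 : ℝ)) fun j _ => ?_).trans ?_
  · exact (norm_add_le _ _).trans ((add_le_add (norm_translation_le _)
      (norm_translation_le _)).trans (by norm_num))
  · simp [mul_comm]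

/-- The operator `A - 2 r c` on `ℓ²(Γ)`. -/
noncomputable def shiftedAdjacency (c : ℂ) :
    lp (fun _ : Γ => ℂ) 2 →L[ℂ] lp (fun _ : Γ => ℂ) 2 :=
  adjacencyOp gen - algebraMap ℂ _ (2 * Fintype.card ι * c)

theorem shiftedAdjacency_apply (c : ℂ) (φ : lp (fun _ : Γ => ℂ) 2) (γ : Γ) :
    shiftedAdjacency gen c φ γ
      = ∑ j, (φ (γ + gen j) + φ (γ - gen j)) - 2 * Fintype.card ι * c * φ γ := by
  rw [shiftedAdjacency, sub_apply, lp.coeFn_sub, Pi.sub_apply,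
    adjacencyOp_apply, Algebra.algebraMap_eq_smul_one]
  simp

/-- Spreading the diagonal term over the r generators allows a comparison with the Kirchhoff sum one
generator at a time. -/
theorem shiftedAdjacency_apply_eq_sum (c : ℂ) (φ : lp (fun _ : Γ => ℂ) 2) (γ : Γ) :
    shiftedAdjacency gen c φ γ
      = ∑ j, (φ (γ + gen j) + φ (γ - gen j) - 2 * c * φ γ) := by
  rw [shiftedAdjacency_apply, Finset.sum_sub_distrib, Finset.sum_const, nsmul_eq_mul,
    Finset.card_univ]
  ring

end Adjacency

/-! ### Resolvent points of unbounded operators -/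

namespace LinearPMap

variable {H : Type*} [NormedAddCommGroup H] [NormedSpace ℂ H]

/-- A bounded right inverse and a trivial kernel suffice: u - R(Tu - zu) lies in the kernel of T -
z. Phrasing this through the graph avoids domain membership proofs. -/
theorem isResolventPoint_of_graph (T : H →ₗ.[ℂ] H) (z : ℂ) (R : H →L[ℂ] H)
    (h1 : ∀ f, (R f, z • R f + f) ∈ T.graph) (h2 : ∀ x, (x, z • x) ∈ T.graph → x = 0) :
    T.IsResolventPoint z := by
  refine ⟨R, fun f => ?_, fun u => ?_⟩
  · obtain ⟨y, hy1, hy2⟩ := T.mem_graph_iff.1 (h1 f)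
    have hy : R f ∈ T.domain := by
      rw [show R f = y from hy1.symm]; exact y.2
    refine ⟨hy, ?_⟩
    have : y = ⟨R f, hy⟩ := Subtype.ext hy1
    rw [← this, hy2, add_sub_cancel_left]
  · have hu : ((u : H), T u) ∈ T.graph := T.mem_graph u
    have h3 := T.graph.sub_mem hu (h1 (T u - z • (u : H)))
    refine (sub_eq_zero.1 (h2 _ ?_)).symm
    convert h3 using 1
    simp only [Prod.mk_sub_mk, smul_sub]
    congr 1
    abel

theorem IsResolventPoint.exists_graph {T : H →ₗ.[ℂ] H} {z : ℂ} (h : T.IsResolventPoint z) :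
    ∃ R : H →L[ℂ] H, ∀ x f, (x, z • x + f) ∈ T.graph → R f = x := by
  obtain ⟨R, -, hR⟩ := h
  refine ⟨R, fun x f hx => ?_⟩
  obtain ⟨y, hy1, hy2⟩ := T.mem_graph_iff.1 hx
  have := hR y
  rwa [hy2, hy1, add_sub_cancel_left] at this

theorem not_isResolventPoint_of_eigenvector {T : H →ₗ.[ℂ] H} {z : ℂ} {x : H} (hx : x ≠ 0)
    (h : (x, z • x) ∈ T.graph) : ¬ T.IsResolventPoint z := by
  intro hz
  obtain ⟨R, hR⟩ := hz.exists_graph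
  have := hR x 0 (by rwa [add_zero])
  exact hx (this.symm.trans R.map_zero)

theorem mem_eigenspaceAt_iff (T : H →ₗ.[ℂ] H) (z : ℂ) (x : H) :
    x ∈ T.eigenspaceAt z ↔ (x, z • x) ∈ T.graph := by
  rw [T.mem_graph_iff]
  constructor
  · rintro ⟨h, e⟩
    exact ⟨⟨x, h⟩, rfl, e⟩
  · rintro ⟨y, rfl, hy⟩
    exact ⟨y.2, hy⟩

theorem isOpen_setOf_isResolventPoint [CompleteSpace H] (T : H →ₗ.[ℂ] H) :
    IsOpen {z | T.IsResolventPoint z} := by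
  rw [Metric.isOpen_iff]
  rintro z ⟨R, hR1, hR2⟩
  -- Neumann series: the resolvent at z' is R (1 - (z' - z) R)⁻¹. The summand 1 covers the case R =
  -- 0.
  refine ⟨1 / (‖R‖ + 1), by positivity, fun z' hz' => ?_⟩
  have hlt : ‖(z' - z) • R‖ < 1 := by
    rw [Metric.mem_ball, dist_eq_norm, lt_div_iff₀ (by positivity)] at hz'
    calc ‖(z' - z) • R‖ ≤ ‖z' - z‖ * ‖R‖ := (norm_smul (z' - z) R).le
      _ ≤ ‖z' - z‖ * (‖R‖ + 1) := mul_le_mul_of_nonneg_left (by linarith) (norm_nonneg _)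
      _ < 1 := hz'
  obtain ⟨u, hu⟩ := isUnit_one_sub_of_norm_lt_one hlt
  have hinv1 : ∀ f, (↑u⁻¹ : H →L[ℂ] H) f - (z' - z) • R ((↑u⁻¹ : H →L[ℂ] H) f) = f := by
    intro f
    have := congrArg (fun S : H →L[ℂ] H => S f) u.mul_inv
    simpa [hu] using this
  have hinv2 : ∀ f, (↑u⁻¹ : H →L[ℂ] H) (f - (z' - z) • R f) = f := by
    intro f
    have := congrArg (fun S : H →L[ℂ] H => S f) u.inv_mul
    simpa [hu] using this
  refine ⟨R * ↑u⁻¹, fun f => ?_, fun x => ?_⟩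
  · obtain ⟨h, e⟩ := hR1 ((↑u⁻¹ : H →L[ℂ] H) f)
    refine ⟨h, ?_⟩
    have e2 := hinv1 f
    show T ⟨R ((↑u⁻¹ : H →L[ℂ] H) f), h⟩ - z' • R ((↑u⁻¹ : H →L[ℂ] H) f) = f
    calc _ = (T ⟨R ((↑u⁻¹ : H →L[ℂ] H) f), h⟩ - z • R ((↑u⁻¹ : H →L[ℂ] H) f))
          - (z' - z) • R ((↑u⁻¹ : H →L[ℂ] H) f) := by rw [sub_smul]; abel
      _ = f := by rw [e, e2]
  · show R ((↑u⁻¹ : H →L[ℂ] H) (T x - z' • (x : H))) = x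
    have e := hR2 x
    have e2 : T x - z' • (x : H)
        = (T x - z • (x : H)) - (z' - z) • R (T x - z • (x : H)) := by
      rw [e, sub_smul]; abel
    rw [e2, hinv2, e]

end LinearPMap

/-! ### Vertex conditions on Cayley graphs and bouquets -/

theorem UnitGraph.mem_graph_iff {V E : Type*} (G : UnitGraph V E) (z : E → Circle)
    (p : GraphL2 E × GraphL2 E) :
    p ∈ (G.twistedLaplacian z).graph ↔ ∃ u w : E → ℝ → ℂ,
      (∀ e, IsH2Rep (p.1 e) (p.2 e) (u e) (w e)) ∧ G.VertexConditions z u w := by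
  rw [G.twistedLaplacian_graph]; rfl

/-- For each generator j exactly one edge arrives at γ, namely (γ - gen j, j), and exactly one
leaves, namely (γ, j). Labelling edges by pairs keeps this count right for loops and multiple edges.
-/
theorem cayleyGraph_vertexConditions_iff {Γ ι : Type*} [AddCommGroup Γ] [Fintype ι]
    (gen : ι → Γ) (u w : Γ × ι → ℝ → ℂ) :
    (cayleyGraph gen).VertexConditions 1 u w ↔
      (∃ φ : Γ → ℂ, ∀ e, u e 0 = φ e.1 ∧ u e 1 = φ (e.1 + gen e.2)) ∧
      ∀ γ, ∑ j, (w (γ - gen j, j) 1 - w (γ, j) 0) = 0 := by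
  have h1 : ∀ γ, (∑ᶠ (e : Γ × ι) (_ : e ∈ {e | (cayleyGraph gen).tgt e = γ}), w e 1)
      = ∑ j, w (γ - gen j, j) 1 := by
    intro γ
    have : {e | (cayleyGraph gen).tgt e = γ} = Set.range fun j => (γ - gen j, j) := by
      ext ⟨δ, j⟩
      simp only [cayleyGraph, Set.mem_ofPred_eq, Set.mem_range, Prod.mk.injEq]
      constructor
      · rintro rfl; exact ⟨j, by simp, rfl⟩
      · rintro ⟨i, rfl, rfl⟩; simp
    rw [this, finsum_mem_range (fun i j h => (Prod.ext_iff.1 h).2), finsum_eq_sum_of_fintype]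
  have h2 : ∀ γ, (∑ᶠ (e : Γ × ι) (_ : e ∈ {e | (cayleyGraph gen).src e = γ}), w e 0)
      = ∑ j, w (γ, j) 0 := by
    intro γ
    have : {e | (cayleyGraph gen).src e = γ} = Set.range fun j => (γ, j) := by
      ext ⟨δ, j⟩
      simp only [cayleyGraph, Set.mem_ofPred_eq, Set.mem_range, Prod.mk.injEq]
      constructor
      · rintro rfl; exact ⟨j, by simp, rfl⟩
      · rintro ⟨i, rfl, rfl⟩; simp
    rw [this, finsum_mem_range (fun i j h => (Prod.ext_iff.1 h).2), finsum_eq_sum_of_fintype]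
  constructor
  · rintro ⟨⟨φ, hφ⟩, hk⟩
    refine ⟨⟨φ, fun e => by simpa [cayleyGraph] using hφ e⟩, fun γ => ?_⟩
    have := hk γ
    simp only [Pi.one_apply, Circle.coe_one, inv_one, one_mul] at this
    rw [Finset.sum_sub_distrib, ← h1, ← h2]
    exact this
  · rintro ⟨⟨φ, hφ⟩, hk⟩
    refine ⟨⟨φ, fun e => by simpa [cayleyGraph] using hφ e⟩, fun γ => ?_⟩
    have := hk γ
    simp only [Pi.one_apply, Circle.coe_one, inv_one, one_mul]
    rw [Finset.sum_sub_distrib, ← h1, ← h2] at this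
    exact this

theorem bouquet_vertexConditions_iff {ι : Type*} [Fintype ι] (z : ι → Circle)
    (u w : ι → ℝ → ℂ) :
    (bouquet ι).VertexConditions z u w ↔
      (∃ c : ℂ, ∀ j, u j 0 = c ∧ (z j : ℂ)⁻¹ * u j 1 = c) ∧
      ∑ j, ((z j : ℂ)⁻¹ * w j 1 - w j 0) = 0 := by
  have h : ∀ F : ι → ℂ, (∑ᶠ (e : ι) (_ : e ∈ {_e : ι | () = ()}), F e) = ∑ j, F j := by
    intro F
    rw [← finsum_eq_sum_of_fintype]
    exact finsum_congr fun e => by simp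
  constructor
  · rintro ⟨⟨φ, hφ⟩, hk⟩
    refine ⟨⟨φ (), hφ⟩, ?_⟩
    rw [Finset.sum_sub_distrib, ← h, ← h]
    exact hk ()
  · rintro ⟨⟨c, hc⟩, hk⟩
    refine ⟨⟨fun _ => c, hc⟩, fun _ => ?_⟩
    rw [Finset.sum_sub_distrib, ← h, ← h] at hk
    exact hk

/-! ### The spectrum of a Cayley graph away from the Dirichlet spectrum -/

section CayleySpectrum

/-- An edge is recovered from its end vertex and its generator, which makes restriction to end
vertices bounded on ℓ². -/
theorem injective_tgt_snd {Γ ι : Type*} [AddCommGroup Γ] (gen : ι → Γ) :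
    Function.Injective fun e : Γ × ι => (e.1 + gen e.2, e.2) := by
  rintro ⟨γ, j⟩ ⟨δ, k⟩ h
  obtain ⟨h1, rfl⟩ := Prod.ext_iff.1 h
  exact Prod.ext (add_right_cancel h1) rfl

variable {Γ ι : Type*} [AddCommGroup Γ] [Fintype ι] (gen : ι → Γ)

/-- The extension of a function on the vertices to a solution of `-u'' = w² u` on the edges. -/
noncomputable def edgeExtension (w : ℂ) :
    lp (fun _ : Γ => ℂ) 2 →L[ℂ] GraphL2 (Γ × ι) :=
  let src : lp (fun _ : Γ => ℂ) 2 →L[ℂ] lp (fun _ : Γ × ι => ℂ) 2 :=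
    lpComp (fun e => e.1) (fun e => e.2) fun _ _ h => h
  let tgt : lp (fun _ : Γ => ℂ) 2 →L[ℂ] lp (fun _ : Γ × ι => ℂ) 2 :=
    lpComp (fun e => e.1 + gen e.2) (fun e => e.2) (injective_tgt_snd gen)
  lpMap (fun _ => ContinuousLinearMap.toSpanSingleton ℂ (cosEdge w)) _ (fun _ => le_rfl) ∘L src
    + lpMap (fun _ => ContinuousLinearMap.toSpanSingleton ℂ (sinEdge w)) _ (fun _ => le_rfl) ∘L
      ((sinSol w 1)⁻¹ • (tgt - cosSol w 1 • src))

theorem edgeExtension_apply (w : ℂ) (φ : lp (fun _ : Γ => ℂ) 2) (e : Γ × ι) :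
    edgeExtension gen w φ e = φ e.1 • cosEdge w
      + ((sinSol w 1)⁻¹ * (φ (e.1 + gen e.2) - cosSol w 1 * φ e.1)) • sinEdge w := by
  show φ e.1 • cosEdge w
      + ((sinSol w 1)⁻¹ • (φ (e.1 + gen e.2) - cosSol w 1 • φ e.1)) • sinEdge w = _
  simp only [smul_eq_mul]

/-- Solutions of `-u'' = w² u` on the edges which satisfy the vertex conditions come from the
kernel of the shifted adjacency operator. -/
theorem eq_zero_of_mem_graph_cayley [Nonempty ι] {w : ℂ} (hs : sinSol w 1 ≠ 0)
    (hM : ∀ φ, shiftedAdjacency gen (Complex.cos w) φ = 0 → φ = 0) {x : GraphL2 (Γ × ι)}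
    (hx : (x, w ^ 2 • x) ∈ (cayleyGraph gen).kirchhoffLaplacian.graph) : x = 0 := by
  obtain ⟨u, v, hrep, hv⟩ := ((cayleyGraph gen).mem_graph_iff 1 _).1 hx
  obtain ⟨⟨φ, hφ⟩, hk⟩ := (cayleyGraph_vertexConditions_iff gen u v).1 hv
  have hrep' : ∀ e, IsH2Rep (x e) (w ^ 2 • x e) (u e) (v e) := hrep
  have h1 : (1 : ℝ) ∈ Set.Icc (0 : ℝ) 1 := ⟨zero_le_one, le_rfl⟩
  obtain ⟨-, -, Q, -, -, -, -, -, -, -, hQ⟩ := exists_bump w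
  obtain ⟨j₀⟩ := ‹Nonempty ι›
  -- The vertex values φ are so far an arbitrary function. The bounded functional Q, applied on the
  -- edges in one fixed direction j₀, recovers them from x and shows that they are square summable.
  set ψ : lp (fun _ : Γ => ℂ) 2 :=
    lpMap (fun _ => Q) _ (fun _ => le_rfl) (lpCompInj (fun γ : Γ => (γ, j₀))
      (fun _ _ h => (Prod.ext_iff.1 h).1) x) with hψ
  have hψφ : ∀ γ, ψ γ = φ γ := by
    intro γ
    have : ψ γ = Q (x (γ, j₀)) := rfl
    rw [this, (hrep' (γ, j₀)).eq_combination, hQ, (hφ (γ, j₀)).1]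
  have hv0 : ∀ e, v e 0 = (sinSol w 1)⁻¹ * (φ (e.1 + gen e.2) - cosSol w 1 * φ e.1) := by
    intro e
    have := ((hrep' e).eq_cosSol_sinSol h1).1
    rw [(hφ e).1, (hφ e).2] at this
    field_simp
    linear_combination -this
  have hv1 : ∀ e, v e 1 = -(w ^ 2 * (φ e.1 * sinSol w 1)) + v e 0 * cosSol w 1 := by
    intro e
    rw [((hrep' e).eq_cosSol_sinSol h1).2, (hφ e).1]
  have hψ0 : ψ = 0 := by
    refine hM ψ (lp.ext (funext fun γ => ?_))
    rw [shiftedAdjacency_apply_eq_sum, lp.coeFn_zero, Pi.zero_apply]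
    have := hk γ
    -- The shifted adjacency operator applied to φ is -sin times the Kirchhoff sum, generator by
    -- generator.
    rw [← mul_zero (-sinSol w 1), ← this, Finset.mul_sum]
    refine Finset.sum_congr rfl fun j _ => ?_
    rw [hv1, hv0, hv0, hψφ, hψφ, hψφ, ← cosSol_one]
    simp only [sub_add_cancel]
    field_simp
    linear_combination -φ (γ - gen j) * cosSol_sq_add w 1
  have hφ0 : ∀ γ, φ γ = 0 := fun γ => by rw [← hψφ, hψ0]; rfl
  refine lp.ext (funext fun e => ?_)
  rw [(hrep' e).eq_combination, (hφ e).1, hv0, hφ0, hφ0]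
  simp

/-- Krein's resolvent formula. -/
theorem isResolventPoint_of_isUnit [Nonempty ι] {w : ℂ} (hs : sinSol w 1 ≠ 0)
    (hM : IsUnit (shiftedAdjacency gen (Complex.cos w))) :
    (cayleyGraph gen).kirchhoffLaplacian.IsResolventPoint (w ^ 2) := by
  obtain ⟨M, hMu⟩ := hM
  have hM1 : ∀ φ, shiftedAdjacency gen (Complex.cos w)
      ((↑M⁻¹ : lp (fun _ : Γ => ℂ) 2 →L[ℂ] lp (fun _ : Γ => ℂ) 2) φ) = φ := by
    intro φ
    have := congrArg (fun S : lp (fun _ : Γ => ℂ) 2 →L[ℂ] lp (fun _ : Γ => ℂ) 2 => S φ) M.mul_inv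
    simpa [hMu] using this
  have hM2 : ∀ φ, (↑M⁻¹ : lp (fun _ : Γ => ℂ) 2 →L[ℂ] lp (fun _ : Γ => ℂ) 2)
      (shiftedAdjacency gen (Complex.cos w) φ) = φ := by
    intro φ
    have := congrArg (fun S : lp (fun _ : Γ => ℂ) 2 →L[ℂ] lp (fun _ : Γ => ℂ) 2 => S φ) M.inv_mul
    simpa [hMu] using this
  obtain ⟨D, τ₀, τ₁, hD⟩ := exists_dirichlet_resolvent hs
  let D' : GraphL2 (Γ × ι) →L[ℂ] GraphL2 (Γ × ι) := lpMap (fun _ => D) _ (fun _ => le_rfl)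
  -- N f is the Kirchhoff sum of the Dirichlet solution D' f. An extension of vertex values φ has
  -- Kirchhoff sum -(sin)⁻¹ (A - 2r cos w) φ, so the choice φ = sin · (A - 2r cos w)⁻¹ N f below
  -- cancels the defect.
  let N : GraphL2 (Γ × ι) →L[ℂ] lp (fun _ : Γ => ℂ) 2 := ∑ j,
    (lpMap (fun _ => τ₁) _ (fun _ => le_rfl) ∘L lpCompInj (fun γ : Γ => (γ - gen j, j))
        (fun _ _ h => sub_left_injective (Prod.ext_iff.1 h).1)
      - lpMap (fun _ => τ₀) _ (fun _ => le_rfl) ∘L lpCompInj (fun γ : Γ => (γ, j))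
        (fun _ _ h => (Prod.ext_iff.1 h).1))
  have hN : ∀ f γ, N f γ = ∑ j, (τ₁ (f (γ - gen j, j)) - τ₀ (f (γ, j))) := by
    intro f γ
    simp only [N]
    rw [sum_apply, lp_sum_apply]
    rfl
  let Φ : GraphL2 (Γ × ι) →L[ℂ] lp (fun _ : Γ => ℂ) 2 := sinSol w 1 • (↑M⁻¹ ∘L N)
  have hΦ : ∀ f, shiftedAdjacency gen (Complex.cos w) (Φ f) = sinSol w 1 • N f := by
    intro f
    have : Φ f = sinSol w 1 •
      ((↑M⁻¹ : lp (fun _ : Γ => ℂ) 2 →L[ℂ] lp (fun _ : Γ => ℂ) 2) (N f)) := rfl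
    rw [this, map_smul, hM1]
  refine LinearPMap.isResolventPoint_of_graph _ _ (D' + edgeExtension gen w ∘L Φ) (fun f => ?_)
    (fun x hx => eq_zero_of_mem_graph_cayley gen hs (fun φ h => ?_) hx)
  · choose u v huv using fun e : Γ × ι => hD (f e)
    set φ := Φ f with hφ
    refine ((cayleyGraph gen).mem_graph_iff 1 _).2 ⟨fun e x => u e x + (φ e.1 * cosSol w x
      + ((sinSol w 1)⁻¹ * (φ (e.1 + gen e.2) - cosSol w 1 * φ e.1)) * sinSol w x),
      fun e x => v e x + (-(w ^ 2 * (φ e.1 * sinSol w x))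
      + ((sinSol w 1)⁻¹ * (φ (e.1 + gen e.2) - cosSol w 1 * φ e.1)) * cosSol w x),
      fun e => ?_, ?_⟩
    · refine ((huv e).1.add (isH2Rep_cosEdge_add_sinEdge w (φ e.1)
        ((sinSol w 1)⁻¹ * (φ (e.1 + gen e.2) - cosSol w 1 * φ e.1)))).congr ?_ ?_ rfl rfl
      · rw [← edgeExtension_apply]; rfl
      · rw [← edgeExtension_apply]
        have : (w ^ 2 • (D' + edgeExtension gen w ∘L Φ) f + f) e
          = w ^ 2 • (D (f e) + edgeExtension gen w φ e) + f e := rfl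
        rw [this, smul_add]; abel
    · rw [cayleyGraph_vertexConditions_iff]
      refine ⟨⟨φ, fun e => ⟨?_, ?_⟩⟩, fun γ => ?_⟩
      · simp [(huv e).2.1, cosSol_zero, sinSol_zero]
      · simp only [(huv e).2.2.1]
        field_simp
        ring
      · have h1 := congrArg (fun ψ : lp (fun _ : Γ => ℂ) 2 => ψ γ) (hΦ f)
        simp only [lp.coeFn_smul, Pi.smul_apply, smul_eq_mul] at h1
        rw [shiftedAdjacency_apply_eq_sum, hN, Finset.mul_sum, ← sub_eq_zero,
          ← Finset.sum_sub_distrib] at h1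
        rw [← mul_zero (-(sinSol w 1)⁻¹), ← h1, Finset.mul_sum]
        refine Finset.sum_congr rfl fun j _ => ?_
        simp only [(huv _).2.2.2.1, (huv _).2.2.2.2, cosSol_zero, sinSol_zero, sub_add_cancel,
          ← cosSol_one, ← hφ]
        field_simp
        linear_combination -φ (γ - gen j) * cosSol_sq_add w 1
  · rw [← hM2 φ, h, map_zero]

/-- Away from the Dirichlet spectrum, resolvent points of the Laplacian give left inverses of the
shifted adjacency operator. -/
theorem exists_leftInverse_of_isResolventPoint [Nonempty ι] {w : ℂ} (hs : sinSol w 1 ≠ 0)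
    (h : (cayleyGraph gen).kirchhoffLaplacian.IsResolventPoint (w ^ 2)) :
    ∃ L : lp (fun _ : Γ => ℂ) 2 →L[ℂ] lp (fun _ : Γ => ℂ) 2,
      ∀ φ, L (shiftedAdjacency gen (Complex.cos w) φ) = φ := by
  classical
  obtain ⟨R, hR⟩ := h.exists_graph
  obtain ⟨β, k, Q, u, v, hrep, hu0, hu1, hv0, hv1, hQ⟩ := exists_bump w
  obtain ⟨j₀⟩ := ‹Nonempty ι›
  let src : lp (fun _ : Γ => ℂ) 2 →L[ℂ] lp (fun _ : Γ × ι => ℂ) 2 :=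
    lpComp (fun e => e.1) (fun e => e.2) fun _ _ h => h
  -- At each vertex a single outgoing edge, the one in direction j₀, carries the correction by a
  -- bump.
  let δ : Γ × ι → ℂ := fun e => if e.2 = j₀ then 1 else 0
  have hδ : ∀ (y : EdgeL2) (e : Γ × ι),
      ‖δ e • ContinuousLinearMap.toSpanSingleton ℂ y‖
        ≤ ‖ContinuousLinearMap.toSpanSingleton ℂ y‖ := by
    intro y e
    refine (norm_smul (δ e) (ContinuousLinearMap.toSpanSingleton ℂ y)).le.trans (mul_le_of_le_one_left (norm_nonneg _) ?_)
    simp only [δ]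
    split_ifs <;> simp
  let B : EdgeL2 → lp (fun _ : Γ => ℂ) 2 →L[ℂ] GraphL2 (Γ × ι) := fun y =>
    lpMap (fun e => δ e • ContinuousLinearMap.toSpanSingleton ℂ y) _ (hδ y) ∘L src
  have hB : ∀ y ψ e, B y ψ e = (δ e * ψ e.1) • y := by
    intro y ψ e
    exact (mul_smul (δ e) (ψ e.1) y).symm
  let Q' : GraphL2 (Γ × ι) →L[ℂ] lp (fun _ : Γ => ℂ) 2 :=
    lpMap (fun _ => Q) _ (fun _ => le_rfl) ∘L lpCompInj (fun γ : Γ => (γ, j₀))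
      (fun _ _ h => (Prod.ext_iff.1 h).1)
  let M := shiftedAdjacency gen (Complex.cos w)
  -- The extension of φ fails the Kirchhoff condition by ψ = -(sin)⁻¹ (A - 2r cos w) φ. Bumps with
  -- initial slope ψ repair it without changing vertex values, at the price of the source B k ψ. The
  -- resolvent thus maps that source back to the corrected extension, from which φ can be read off.
  have key : ∀ φ, R (B k (-(sinSol w 1)⁻¹ • M φ))
      = edgeExtension gen w φ + B β (-(sinSol w 1)⁻¹ • M φ) := by
    intro φ
    set ψ := -(sinSol w 1)⁻¹ • M φ with hψ
    refine hR _ _ (((cayleyGraph gen).mem_graph_iff 1 _).2 ⟨fun e x => (φ e.1 * cosSol w x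
      + ((sinSol w 1)⁻¹ * (φ (e.1 + gen e.2) - cosSol w 1 * φ e.1)) * sinSol w x)
        + (δ e * ψ e.1) * u x,
      fun e x => (-(w ^ 2 * (φ e.1 * sinSol w x))
      + ((sinSol w 1)⁻¹ * (φ (e.1 + gen e.2) - cosSol w 1 * φ e.1)) * cosSol w x)
        + (δ e * ψ e.1) * v x,
      fun e => ?_, ?_⟩)
    · refine ((isH2Rep_cosEdge_add_sinEdge w (φ e.1)
        ((sinSol w 1)⁻¹ * (φ (e.1 + gen e.2) - cosSol w 1 * φ e.1))).add
          (hrep.smul (δ e * ψ e.1))).congr ?_ ?_ rfl rfl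
      · rw [← edgeExtension_apply, ← hB]; rfl
      · rw [← edgeExtension_apply]
        have : (w ^ 2 • (edgeExtension gen w φ + B β ψ) + B k ψ) e
          = w ^ 2 • (edgeExtension gen w φ e + B β ψ e) + B k ψ e := rfl
        rw [this, hB, hB, smul_add, smul_add, smul_comm (w ^ 2) (δ e * ψ e.1), add_assoc]
    · rw [cayleyGraph_vertexConditions_iff]
      refine ⟨⟨φ, fun e => ⟨?_, ?_⟩⟩, fun γ => ?_⟩
      · simp [hu0, cosSol_zero, sinSol_zero]
      · simp only [hu1]
        field_simp
        ring
      · have h1 : ψ γ = -(sinSol w 1)⁻¹ * M φ γ := rfl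
        have h2 : ∑ j, δ (γ, j) * ψ γ = ψ γ := by simp [δ]
        have h3 := shiftedAdjacency_apply_eq_sum gen (Complex.cos w) φ γ
        refine Eq.trans (Finset.sum_congr rfl (g := fun j => -(sinSol w 1)⁻¹ *
          (φ (γ + gen j) + φ (γ - gen j) - 2 * Complex.cos w * φ γ) - δ (γ, j) * ψ γ)
          fun j _ => ?_) ?_
        · simp only [hv0, hv1, cosSol_zero, sinSol_zero, sub_add_cancel, ← cosSol_one]
          field_simp
          linear_combination -φ (γ - gen j) * cosSol_sq_add w 1
        · rw [Finset.sum_sub_distrib, h2, ← Finset.mul_sum, ← h3, h1, sub_self]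
  have hQ' : ∀ φ, Q' (edgeExtension gen w φ) = φ := by
    intro φ
    refine lp.ext (funext fun γ => ?_)
    have : Q' (edgeExtension gen w φ) γ = Q (edgeExtension gen w φ (γ, j₀)) := rfl
    rw [this, edgeExtension_apply, hQ]
  refine ⟨-(sinSol w 1)⁻¹ • (Q' ∘L (R ∘L B k - B β)), fun φ => ?_⟩
  have : (-(sinSol w 1)⁻¹ • (Q' ∘L (R ∘L B k - B β))) (M φ)
      = Q' (R (B k (-(sinSol w 1)⁻¹ • M φ)) - B β (-(sinSol w 1)⁻¹ • M φ)) := by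
    simp only [map_smul, ← smul_sub]
    rfl
  rw [this, key, add_sub_cancel_right, hQ']

end CayleySpectrum

/-! ### Compactly supported eigenfunctions -/

theorem sinSol_one_odd_mul_pi (l : ℕ) : sinSol (((2 * (l : ℝ) + 1) * Real.pi : ℝ) : ℂ) 1 = 0 := by
  rw [sinSol_one_eq_zero_iff]
  constructor
  · have : (2 * (l : ℝ) + 1) * Real.pi ≠ 0 := by positivity
    exact_mod_cast this
  · rw [← Complex.ofReal_sin, Complex.ofReal_eq_zero,
      show (2 * (l : ℝ) + 1) * Real.pi = ((2 * l + 1 : ℕ) : ℝ) * Real.pi by push_cast; ring]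
    exact Real.sin_nat_mul_pi _

theorem cos_odd_mul_pi (l : ℕ) : Real.cos ((2 * (l : ℝ) + 1) * Real.pi) = -1 := by
  rw [show (2 * (l : ℝ) + 1) * Real.pi = Real.pi + l * (2 * Real.pi) by ring,
    Real.cos_add_nat_mul_two_pi, Real.cos_pi]

theorem cosSol_one_odd_mul_pi (l : ℕ) :
    cosSol (((2 * (l : ℝ) + 1) * Real.pi : ℝ) : ℂ) 1 = -1 := by
  rw [cosSol_one, ← Complex.ofReal_cos, cos_odd_mul_pi]
  simp

/-- A Cayley graph with at least two generators has compactly supported eigenfunctions. -/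
theorem not_isResolventPoint_odd_mul_pi_sq {Γ ι : Type*} [AddCommGroup Γ] [Fintype ι]
    (gen : ι → Γ) {j k : ι} (hjk : j ≠ k) (l : ℕ) :
    ¬ (cayleyGraph gen).kirchhoffLaplacian.IsResolventPoint
      ((((2 * (l : ℝ) + 1) * Real.pi : ℝ) : ℂ) ^ 2) := by
  classical
  set w : ℂ := (((2 * (l : ℝ) + 1) * Real.pi : ℝ) : ℂ) with hw
  set d : Γ → ℂ := fun γ => if γ = 0 then 1 else 0 with hd
  -- Amplitudes of sine waves on the closed path 0, gen j, gen j + gen k, gen k: positive on the two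
  -- j-edges, negative on the two k-edges. At an odd multiple of π the slopes at the two ends of an
  -- edge are opposite, so these alternating signs give Kirchhoff's condition.
  set c : Γ × ι → ℂ := fun e => (if e.2 = j then d e.1 + d (e.1 - gen k) else 0)
    - (if e.2 = k then d e.1 + d (e.1 - gen j) else 0) with hc
  have hfin : (Function.support fun e : Γ × ι => ‖c e • sinEdge w‖ ^ 2).Finite := by
    refine (((Set.finite_singleton (0 : Γ)).union ((Set.finite_singleton (gen j)).union
      (Set.finite_singleton (gen k)))).prod (Set.finite_univ (α := ι))).subset ?_
    rintro ⟨γ, i⟩ h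
    refine ⟨?_, Set.mem_univ _⟩
    by_contra hγ
    simp only [Set.mem_union, Set.mem_singleton_iff, not_or] at hγ
    apply h
    simp [hc, hd, hγ.1, sub_eq_zero, hγ.2.1, hγ.2.2]
  let x : GraphL2 (Γ × ι) := ⟨fun e => c e • sinEdge w,
    memℓp_gen (by simpa using summable_of_hasFiniteSupport hfin)⟩
  have hx : ∀ e, x e = c e • sinEdge w := fun e => rfl
  refine LinearPMap.not_isResolventPoint_of_eigenvector (x := x) (fun h0 => ?_) ?_
  · have h1 : (0 : ℂ) • cosEdge w + c (0, j) • sinEdge w = 0 := by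
      rw [zero_smul, zero_add, ← hx, h0]; rfl
    have h2 := (cosEdge_sinEdge_eq_zero h1).2
    simp only [hc, hd, if_true, if_neg hjk, sub_zero] at h2
    -- The amplitude on (0, j) is 1, or 2 when gen k = 0; it does not vanish even if the 4-cycle
    -- degenerates.
    split_ifs at h2 <;> norm_num at h2
  · refine ((cayleyGraph gen).mem_graph_iff 1 _).2 ⟨fun e y => c e * sinSol w y,
      fun e y => c e * cosSol w y, fun e => ?_, ?_⟩
    · refine ((isH2Rep_sinEdge w).smul (c e)).congr (hx e) ?_ rfl rfl
      rw [smul_comm, ← hx]; rfl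
    · rw [cayleyGraph_vertexConditions_iff]
      refine ⟨⟨0, fun e => ⟨?_, ?_⟩⟩, fun γ => ?_⟩
      · simp [sinSol_zero]
      · show c e * sinSol w 1 = 0
        rw [hw, sinSol_one_odd_mul_pi, mul_zero]
      · have hA : ∑ i, c (γ, i) = (d γ + d (γ - gen k)) - (d γ + d (γ - gen j)) := by
          simp [hc]
        have hB : ∑ i, c (γ - gen i, i) = (d (γ - gen j) + d (γ - gen j - gen k))
            - (d (γ - gen k) + d (γ - gen k - gen j)) := by
          simp [hc]
        rw [hw, Finset.sum_sub_distrib]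
        simp only [cosSol_zero, cosSol_one_odd_mul_pi, ← Finset.sum_mul]
        rw [hA, hB, sub_right_comm γ (gen k) (gen j)]
        ring

/-! ### Lower bounds for the adjacency operator -/

section LoewnerOrder

variable {H : Type*} [NormedAddCommGroup H] [InnerProductSpace ℂ H] [CompleteSpace H]

/-- Spectral bounds are recast as operator inequalities because the latter can be added over the
generators. -/
theorem algebraMap_le_of_spectrum {a : H →L[ℂ] H} (ha : IsSelfAdjoint a) {r : ℝ}
    (h : ∀ z ∈ spectrum ℂ a, r ≤ z.re) : algebraMap ℝ (H →L[ℂ] H) r ≤ a := by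
  rw [algebraMap_le_iff_le_spectrum ha]
  intro x hx
  have := h (x : ℂ) ((spectrum.algebraMap_mem_iff ℂ).2 hx)
  simpa using this

theorem isUnit_sub_algebraMap_of_lt {a : H →L[ℂ] H} (ha : IsSelfAdjoint a) {r x : ℝ}
    (h : algebraMap ℝ (H →L[ℂ] H) r ≤ a) (hx : x < r) :
    IsUnit (a - algebraMap ℂ (H →L[ℂ] H) (x : ℂ)) := by
  rw [algebraMap_le_iff_le_spectrum ha] at h
  by_contra hu
  have hmem : (x : ℂ) ∈ spectrum ℂ a := by
    rw [spectrum.mem_iff, IsUnit.sub_iff]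
    exact hu
  exact absurd (h x ((spectrum.algebraMap_mem_iff ℂ).1 hmem)) (not_le.2 hx)

end LoewnerOrder

/-- Otherwise -ζ = e^{iθ} with |θ| < π/p. As p is odd, (-ζ)^p = -1, so cos(pθ) = -1, which is
impossible for |pθ| < π. -/
theorem neg_cos_pi_div_le_re {ζ : ℂ} {p : ℕ} (hp : Odd p) (hζ : ζ ^ p = 1) :
    -Real.cos (Real.pi / p) ≤ ζ.re := by
  have hp0 : 0 < (p : ℝ) := Nat.cast_pos.2 hp.pos
  have hn : ‖ζ‖ = 1 := Complex.norm_eq_one_of_pow_eq_one hζ hp.pos.ne'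
  by_contra hlt
  push Not at hlt
  set θ := Complex.arg (-ζ) with hθ
  have hexp : Complex.exp (θ * Complex.I) = -ζ := by
    have := Complex.norm_mul_exp_arg_mul_I (-ζ)
    rwa [norm_neg, hn, Complex.ofReal_one, one_mul] at this
  have hcos : Real.cos |θ| = -ζ.re := by
    rw [Real.cos_abs, ← Complex.exp_ofReal_mul_I_re, hexp, Complex.neg_re]
  have hθπ : |θ| ≤ Real.pi := Complex.abs_arg_le_pi _
  have hθp : |θ| < Real.pi / p := by
    by_contra hge
    push Not at hge
    have := Real.cos_le_cos_of_nonneg_of_le_pi (by positivity) hθπ hge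
    linarith
  have hpow : Complex.exp ((p * θ : ℝ) * Complex.I) = -1 := by
    rw [show ((p * θ : ℝ) : ℂ) * Complex.I = p * (θ * Complex.I) by push_cast; ring,
      Complex.exp_nat_mul, hexp, hp.neg_pow, hζ]
  have hc1 : Real.cos |p * θ| = -1 := by
    rw [Real.cos_abs, ← Complex.exp_ofReal_mul_I_re, hpow]; simp
  have hlt' : |p * θ| < Real.pi := by
    rw [abs_mul, abs_of_pos hp0, mul_comm]
    exact (lt_div_iff₀ hp0).1 hθp
  have := Real.cos_lt_cos_of_nonneg_of_le_pi (abs_nonneg _) le_rfl hlt'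
  rw [Real.cos_pi, hc1] at this
  exact lt_irrefl _ this

/-- The least real part of a `p`-th root of unity for odd `p`, and `-1` for even `p`. -/
noncomputable def minRootRe (p : ℕ) : ℝ :=
  if Odd p then -Real.cos (Real.pi / p) else -1

theorem neg_one_le_minRootRe (p : ℕ) : -1 ≤ minRootRe p := by
  unfold minRootRe
  split_ifs
  · linarith [Real.cos_le_one (Real.pi / p)]
  · exact le_rfl

theorem neg_one_lt_minRootRe {p : ℕ} (hp : Odd p) : -1 < minRootRe p := by
  have hp0 : 0 < (p : ℝ) := Nat.cast_pos.2 hp.pos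
  have hp1 : (1 : ℝ) ≤ p := Nat.one_le_cast.2 hp.pos
  rw [minRootRe, if_pos hp, neg_lt_neg_iff, ← Real.cos_zero]
  refine Real.cos_lt_cos_of_nonneg_of_le_pi le_rfl ?_ (by positivity)
  exact div_le_self Real.pi_pos.le hp1

theorem minRootRe_le_one (p : ℕ) : minRootRe p ≤ 1 := by
  unfold minRootRe
  split_ifs
  · linarith [Real.neg_one_le_cos (Real.pi / p)]
  · norm_num

theorem exists_root_re_eq_minRootRe {p : ℕ} (hp : 0 < p) :
    ∃ ζ : Circle, ζ ^ p = 1 ∧ (ζ : ℂ).re = minRootRe p := by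
  by_cases ho : Odd p
  · obtain ⟨m, hm⟩ := ho
    -- For p = 2m + 1 the total angle p(π + π/p) = (p + 1)π is (m + 1) full turns.
    refine ⟨Circle.exp (Real.pi + Real.pi / p), ?_, ?_⟩
    · rw [← Circle.exp_nsmul, Circle.exp_eq_one]
      refine ⟨m + 1, ?_⟩
      have : (p : ℝ) ≠ 0 := Nat.cast_ne_zero.2 hp.ne'
      rw [nsmul_eq_mul]
      field_simp
      rw [hm]; push_cast; ring
    · rw [Circle.coe_exp, Complex.exp_ofReal_mul_I_re, minRootRe, if_pos ⟨m, hm⟩, add_comm,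
        Real.cos_add_pi]
  · refine ⟨Circle.exp Real.pi, ?_, ?_⟩
    · rw [← Circle.exp_nsmul, Circle.exp_eq_one]
      obtain ⟨m, hm⟩ := Nat.not_odd_iff_even.1 ho
      refine ⟨m, ?_⟩
      rw [nsmul_eq_mul, hm]; push_cast; ring
    · rw [Circle.coe_exp, Complex.exp_ofReal_mul_I_re, minRootRe, if_neg ho, Real.cos_pi]

/-! ### Operator inequalities for translations -/

section AdjacencyBounds

variable {Γ ι : Type*} [AddCommGroup Γ]

theorem neg_two_le_translation_add (g : Γ) :
    algebraMap ℝ _ (2 * (-1 : ℝ)) ≤ translation g + translation (-g) := by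
  refine algebraMap_le_of_spectrum (isSelfAdjoint_translation_add g) fun z hz => ?_
  have h1 := spectrum.norm_le_norm_mul_of_mem hz
  have h2 : ‖translation g + translation (-g)‖ ≤ 2 :=
    (norm_add_le _ _).trans ((add_le_add (norm_translation_le _)
      (norm_translation_le _)).trans (by norm_num))
  have h3 : ‖(1 : lp (fun _ : Γ => ℂ) 2 →L[ℂ] lp (fun _ : Γ => ℂ) 2)‖ ≤ 1 :=
    ContinuousLinearMap.norm_id_le
  have h4 : ‖z‖ ≤ 2 := h1.trans ((mul_le_mul h2 h3 (norm_nonneg _) (by norm_num)).trans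
    (by norm_num))
  have := (abs_le.1 (Complex.abs_re_le_norm z)).1
  linarith

/-- If p is odd, the translation U satisfies U^p = 1 and U⁻¹ = U^(p-1), so U + U⁻¹ is a polynomial
in U. By spectral mapping its spectrum consists of numbers ζ + ζ̄ = 2 Re ζ with ζ^p = 1. -/
theorem minRootRe_le_translation_add {g : Γ} {p : ℕ} (hp : 0 < p) (hg : p • g = 0) :
    algebraMap ℝ _ (2 * minRootRe p) ≤ translation g + translation (-g) := by
  by_cases ho : Odd p
  · refine algebraMap_le_of_spectrum (isSelfAdjoint_translation_add g) fun z hz => ?_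
    have hU : translation g ^ p = 1 := by rw [translation_pow, hg, translation_zero]
    have hU' : translation (-g) = translation g ^ (p - 1) := by
      rw [translation_pow]
      congr 1
      rw [neg_eq_iff_add_eq_zero, ← succ_nsmul', Nat.sub_add_cancel hp, hg]
    have hspec : ∀ ζ ∈ spectrum ℂ (translation g), ζ ^ p = 1 := by
      intro ζ hζ
      have := spectrum.pow_mem_pow (translation g) p hζ
      rw [hU] at this
      by_contra hne
      refine this ?_
      rw [spectrum.mem_resolventSet_iff, ← map_one (algebraMap ℂ (lp (fun _ : Γ => ℂ) 2 →L[ℂ] lp (fun _ : Γ => ℂ) 2)), ← map_sub]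
      exact (isUnit_iff_ne_zero.2 (sub_ne_zero.2 hne)).map _
    have hq : translation g + translation (-g)
        = Polynomial.aeval (translation g) (Polynomial.X + Polynomial.X ^ (p - 1) :
          Polynomial ℂ) := by
      simp [hU']
    have : Nontrivial (lp (fun _ : Γ => ℂ) 2 →L[ℂ] lp (fun _ : Γ => ℂ) 2) := by
      by_contra hnt
      rw [not_nontrivial_iff_subsingleton] at hnt
      exact hz (isUnit_of_subsingleton _)
    rw [hq, spectrum.map_polynomial_aeval] at hz
    obtain ⟨ζ, hζ, rfl⟩ := hz
    have hζp := hspec ζ hζ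
    have hn : ‖ζ‖ = 1 := Complex.norm_eq_one_of_pow_eq_one hζp hp.ne'
    have hinv : ζ ^ (p - 1) = (starRingEnd ℂ) ζ := by
      rw [← Complex.inv_eq_conj hn]
      refine eq_inv_of_mul_eq_one_left ?_
      rw [← pow_succ, Nat.sub_add_cancel hp, hζp]
    simp only [Polynomial.eval_add, Polynomial.eval_X, Polynomial.eval_pow, hinv, Complex.add_re,
      Complex.conj_re, minRootRe, if_pos ho]
    linarith [neg_cos_pi_div_le_re ho hζp]
  · rw [minRootRe, if_neg ho]
    exact neg_two_le_translation_add g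

theorem isUnit_shiftedAdjacency_of_lt [Fintype ι] (gen : ι → Γ) (μ : ι → ℝ)
    (hμ : ∀ j, algebraMap ℝ _ (2 * μ j) ≤ translation (gen j) + translation (-gen j)) {c : ℝ}
    (hc : Fintype.card ι * c < ∑ j, μ j) : IsUnit (shiftedAdjacency gen (c : ℂ)) := by
  have h1 : algebraMap ℝ _ (2 * ∑ j, μ j) ≤ adjacencyOp gen := by
    rw [Finset.mul_sum, map_sum]
    exact Finset.sum_le_sum fun j _ => hμ j
  have := isUnit_sub_algebraMap_of_lt (isSelfAdjoint_adjacencyOp gen) h1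
    (x := 2 * Fintype.card ι * c) (by linarith)
  rw [shiftedAdjacency]
  exact_mod_cast this

/-- The adjacency operator is self-adjoint of norm at most 2r, hence its spectrum lies in [-2r, 2r].
-/
theorem isUnit_shiftedAdjacency_of_notMem [Fintype ι] [Nonempty ι] (gen : ι → Γ) {c : ℂ}
    (hc : ∀ x : ℝ, x ∈ Set.Icc (-1 : ℝ) 1 → (x : ℂ) ≠ c) :
    IsUnit (shiftedAdjacency gen c) := by
  by_contra hu
  have hr : 0 < (Fintype.card ι : ℝ) := Nat.cast_pos.2 Fintype.card_pos
  have hmem : (2 * Fintype.card ι * c) ∈ spectrum ℂ (adjacencyOp gen) := by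
    rw [spectrum.mem_iff, IsUnit.sub_iff]
    exact hu
  have h1 := spectrum.norm_le_norm_mul_of_mem hmem
  have h3 : ‖(1 : lp (fun _ : Γ => ℂ) 2 →L[ℂ] lp (fun _ : Γ => ℂ) 2)‖ ≤ 1 :=
    ContinuousLinearMap.norm_id_le
  have h4 := h1.trans (mul_le_mul (norm_adjacencyOp_le gen) h3 (norm_nonneg _) (by positivity))
  have h5 := (isSelfAdjoint_adjacencyOp gen).mem_spectrum_eq_re hmem
  have h6 : c = (c.re : ℂ) := by
    have : (2 * (Fintype.card ι : ℂ) * c).re = 2 * Fintype.card ι * c.re := by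
      rw [show (2 * (Fintype.card ι : ℂ) * c) = ((2 * Fintype.card ι : ℝ) : ℂ) * c by push_cast; ring,
        Complex.re_ofReal_mul]
    rw [this] at h5
    have hne : (2 * (Fintype.card ι : ℂ)) ≠ 0 := by
      have : (Fintype.card ι : ℂ) ≠ 0 := by exact_mod_cast hr.ne'
      simp
    refine mul_left_cancel₀ hne ?_
    rw [h5]; push_cast; ring
  refine hc c.re ?_ h6.symm
  rw [h6, show (2 * (Fintype.card ι : ℂ) * (c.re : ℂ)) = ((2 * Fintype.card ι * c.re : ℝ) : ℂ) by
    push_cast; ring, Complex.norm_real, Real.norm_eq_abs, abs_mul, abs_of_pos (by positivity),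
    mul_one] at h4
  rw [Set.mem_Icc, ← abs_le]
  exact le_of_mul_le_mul_left (by linarith) (show 0 < 2 * (Fintype.card ι : ℝ) by positivity)

end AdjacencyBounds

/-! ### Approximate eigenvectors of the adjacency operator -/

section ApproximateEigenvectors

variable {Γ ι : Type*} [AddCommGroup Γ] [Fintype ι] (gen : ι → Γ)

/-- A character is a formal eigenvector of A. For the product χρ the eigenvalue part cancels and
only the increments of ρ along generators remain, which are small relative to ρ. -/
theorem norm_shiftedAdjacency_le_of_weight {c : ℝ} (χ : AddChar Γ Circle)
    (hχ : Fintype.card ι * c = ∑ j, (χ (gen j) : ℂ).re) {ρ : Γ → ℝ} (hρ0 : ∀ γ, 0 ≤ ρ γ)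
    {ε : ℝ} (hε : 0 ≤ ε) (hρ1 : ∀ γ j, |ρ (γ + gen j) - ρ γ| ≤ ε * ρ γ)
    (hρ2 : ∀ γ j, |ρ (γ - gen j) - ρ γ| ≤ ε * ρ γ) (φ : lp (fun _ : Γ => ℂ) 2)
    (hφ : ∀ γ, φ γ = χ γ * ρ γ) :
    ‖shiftedAdjacency gen (c : ℂ) φ‖ ≤ 2 * Fintype.card ι * ε * ‖φ‖ := by
  have hpt : ∀ γ, ‖shiftedAdjacency gen (c : ℂ) φ γ‖ ≤ 2 * Fintype.card ι * ε * ρ γ := by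
    intro γ
    have hinv : ∀ j, ((χ (gen j) : Circle) : ℂ)⁻¹ = (starRingEnd ℂ) (χ (gen j) : ℂ) := fun j =>
      Complex.inv_eq_conj (Circle.norm_coe _)
    have h1 : shiftedAdjacency gen (c : ℂ) φ γ = χ γ * ∑ j, ((χ (gen j) : ℂ)
        * ((ρ (γ + gen j) - ρ γ : ℝ) : ℂ) + (χ (gen j) : ℂ)⁻¹ * ((ρ (γ - gen j) - ρ γ : ℝ) : ℂ)) := by
      have h2 : ∑ j, ((χ (gen j) : ℂ) + (χ (gen j) : ℂ)⁻¹) = 2 * (Fintype.card ι * c : ℝ) := by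
        rw [hχ]
        push_cast
        rw [Finset.mul_sum]
        refine Finset.sum_congr rfl fun j _ => ?_
        rw [hinv, Complex.add_conj]
        push_cast; rfl
      rw [shiftedAdjacency_apply, hφ γ,
        show 2 * (Fintype.card ι : ℂ) * (c : ℂ) * ((χ γ : ℂ) * ρ γ)
          = (2 * (Fintype.card ι * c : ℝ)) * ((χ γ : ℂ) * ρ γ) by push_cast; ring,
        ← h2, Finset.sum_mul, ← Finset.sum_sub_distrib, Finset.mul_sum]
      refine Finset.sum_congr rfl fun j _ => ?_
      rw [hφ, hφ, AddChar.map_add_eq_mul, AddChar.map_sub_eq_div, Circle.coe_mul, Circle.coe_div]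
      push_cast
      ring
    have h3 : ∀ j, ‖(χ (gen j) : ℂ) * ((ρ (γ + gen j) - ρ γ : ℝ) : ℂ)
        + (χ (gen j) : ℂ)⁻¹ * ((ρ (γ - gen j) - ρ γ : ℝ) : ℂ)‖ ≤ 2 * (ε * ρ γ) := by
      intro j
      refine (norm_add_le _ _).trans ?_
      rw [norm_mul, norm_mul, norm_inv, Circle.norm_coe, Complex.norm_real, Complex.norm_real,
        Real.norm_eq_abs, Real.norm_eq_abs]
      have := hρ1 γ j
      have := hρ2 γ j
      linarith
    rw [h1, norm_mul, Circle.norm_coe, one_mul]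
    refine (norm_sum_le_of_le _ fun j _ => h3 j).trans (le_of_eq ?_)
    rw [Finset.sum_const, nsmul_eq_mul, Finset.card_univ]
    ring
  have hK : 0 ≤ 2 * Fintype.card ι * ε := by positivity
  refine lp.norm_le_of_forall_sum_le (by norm_num) (by positivity) fun s => ?_
  simp only [ENNReal.toReal_ofNat, Real.rpow_two]
  calc ∑ γ ∈ s, ‖shiftedAdjacency gen (c : ℂ) φ γ‖ ^ 2
      ≤ ∑ γ ∈ s, (2 * Fintype.card ι * ε) ^ 2 * ‖φ γ‖ ^ 2 := by
        refine Finset.sum_le_sum fun γ _ => ?_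
        rw [← mul_pow, hφ, norm_mul, Circle.norm_coe, one_mul, Complex.norm_real,
          Real.norm_of_nonneg (hρ0 γ)]
        exact pow_le_pow_left₀ (norm_nonneg _) (hpt γ) 2
    _ = (2 * Fintype.card ι * ε) ^ 2 * ∑ γ ∈ s, ‖φ γ‖ ^ 2 := (Finset.mul_sum _ _ _).symm
    _ ≤ (2 * Fintype.card ι * ε) ^ 2 * ‖φ‖ ^ 2 :=
        mul_le_mul_of_nonneg_left (lp_sum_sq_le φ s) (by positivity)
    _ = (2 * Fintype.card ι * ε * ‖φ‖) ^ 2 := (mul_pow _ _ _).symm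

/-- If the group carries a length function of subexponential growth, the shifted adjacency
operator has no left inverse at the values taken by the characters. -/
theorem not_exists_leftInverse_shiftedAdjacency {c : ℝ} (χ : AddChar Γ Circle)
    (hχ : Fintype.card ι * c = ∑ j, (χ (gen j) : ℂ).re) (N : Γ → ℕ)
    (hN1 : ∀ γ j, N (γ + gen j) ≤ N γ + 1) (hN2 : ∀ γ j, N (γ - gen j) ≤ N γ + 1)
    (hN : ∀ q : ℝ, 0 < q → q < 1 → Summable fun γ => q ^ N γ) :
    ¬ ∃ L : lp (fun _ : Γ => ℂ) 2 →L[ℂ] lp (fun _ : Γ => ℂ) 2,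
      ∀ φ, L (shiftedAdjacency gen (c : ℂ) φ) = φ := by
  rintro ⟨L, hL⟩
  set K : ℝ := ‖L‖ * (2 * Fintype.card ι) with hK
  have hK0 : 0 ≤ K := by positivity
  -- The approximate eigenvector bound with a left inverse L would force 1 ≤ Kε. The rate t = 1/(1 +
  -- ε) is chosen so that changing the exponent by one alters t^n by at most ε t^n: t⁻¹ - 1 = ε and
  -- 1 - t ≤ ε.
  set ε : ℝ := 1 / (K + 1) with hε
  have hε0 : 0 < ε := by positivity
  set t : ℝ := 1 / (1 + ε) with ht
  have ht0 : 0 < t := by positivity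
  have ht1 : t < 1 := by rw [ht, div_lt_one (by positivity)]; linarith
  have htε : t * (1 + ε) = 1 := by rw [ht]; field_simp
  have hstep : ∀ m n : ℕ, m ≤ n + 1 → n ≤ m + 1 → |t ^ m - t ^ n| ≤ ε * t ^ n := by
    intro m n h1 h2
    have hpos : ∀ k, 0 < t ^ k := fun k => pow_pos ht0 k
    rcases Nat.lt_trichotomy m n with h | h | h
    · obtain rfl : n = m + 1 := by omega
      rw [pow_succ, abs_le]
      constructor <;> nlinarith [hpos m]
    · subst h
      rw [sub_self, abs_zero]; exact mul_nonneg hε0.le (hpos _).le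
    · obtain rfl : m = n + 1 := by omega
      have h3 : 1 - t ≤ ε := by nlinarith
      have h4 := mul_le_mul_of_nonneg_right h3 (hpos n).le
      rw [pow_succ, abs_le]
      constructor <;> nlinarith [hpos n]
  set ρ : Γ → ℝ := fun γ => t ^ N γ with hρ
  have hρ0 : ∀ γ, 0 < ρ γ := fun γ => pow_pos ht0 _
  have hmem : Memℓp (fun γ => (χ γ : ℂ) * (ρ γ : ℂ)) 2 := by
    refine memℓp_gen ?_
    have := hN (t ^ 2) (by positivity) (by nlinarith)
    refine this.congr fun γ => ?_
    rw [norm_mul, Circle.norm_coe, one_mul, Complex.norm_real, Real.norm_of_nonneg (hρ0 γ).le,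
      ENNReal.toReal_ofNat, Real.rpow_two, ← pow_mul, ← pow_mul, mul_comm]
  let φ : lp (fun _ : Γ => ℂ) 2 := ⟨_, hmem⟩
  have hφ : ∀ γ, φ γ = (χ γ : ℂ) * (ρ γ : ℂ) := fun γ => rfl
  have hφ0 : 0 < ‖φ‖ := by
    rw [norm_pos_iff]
    intro h0
    have h1 := hφ 0
    rw [h0, lp.coeFn_zero, Pi.zero_apply] at h1
    have h2 : (χ 0 : ℂ) ≠ 0 := Circle.coe_ne_zero _
    have h3 : (ρ 0 : ℂ) ≠ 0 := by exact_mod_cast (hρ0 0).ne'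
    exact mul_ne_zero h2 h3 h1.symm
  have hbound := norm_shiftedAdjacency_le_of_weight gen χ hχ (fun γ => (hρ0 γ).le) hε0.le
    (fun γ j => hstep _ _ (hN1 γ j) (by simpa using hN2 (γ + gen j) j))
    (fun γ j => hstep _ _ (hN2 γ j) (by simpa using hN1 (γ - gen j) j)) φ hφ
  have h1 : ‖φ‖ ≤ ‖L‖ * (2 * Fintype.card ι * ε * ‖φ‖) := by
    conv_lhs => rw [← hL φ]
    exact (L.le_opNorm _).trans (mul_le_mul_of_nonneg_left hbound (norm_nonneg _))
  have h2 : ‖φ‖ * 1 ≤ ‖φ‖ * (K * ε) := by rw [mul_one]; exact h1.trans (le_of_eq (by rw [hK]; ring))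
  have h3 : 1 ≤ K * ε := le_of_mul_le_mul_left h2 hφ0
  have h4 : K * ε < 1 := by
    rw [hε, mul_one_div, div_lt_one (by positivity)]; linarith
  linarith

/-- Values of the dispersion relation belong to the spectrum. -/
theorem not_isResolventPoint_of_character [Nonempty ι] (N : Γ → ℕ)
    (hN1 : ∀ γ j, N (γ + gen j) ≤ N γ + 1) (hN2 : ∀ γ j, N (γ - gen j) ≤ N γ + 1)
    (hN : ∀ q : ℝ, 0 < q → q < 1 → Summable fun γ => q ^ N γ) (χ : AddChar Γ Circle) {k : ℝ}
    (hχ : Fintype.card ι * Real.cos k = ∑ j, (χ (gen j) : ℂ).re) (hk : Real.sin k ≠ 0) :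
    ¬ (cayleyGraph gen).kirchhoffLaplacian.IsResolventPoint ((k : ℂ) ^ 2) := by
  intro h
  have hs : sinSol (k : ℂ) 1 ≠ 0 := by
    rw [Ne, sinSol_one_eq_zero_iff, ← Complex.ofReal_sin, Complex.ofReal_eq_zero]
    exact fun h => hk h.2
  have := exists_leftInverse_of_isResolventPoint gen hs h
  rw [← Complex.ofReal_cos] at this
  exact not_exists_leftInverse_shiftedAdjacency gen χ hχ N hN1 hN2 hN this

end ApproximateEigenvectors

/-! ### Finitely generated abelian groups -/

theorem summable_int_pow_natAbs {q : ℝ} (h0 : 0 < q) (h1 : q < 1) :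
    Summable fun n : ℤ => q ^ n.natAbs := by
  have := summable_geometric_of_lt_one h0.le h1
  exact Summable.of_nat_of_neg (by simpa using this) (by simpa using this)

theorem summable_pi_int_pow_sum_natAbs {q : ℝ} (h0 : 0 < q) (h1 : q < 1) (r : ℕ) :
    Summable fun n : Fin r → ℤ => q ^ ∑ i, (n i).natAbs := by
  induction r with
  | zero => exact Summable.of_finite
  | succ r ih =>
    rw [← (Fin.consEquiv fun _ => ℤ).summable_iff]
    have := (summable_int_pow_natAbs h0 h1).mul_of_nonneg ih (fun _ => by positivity)
      (fun _ => by positivity)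
    refine this.congr fun x => ?_
    simp [Fin.sum_univ_succ, pow_add, Fin.consEquiv]

section FGAbelian

variable {r₀ a : ℕ} {p m : Fin a → ℕ}

/-- The word length of the free part. -/
def FGAbelian.length (γ : FGAbelian r₀ p m) : ℕ := ∑ i, (γ.1 i).natAbs

theorem FGAbelian.length_add_le (γ δ : FGAbelian r₀ p m) :
    FGAbelian.length (γ + δ) ≤ FGAbelian.length γ + FGAbelian.length δ := by
  unfold FGAbelian.length
  rw [← Finset.sum_add_distrib]
  exact Finset.sum_le_sum fun i _ => Int.natAbs_add_le _ _

theorem FGAbelian.length_neg (γ : FGAbelian r₀ p m) :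
    FGAbelian.length (-γ) = FGAbelian.length γ := by
  simp [FGAbelian.length]

theorem FGAbelian.length_canonicalGen_le (j : GenIndex r₀ m) :
    FGAbelian.length (canonicalGen r₀ p m j) ≤ 1 := by
  rcases j with k | ⟨i, k⟩
  · have : FGAbelian.length (canonicalGen r₀ p m (Sum.inl k))
        = ∑ i, if i = k then 1 else 0 := by
      refine Finset.sum_congr rfl fun i _ => ?_
      simp only [canonicalGen, Pi.single_apply]
      split_ifs <;> rfl
    rw [this]; simp
  · simp [FGAbelian.length, canonicalGen]

/-- The length ignores the torsion part; that part is finite and only multiplies the sum by a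
constant. -/
theorem FGAbelian.summable_pow_length (hp : ∀ i, 0 < p i) {q : ℝ} (h0 : 0 < q) (h1 : q < 1) :
    Summable fun γ : FGAbelian r₀ p m => q ^ FGAbelian.length γ := by
  have : ∀ i, NeZero (p i) := fun i => ⟨(hp i).ne'⟩
  have h := (summable_pi_int_pow_sum_natAbs h0 h1 r₀).mul_of_nonneg
    (Summable.of_finite (f := fun _ : (i : Fin a) → Fin (m i) → ZMod (p i) => (1 : ℝ)))
    (fun _ => by positivity) (fun _ => by simp)
  refine h.congr fun γ => ?_
  simp [FGAbelian.length]

/-- Characters take arbitrary compatible values on the canonical generators. -/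
theorem exists_addChar_canonicalGen (hp : ∀ i, 0 < p i) (ζ : GenIndex r₀ m → Circle)
    (hζ : ∀ i k, ζ (Sum.inr ⟨i, k⟩) ^ p i = 1) :
    ∃ χ : AddChar (FGAbelian r₀ p m) Circle, ∀ j, χ (canonicalGen r₀ p m j) = ζ j := by
  classical
  have : ∀ i, NeZero (p i) := fun i => ⟨(hp i).ne'⟩
  let χ : AddChar (FGAbelian r₀ p m) Circle :=
    { toFun := fun γ => (∏ i, ζ (Sum.inl i) ^ γ.1 i)
        * ∏ i, ∏ k, AddChar.zmodChar (p i) (hζ i k) (γ.2 i k)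
      map_zero_eq_one' := by simp
      map_add_eq_mul' := fun γ δ => by
        simp only [Prod.fst_add, Prod.snd_add, Pi.add_apply, zpow_add, AddChar.map_add_eq_mul,
          Finset.prod_mul_distrib]
        exact mul_mul_mul_comm _ _ _ _ }
  have hχ : ∀ γ, χ γ = (∏ i, ζ (Sum.inl i) ^ γ.1 i)
        * ∏ i, ∏ k, AddChar.zmodChar (p i) (hζ i k) (γ.2 i k) := fun γ => rfl
  refine ⟨χ, fun j => ?_⟩
  rw [hχ]
  rcases j with k | ⟨i, k⟩
  · rw [Finset.prod_eq_single k (fun b _ hb => by simp [canonicalGen, hb]) (by simp)]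
    simp [canonicalGen]
  · rw [Finset.prod_eq_single i (fun b _ hb => by simp [canonicalGen, hb]) (by simp),
      Finset.prod_eq_single k (fun b _ hb => by simp [canonicalGen, hb]) (by simp)]
    have h1 := AddChar.zmodChar_apply' (hζ i k) 1
    simp only [Nat.cast_one, pow_one] at h1
    simp [canonicalGen, h1]

theorem nsmul_canonicalGen_inr (i : Fin a) (k : Fin (m i)) :
    p i • canonicalGen r₀ p m (Sum.inr ⟨i, k⟩) = 0 := by
  classical
  refine Prod.ext ?_ ?_
  · simp [canonicalGen]
  · show p i • (Pi.single i (Pi.single k 1) : (i : Fin a) → Fin (m i) → ZMod (p i)) = 0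
    rw [← Pi.single_smul, ← Pi.single_smul]
    simp

/-- Values on the generators may be prescribed freely up to the torsion relations, and the length of
the free part changes by at most 1 along each generator. -/
theorem not_isResolventPoint_of_values (hr₀ : 0 < r₀) (hp : ∀ i, 0 < p i)
    (ζ : GenIndex r₀ m → Circle) (hζ : ∀ i k, ζ (Sum.inr ⟨i, k⟩) ^ p i = 1) {k : ℝ}
    (hk : Fintype.card (GenIndex r₀ m) * Real.cos k = ∑ j, (ζ j : ℂ).re) (hs : Real.sin k ≠ 0) :
    ¬ (cayleyGraph (canonicalGen r₀ p m)).kirchhoffLaplacian.IsResolventPoint ((k : ℂ) ^ 2) := by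
  have : Nonempty (GenIndex r₀ m) := ⟨Sum.inl ⟨0, hr₀⟩⟩
  obtain ⟨χ, hχ⟩ := exists_addChar_canonicalGen hp ζ hζ
  refine not_isResolventPoint_of_character _ FGAbelian.length (fun γ j => ?_) (fun γ j => ?_)
    (fun q h0 h1 => FGAbelian.summable_pow_length hp h0 h1) χ ?_ hs
  · exact (FGAbelian.length_add_le _ _).trans
      (Nat.add_le_add_left (FGAbelian.length_canonicalGen_le j) _)
  · rw [sub_eq_add_neg]
    refine (FGAbelian.length_add_le _ _).trans (Nat.add_le_add_left ?_ _)
    rw [FGAbelian.length_neg]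
    exact FGAbelian.length_canonicalGen_le j
  · simp only [hχ]; exact hk

end FGAbelian

/-! ### Spectral gaps and the full half line -/

theorem cos_odd_mul_pi_add (l : ℕ) (y : ℝ) :
    Real.cos ((2 * (l : ℝ) + 1) * Real.pi + y) = -Real.cos y := by
  rw [show (2 * (l : ℝ) + 1) * Real.pi + y = y + Real.pi + l * (2 * Real.pi) by ring,
    Real.cos_add_nat_mul_two_pi, Real.cos_add_pi]

theorem sin_odd_mul_pi_add (l : ℕ) (y : ℝ) :
    Real.sin ((2 * (l : ℝ) + 1) * Real.pi + y) = -Real.sin y := by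
  rw [show (2 * (l : ℝ) + 1) * Real.pi + y = y + Real.pi + l * (2 * Real.pi) by ring,
    Real.sin_add_nat_mul_two_pi, Real.sin_add_pi]

/-- Applied to the gap lengths, which are affine functions of the gap number. -/
theorem tendsto_and_strictMono_affine {A B : ℝ} (hA : 0 < A) {f : ℕ → ℝ}
    (hf : ∀ l, f l = A * l + B) : StrictMono f ∧ Filter.Tendsto f Filter.atTop Filter.atTop := by
  obtain rfl : f = fun l : ℕ => A * l + B := funext hf
  refine ⟨fun a b hab => ?_, ?_⟩
  · have : (a : ℝ) < b := Nat.cast_lt.2 hab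
    have := mul_lt_mul_of_pos_left this hA
    simpa using this
  · exact Filter.tendsto_atTop_add_const_right _ _
      (tendsto_natCast_atTop_atTop.const_mul_atTop hA)

section FGAbelian

variable {r₀ a : ℕ} {p m : Fin a → ℕ}

theorem card_genIndex : Fintype.card (GenIndex r₀ m) = r₀ + ∑ i, m i := by
  simp [GenIndex]

/-- The least real part of the value of a character on a canonical generator. -/
noncomputable def minGenRe (p m : Fin a → ℕ) : GenIndex r₀ m → ℝ
  | Sum.inl _ => -1
  | Sum.inr ⟨i, _⟩ => minRootRe (p i)

/-- The minimum of the dispersion relation. -/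
noncomputable def minDispersion (r₀ : ℕ) (p m : Fin a → ℕ) : ℝ :=
  (∑ j : GenIndex r₀ m, minGenRe p m j) / Fintype.card (GenIndex r₀ m)

theorem card_mul_minDispersion (hr₀ : 0 < r₀) :
    Fintype.card (GenIndex r₀ m) * minDispersion r₀ p m
      = ∑ j : GenIndex r₀ m, minGenRe p m j := by
  have : Nonempty (GenIndex r₀ m) := ⟨Sum.inl ⟨0, hr₀⟩⟩
  have : (Fintype.card (GenIndex r₀ m) : ℝ) ≠ 0 := Nat.cast_ne_zero.2 Fintype.card_ne_zero
  rw [minDispersion, mul_div_cancel₀ _ this]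

theorem neg_one_le_minGenRe (j : GenIndex r₀ m) : -1 ≤ minGenRe p m j := by
  rcases j with k | ⟨i, k⟩
  · exact le_rfl
  · exact neg_one_le_minRootRe _

theorem minGenRe_le_one (j : GenIndex r₀ m) : minGenRe p m j ≤ 1 := by
  rcases j with k | ⟨i, k⟩
  · show (-1 : ℝ) ≤ 1
    norm_num
  · exact minRootRe_le_one _

/-- The only use of odd order for the gaps to open: one summand exceeds -1. -/
theorem neg_one_lt_minDispersion (hr₀ : 0 < r₀) (hm : ∀ i, 0 < m i) (hodd : ∃ i, Odd (p i)) :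
    -1 < minDispersion r₀ p m := by
  have : Nonempty (GenIndex r₀ m) := ⟨Sum.inl ⟨0, hr₀⟩⟩
  have hr : (0 : ℝ) < Fintype.card (GenIndex r₀ m) := Nat.cast_pos.2 Fintype.card_pos
  obtain ⟨i, hi⟩ := hodd
  rw [minDispersion, lt_div_iff₀ hr]
  calc -1 * (Fintype.card (GenIndex r₀ m) : ℝ) = ∑ _j : GenIndex r₀ m, (-1 : ℝ) := by simp
    _ < _ := Finset.sum_lt_sum (fun j _ => neg_one_le_minGenRe j)
      ⟨Sum.inr ⟨i, ⟨0, hm i⟩⟩, Finset.mem_univ _, neg_one_lt_minRootRe hi⟩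

theorem minDispersion_lt_one (hr₀ : 0 < r₀) : minDispersion r₀ p m < 1 := by
  have : Nonempty (GenIndex r₀ m) := ⟨Sum.inl ⟨0, hr₀⟩⟩
  have hr : (0 : ℝ) < Fintype.card (GenIndex r₀ m) := Nat.cast_pos.2 Fintype.card_pos
  rw [minDispersion, div_lt_iff₀ hr]
  calc _ < ∑ _j : GenIndex r₀ m, (1 : ℝ) := Finset.sum_lt_sum (fun j _ => minGenRe_le_one j)
        ⟨Sum.inl ⟨0, hr₀⟩, Finset.mem_univ _, by show (-1 : ℝ) < 1; norm_num⟩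
    _ = _ := by simp

theorem isResolventPoint_of_cos_lt (hr₀ : 0 < r₀) (hp : ∀ i, 0 < p i) {k : ℝ}
    (hs : Real.sin k ≠ 0) (hk : Real.cos k < minDispersion r₀ p m) :
    (cayleyGraph (canonicalGen r₀ p m)).kirchhoffLaplacian.IsResolventPoint ((k : ℂ) ^ 2) := by
  have : Nonempty (GenIndex r₀ m) := ⟨Sum.inl ⟨0, hr₀⟩⟩
  have hr : (0 : ℝ) < Fintype.card (GenIndex r₀ m) := Nat.cast_pos.2 Fintype.card_pos
  refine isResolventPoint_of_isUnit _ ?_ ?_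
  · rw [Ne, sinSol_one_eq_zero_iff, ← Complex.ofReal_sin, Complex.ofReal_eq_zero]
    exact fun h => hs h.2
  · rw [← Complex.ofReal_cos]
    refine isUnit_shiftedAdjacency_of_lt _ (minGenRe p m) (fun j => ?_) ?_
    · rcases j with k | ⟨i, k⟩
      · exact neg_two_le_translation_add _
      · exact minRootRe_le_translation_add (hp i) (nsmul_canonicalGen_inr i k)
    · rw [← card_mul_minDispersion hr₀]
      exact mul_lt_mul_of_pos_left hk hr

theorem not_isResolventPoint_of_cos_eq (hr₀ : 0 < r₀) (hp : ∀ i, 0 < p i) {k : ℝ}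
    (hs : Real.sin k ≠ 0) (hk : Real.cos k = minDispersion r₀ p m) :
    ¬ (cayleyGraph (canonicalGen r₀ p m)).kirchhoffLaplacian.IsResolventPoint ((k : ℂ) ^ 2) := by
  choose ξ hξ1 hξ2 using fun i => exists_root_re_eq_minRootRe (hp i)
  -- All minima are attained at once: -1 on the free generators and an extremal root of unity on
  -- each torsion generator.
  let ζ : GenIndex r₀ m → Circle := Sum.elim (fun _ => Circle.exp Real.pi) (fun x => ξ x.1)
  refine not_isResolventPoint_of_values hr₀ hp ζ (fun i k => hξ1 i) ?_ hs
  rw [hk, card_mul_minDispersion hr₀]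
  refine Finset.sum_congr rfl fun j _ => ?_
  rcases j with k | ⟨i, k⟩
  · show (-1 : ℝ) = (Circle.exp Real.pi : ℂ).re
    rw [Circle.coe_exp, Complex.exp_ofReal_mul_I_re, Real.cos_pi]
  · exact (hξ2 i).symm

/-- With k = (2l + 1)π + y one has cos k = -cos y, which is below c exactly when |y| < δ =
arccos(-c), as long as |y| ≤ π. Since 0 < δ < π, the punctured interval 0 < |y| < δ avoids all zeros
of sin, and squaring it gives the two gaps. -/
theorem exists_spectral_gaps (hr₀ : 0 < r₀) (hp : ∀ i, 0 < p i) (hm : ∀ i, 0 < m i)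
    (hodd : ∃ i, Odd (p i)) :
    ∃ α β : ℕ → ℝ,
      (∀ l : ℕ,
        IsSpectralGap (cayleyGraph (canonicalGen r₀ p m)).kirchhoffLaplacian.unboundedSpectrum
          (α l) ((2 * (l : ℝ) + 1) ^ 2 * Real.pi ^ 2) ∧
        IsSpectralGap (cayleyGraph (canonicalGen r₀ p m)).kirchhoffLaplacian.unboundedSpectrum
          ((2 * (l : ℝ) + 1) ^ 2 * Real.pi ^ 2) (β l)) ∧
      StrictMono (fun l : ℕ => (2 * (l : ℝ) + 1) ^ 2 * Real.pi ^ 2 - α l) ∧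
      StrictMono (fun l : ℕ => β l - (2 * (l : ℝ) + 1) ^ 2 * Real.pi ^ 2) ∧
      Filter.Tendsto (fun l : ℕ => (2 * (l : ℝ) + 1) ^ 2 * Real.pi ^ 2 - α l)
        Filter.atTop Filter.atTop ∧
      Filter.Tendsto (fun l : ℕ => β l - (2 * (l : ℝ) + 1) ^ 2 * Real.pi ^ 2)
        Filter.atTop Filter.atTop := by
  set S := (cayleyGraph (canonicalGen r₀ p m)).kirchhoffLaplacian.unboundedSpectrum with hS
  set c := minDispersion r₀ p m with hc
  have hc1 : -1 < c := neg_one_lt_minDispersion hr₀ hm hodd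
  have hc2 : c < 1 := minDispersion_lt_one hr₀
  set δ := Real.arccos (-c) with hδ
  have hδ0 : 0 < δ := Real.arccos_pos.2 (by linarith)
  have hcosδ : Real.cos δ = -c := Real.cos_arccos (by linarith) (by linarith)
  have hδπ : δ < Real.pi := by
    refine lt_of_le_of_ne (Real.arccos_le_pi _) fun h => ?_
    rw [h, Real.cos_pi] at hcosδ
    linarith
  have hsinδ : 0 < Real.sin δ := Real.sin_pos_of_pos_of_lt_pi hδ0 hδπ
  have hnot : ∀ (l : ℕ) (x : ℝ), 0 ≤ x → Real.sqrt x ≠ (2 * (l : ℝ) + 1) * Real.pi →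
      |Real.sqrt x - (2 * (l : ℝ) + 1) * Real.pi| < δ → (x : ℂ) ∉ S := by
    intro l x hx0 hne hlt
    set y := Real.sqrt x - (2 * (l : ℝ) + 1) * Real.pi with hy
    have hk : Real.sqrt x = (2 * (l : ℝ) + 1) * Real.pi + y := by rw [hy]; ring
    have hy0 : y ≠ 0 := sub_ne_zero.2 hne
    have hyp : 0 < |y| := abs_pos.2 hy0
    have hxk : (x : ℂ) = ((Real.sqrt x : ℝ) : ℂ) ^ 2 := by
      rw [← Complex.ofReal_pow, Real.sq_sqrt hx0]
    rw [hxk]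
    refine fun h => h (isResolventPoint_of_cos_lt hr₀ hp ?_ ?_)
    · rw [hk, sin_odd_mul_pi_add, neg_ne_zero]
      have : 0 < Real.sin |y| := Real.sin_pos_of_pos_of_lt_pi hyp (hlt.trans hδπ)
      rcases abs_choice y with h' | h'
      · rw [h'] at this; exact this.ne'
      · rw [h', Real.sin_neg] at this
        intro h0; rw [h0] at this; simp at this
    · rw [hk, cos_odd_mul_pi_add, ← Real.cos_abs y]
      have := Real.cos_lt_cos_of_nonneg_of_le_pi hyp.le hδπ.le hlt
      linarith
  have hT : ∀ l : ℕ, (((2 * (l : ℝ) + 1) ^ 2 * Real.pi ^ 2 : ℝ) : ℂ) ∈ S := by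
    intro l
    -- A free generator and one of odd order are the two distinct generators needed for the 4-cycle.
    obtain ⟨i, hi⟩ := hodd
    have := not_isResolventPoint_odd_mul_pi_sq (canonicalGen r₀ p m)
      (j := Sum.inl ⟨0, hr₀⟩) (k := Sum.inr ⟨i, ⟨0, hm i⟩⟩) (by simp) l
    rwa [← Complex.ofReal_pow, mul_pow] at this
  have hend : ∀ (l : ℕ) (y : ℝ), |y| = δ →
      (((((2 * (l : ℝ) + 1) * Real.pi + y) ^ 2 : ℝ)) : ℂ) ∈ S := by
    intro l y hy
    rw [Complex.ofReal_pow]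
    refine not_isResolventPoint_of_cos_eq hr₀ hp ?_ ?_
    · rw [sin_odd_mul_pi_add, neg_ne_zero]
      rcases abs_choice y with h' | h'
      · rw [← h', hy]; exact hsinδ.ne'
      · rw [← neg_neg y, ← h', hy, Real.sin_neg]; exact neg_ne_zero.2 hsinδ.ne'
    · rw [cos_odd_mul_pi_add, ← Real.cos_abs, hy, hcosδ, neg_neg]
  have hle : ∀ l : ℕ, Real.pi ≤ (2 * (l : ℝ) + 1) * Real.pi := fun l => by
    have : (0 : ℝ) ≤ l := Nat.cast_nonneg l
    nlinarith [Real.pi_pos]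
  -- The squares ((2l + 1)π)² cancel in both lengths, leaving 4πδ l + 2πδ ∓ δ².
  have hA : 0 < 4 * Real.pi * δ := by have := Real.pi_pos; positivity
  have h1 := tendsto_and_strictMono_affine hA (B := 2 * Real.pi * δ - δ ^ 2)
    (f := fun l : ℕ => (2 * (l : ℝ) + 1) ^ 2 * Real.pi ^ 2
      - ((2 * (l : ℝ) + 1) * Real.pi + -δ) ^ 2) (fun l => by ring)
  have h2 := tendsto_and_strictMono_affine hA (B := 2 * Real.pi * δ + δ ^ 2)
    (f := fun l : ℕ => ((2 * (l : ℝ) + 1) * Real.pi + δ) ^ 2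
      - (2 * (l : ℝ) + 1) ^ 2 * Real.pi ^ 2) (fun l => by ring)
  refine ⟨fun l => ((2 * (l : ℝ) + 1) * Real.pi + -δ) ^ 2,
    fun l => ((2 * (l : ℝ) + 1) * Real.pi + δ) ^ 2, fun l => ⟨⟨?_, ?_, ?_, hT l, ?_⟩,
    ⟨?_, ?_, hT l, ?_, ?_⟩⟩, h1.1, h2.1, h1.2, h2.2⟩
  · have := hle l
    exact pow_pos (by linarith) 2
  · have := hle l
    rw [← mul_pow]
    exact pow_lt_pow_left₀ (by linarith) (by linarith) two_ne_zero
  · exact hend l (-δ) (by rw [abs_neg, abs_of_pos hδ0])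
  · rintro x ⟨hx1, hx2⟩
    have := hle l
    have hx0 : 0 ≤ x := (sq_nonneg _).trans hx1.le
    have hs1 := Real.lt_sqrt_of_sq_lt hx1
    have hs2 : Real.sqrt x < (2 * (l : ℝ) + 1) * Real.pi := by
      rw [Real.sqrt_lt' (by linarith [Real.pi_pos]), mul_pow]; exact hx2
    exact hnot l x hx0 hs2.ne (by rw [abs_lt]; constructor <;> linarith)
  · have := Real.pi_pos; positivity
  · have := hle l
    rw [← mul_pow]
    exact pow_lt_pow_left₀ (by linarith) (by linarith [Real.pi_pos]) two_ne_zero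
  · exact hend l δ (abs_of_pos hδ0)
  · rintro x ⟨hx1, hx2⟩
    have := hle l
    rw [← mul_pow] at hx1
    have hx0 : 0 ≤ x := (sq_nonneg _).trans hx1.le
    have hs1 := Real.lt_sqrt_of_sq_lt hx1
    have hs2 : Real.sqrt x < (2 * (l : ℝ) + 1) * Real.pi + δ := by
      rw [Real.sqrt_lt' (by linarith [Real.pi_pos])]; exact hx2
    exact hnot l x hx0 hs1.ne' (by rw [abs_lt]; constructor <;> linarith)

/-- Greedy choice: subtracting the sign of y lowers |y| by 1 or leaves it at most 1, and 1 ≤ R makes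
the second outcome harmless. -/
theorem exists_signs_abs_sub_sum_le {J : Type*} [DecidableEq J] (s : Finset J) {R : ℝ}
    (hR : 1 ≤ R) (y : ℝ) (hy : |y| ≤ R + s.card) :
    ∃ ε : J → ℝ, (∀ j, ε j = 1 ∨ ε j = -1) ∧ |y - ∑ j ∈ s, ε j| ≤ R := by
  induction s using Finset.induction generalizing y with
  | empty => exact ⟨fun _ => 1, fun _ => Or.inl rfl, by simpa using hy⟩
  | insert j s hj ih =>
    rw [Finset.card_insert_of_notMem hj] at hy
    push_cast at hy
    have hs : (0 : ℝ) ≤ s.card := Nat.cast_nonneg _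
    obtain ⟨σ, hσ, hσy⟩ : ∃ σ : ℝ, (σ = 1 ∨ σ = -1) ∧ |y - σ| ≤ R + s.card := by
      rw [abs_le] at hy
      rcases le_total 0 y with h | h
      · exact ⟨1, Or.inl rfl, by rw [abs_le]; constructor <;> linarith⟩
      · exact ⟨-1, Or.inr rfl, by rw [abs_le]; constructor <;> linarith⟩
    obtain ⟨ε, hε, hεy⟩ := ih (y - σ) hσy
    refine ⟨Function.update ε j σ, fun i => ?_, ?_⟩
    · rcases eq_or_ne i j with rfl | hij
      · simpa using hσ
      · simpa [hij] using hε i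
    · have hsum : ∑ i ∈ s, Function.update ε j σ i = ∑ i ∈ s, ε i :=
        Finset.sum_congr rfl fun i hi =>
          Function.update_of_ne (ne_of_mem_of_not_mem hi hj) σ ε
      rw [Finset.sum_insert hj, Function.update_self, hsum, ← sub_sub]
      exact hεy

theorem not_isResolventPoint_of_even (hr₀ : 0 < r₀) (hp : ∀ i, 0 < p i)
    (heven : ∀ i, Even (p i)) {k : ℝ} (hs : Real.sin k ≠ 0) :
    ¬ (cayleyGraph (canonicalGen r₀ p m)).kirchhoffLaplacian.IsResolventPoint ((k : ℂ) ^ 2) := by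
  classical
  have hr : (1 : ℝ) ≤ r₀ := Nat.one_le_cast.2 hr₀
  have hcard : (Fintype.card (GenIndex r₀ m) : ℝ)
      = r₀ + (Finset.univ : Finset ((i : Fin a) × Fin (m i))).card := by
    rw [Finset.card_univ, Fintype.card_sum, Fintype.card_fin, Nat.cast_add]
  obtain ⟨ε, hε, hy⟩ := exists_signs_abs_sub_sum_le
    (Finset.univ : Finset ((i : Fin a) × Fin (m i))) hr
    (Fintype.card (GenIndex r₀ m) * Real.cos k) (by
      rw [← hcard, abs_mul, abs_of_nonneg (Nat.cast_nonneg _)]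
      exact mul_le_of_le_one_right (Nat.cast_nonneg _) (Real.abs_cos_le_one k))
  set y := Fintype.card (GenIndex r₀ m) * Real.cos k - ∑ j, ε j with hydef
  have hr0 : (0 : ℝ) < r₀ := by linarith
  have hq : |y / r₀| ≤ 1 := by rw [abs_div, abs_of_pos hr0, div_le_one hr0]; exact hy
  -- Torsion generators take the signs ε, allowed because their orders are even. The remainder y, of
  -- modulus at most r₀, is shared equally by the free generators.
  let ζ : GenIndex r₀ m → Circle := Sum.elim (fun _ => Circle.exp (Real.arccos (y / r₀)))
    (fun x => if ε x = 1 then 1 else Circle.exp Real.pi)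
  refine not_isResolventPoint_of_values hr₀ hp ζ (fun i k => ?_) ?_ hs
  · show (if ε ⟨i, k⟩ = 1 then (1 : Circle) else Circle.exp Real.pi) ^ p i = 1
    split_ifs
    · exact one_pow _
    · obtain ⟨n, hn⟩ := heven i
      rw [← Circle.exp_nsmul, Circle.exp_eq_one]
      refine ⟨n, ?_⟩
      rw [nsmul_eq_mul, hn]; push_cast; ring
  · have h1 : ∀ i : Fin r₀, (ζ (Sum.inl i) : ℂ).re = y / r₀ := by
      intro i
      show (Circle.exp (Real.arccos (y / r₀)) : ℂ).re = _
      rw [Circle.coe_exp, Complex.exp_ofReal_mul_I_re,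
        Real.cos_arccos (abs_le.1 hq).1 (abs_le.1 hq).2]
    have h2 : ∀ x, (ζ (Sum.inr x) : ℂ).re = ε x := by
      intro x
      show ((if ε x = 1 then (1 : Circle) else Circle.exp Real.pi : Circle) : ℂ).re = ε x
      split_ifs with h
      · simp [h]
      · rw [Circle.coe_exp, Complex.exp_ofReal_mul_I_re, Real.cos_pi,
          (hε x).resolve_left h]
    rw [Fintype.sum_sum_type]
    simp only [h1, h2]
    rw [Finset.sum_const, Finset.card_univ, Fintype.card_fin, nsmul_eq_mul,
      mul_div_cancel₀ _ hr0.ne', hydef, sub_add_cancel]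

end FGAbelian

/-! ### Containment in the half line and equality by closure -/

theorem dense_setOf_sin_ne_zero : Dense {k : ℝ | Real.sin k ≠ 0} := by
  have : {k : ℝ | Real.sin k ≠ 0} = (Set.range fun n : ℤ => (n : ℝ) * Real.pi)ᶜ := by
    ext k
    simp [Real.sin_eq_zero_iff]
  rw [this]
  exact (Set.countable_range _).dense_compl ℝ

/-- The spectrum of the Laplacian of a Cayley graph is contained in the half line. -/
theorem unboundedSpectrum_subset {Γ ι : Type*} [AddCommGroup Γ] [Fintype ι] [Nonempty ι]
    (gen : ι → Γ) : (cayleyGraph gen).kirchhoffLaplacian.unboundedSpectrum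
      ⊆ (fun x : ℝ => (x : ℂ)) '' Set.Ici 0 := by
  intro z hz
  by_contra hne
  obtain ⟨w, rfl⟩ := IsAlgClosed.exists_pow_nat_eq z two_pos
  have hreal : ∀ k : ℝ, w ≠ k := by
    rintro k rfl
    exact hne ⟨k ^ 2, sq_nonneg k, by push_cast; rfl⟩
  refine hz (isResolventPoint_of_isUnit gen ?_ (isUnit_shiftedAdjacency_of_notMem gen ?_))
  · rw [Ne, sinSol_one_eq_zero_iff, Complex.sin_eq_zero_iff]
    rintro ⟨-, n, hn⟩
    exact hreal (n * Real.pi) (by rw [hn]; push_cast; rfl)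
  · intro x hx h
    -- If cos w is real in [-1, 1], then w differs from ± a real arccosine by a multiple of 2π and
    -- is real, so w² would be a nonnegative real number.
    rw [← Real.cos_arccos hx.1 hx.2, Complex.ofReal_cos, Complex.cos_eq_cos_iff] at h
    obtain ⟨n, hn | hn⟩ := h
    · exact hreal (2 * n * Real.pi + Real.arccos x) (by rw [hn]; push_cast; rfl)
    · exact hreal (2 * n * Real.pi - Real.arccos x) (by rw [hn]; push_cast; rfl)

/-- The points k² with sin k ≠ 0 come from characters. Such k are dense and the spectrum is closed,
so the Dirichlet points, where the reduction to A is unavailable, follow by continuity of squaring.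
-/
theorem unboundedSpectrum_eq_of_even {r₀ a : ℕ} {p m : Fin a → ℕ} (hr₀ : 0 < r₀)
    (hp : ∀ i, 0 < p i) (heven : ∀ i, Even (p i)) :
    (cayleyGraph (canonicalGen r₀ p m)).kirchhoffLaplacian.unboundedSpectrum
      = (fun x : ℝ => (x : ℂ)) '' Set.Ici 0 := by
  have : Nonempty (GenIndex r₀ m) := ⟨Sum.inl ⟨0, hr₀⟩⟩
  refine (unboundedSpectrum_subset _).antisymm ?_
  have hclosed : IsClosed
      (cayleyGraph (canonicalGen r₀ p m)).kirchhoffLaplacian.unboundedSpectrum :=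
    isOpen_compl_iff.1 (by
      rw [LinearPMap.unboundedSpectrum, Set.compl_ofPred]
      simpa using LinearPMap.isOpen_setOf_isResolventPoint _)
  have hpre : IsClosed ((fun k : ℝ => (k : ℂ) ^ 2) ⁻¹'
      (cayleyGraph (canonicalGen r₀ p m)).kirchhoffLaplacian.unboundedSpectrum) :=
    hclosed.preimage (by fun_prop)
  have hsub : {k : ℝ | Real.sin k ≠ 0} ⊆ (fun k : ℝ => (k : ℂ) ^ 2) ⁻¹'
      (cayleyGraph (canonicalGen r₀ p m)).kirchhoffLaplacian.unboundedSpectrum := fun k hk =>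
    not_isResolventPoint_of_even hr₀ hp heven hk
  have huniv := (dense_setOf_sin_ne_zero.mono hsub).closure_eq
  rw [hpre.closure_eq] at huniv
  rintro _ ⟨x, hx, rfl⟩
  have : Real.sqrt x ∈ ((fun k : ℝ => (k : ℂ) ^ 2) ⁻¹'
      (cayleyGraph (canonicalGen r₀ p m)).kirchhoffLaplacian.unboundedSpectrum) := by
    rw [Set.eq_univ_iff_forall] at huniv
    exact huniv _
  rw [Set.mem_preimage, ← Complex.ofReal_pow, Real.sq_sqrt hx] at this
  exact this

/-! ### Counting eigenvalues of unbounded operators -/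

namespace LinearPMap

variable {H : Type*} [NormedAddCommGroup H] [NormedSpace ℂ H] (T : H →ₗ.[ℂ] H)

/-- Extend T algebraically to an endomorphism of the whole space. Its eigenspaces contain those of T
and are independent; no symmetry or continuity is involved. -/
theorem iSupIndep_eigenspaceAt : iSupIndep fun s : ℝ => T.eigenspaceAt (s : ℂ) := by
  obtain ⟨g, hg⟩ := T.toFun.exists_extend
  have h1 : iSupIndep fun s : ℝ => Module.End.eigenspace g (s : ℂ) :=
    (Module.End.eigenspaces_iSupIndep g).comp Complex.ofReal_injective
  refine h1.mono fun s x hx => ?_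
  obtain ⟨h, e⟩ := hx
  rw [Module.End.mem_eigenspace_iff, ← e]
  exact congrArg (fun F : T.domain →ₗ[ℂ] H => F ⟨x, h⟩) hg

/-- The number of eigenvalues in a set, counted with multiplicity. -/
noncomputable def rankOn (A : Set ℝ) : Cardinal :=
  Module.rank ℂ (⨆ s ∈ A, T.eigenspaceAt ((s : ℝ) : ℂ) : Submodule ℂ H)

theorem rankOn_Iic (t : ℝ) : T.rankOn (Set.Iic t) = T.eigenvalueCount t := by
  rw [LinearPMap.eigenvalueCount, iSup_subtype'' (Set.Iic t) fun s : ℝ => T.eigenspaceAt (s : ℂ)]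
  rfl

theorem rankOn_mono {A B : Set ℝ} (h : A ⊆ B) : T.rankOn A ≤ T.rankOn B :=
  Submodule.rank_mono (biSup_mono h)

theorem rankOn_union {A B : Set ℝ} (h : Disjoint A B) :
    T.rankOn (A ∪ B) = T.rankOn A + T.rankOn B := by
  have hd := T.iSupIndep_eigenspaceAt.disjoint_biSup_biSup h
  have := Submodule.rank_sup_add_rank_inf_eq (⨆ s ∈ A, T.eigenspaceAt ((s : ℝ) : ℂ))
    (⨆ s ∈ B, T.eigenspaceAt ((s : ℝ) : ℂ))
  rw [hd.eq_bot, rank_bot, add_zero, ← iSup_union] at this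
  exact this

theorem rankOn_singleton (s : ℝ) :
    T.rankOn {s} = Module.rank ℂ (T.eigenspaceAt (s : ℂ)) := by
  rw [rankOn, iSup_singleton]

theorem rankOn_eq_zero {A : Set ℝ}
    (h : ∀ s ∈ A, Module.rank ℂ (T.eigenspaceAt (s : ℂ)) = 0) : T.rankOn A = 0 := by
  have : (⨆ s ∈ A, T.eigenspaceAt ((s : ℝ) : ℂ)) = ⊥ :=
    iSup₂_eq_bot.2 fun s hs => Submodule.rank_eq_zero.1 (h s hs)
  rw [rankOn, this, rank_bot]

theorem rankOn_insert {A : Set ℝ} {s : ℝ} (hs : s ∉ A) :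
    T.rankOn (insert s A) = Module.rank ℂ (T.eigenspaceAt (s : ℂ)) + T.rankOn A := by
  rw [Set.insert_eq, T.rankOn_union (Set.disjoint_singleton_left.2 hs), rankOn_singleton]

theorem rankOn_eq_of_subset {A B : Set ℝ} (hBA : B ⊆ A)
    (h : ∀ s ∈ A, s ∉ B → Module.rank ℂ (T.eigenspaceAt (s : ℂ)) = 0) :
    T.rankOn A = T.rankOn B := by
  rw [← Set.union_sdiff_cancel hBA, T.rankOn_union Set.disjoint_sdiff_right,
    T.rankOn_eq_zero (A := A \ B) fun s hs => h s hs.1 hs.2, add_zero]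

end LinearPMap

/-! ### Eigenspaces of the Floquet operators -/

section Bouquet

variable {ι : Type*} [Fintype ι] (z : ι → Circle)

/-- The solution of `-u'' = w² u` with common initial value and given initial slopes. -/
noncomputable def bouquetSolution (ι : Type*) [Fintype ι] (w : ℂ) :
    (ℂ × (ι → ℂ)) →ₗ[ℂ] GraphL2 ι where
  toFun x := ⟨fun j => x.1 • cosEdge w + x.2 j • sinEdge w, Memℓp.all _⟩
  map_add' x y := lp.ext (funext fun j => by
    show (x.1 + y.1) • cosEdge w + (x.2 j + y.2 j) • sinEdge w
      = (x.1 • cosEdge w + x.2 j • sinEdge w) + (y.1 • cosEdge w + y.2 j • sinEdge w)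
    rw [add_smul, add_smul]; abel)
  map_smul' c x := lp.ext (funext fun j => by
    show (c * x.1) • cosEdge w + (c * x.2 j) • sinEdge w
      = c • (x.1 • cosEdge w + x.2 j • sinEdge w)
    rw [smul_add, mul_smul, mul_smul])

theorem bouquetSolution_apply (w : ℂ) (x : ℂ × (ι → ℂ)) (j : ι) :
    bouquetSolution ι w x j = x.1 • cosEdge w + x.2 j • sinEdge w := rfl

theorem bouquetSolution_injective [Nonempty ι] (w : ℂ) :
    Function.Injective (bouquetSolution ι w) := by
  rw [← LinearMap.ker_eq_bot, LinearMap.ker_eq_bot']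
  intro x hx
  have h : ∀ j, x.1 = 0 ∧ x.2 j = 0 := fun j => cosEdge_sinEdge_eq_zero (w := w) (by
    rw [← bouquetSolution_apply, hx]; rfl)
  obtain ⟨j₀⟩ := ‹Nonempty ι›
  exact Prod.ext (h j₀).1 (funext fun j => (h j).2)

/-- Uniqueness of the representative turns the existential vertex conditions into explicit equations
for the common value and the slopes. -/
theorem bouquetSolution_mem_eigenspaceAt_iff (w : ℂ) (x : ℂ × (ι → ℂ)) :
    bouquetSolution ι w x ∈ ((bouquet ι).twistedLaplacian z).eigenspaceAt (w ^ 2) ↔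
      (∀ j, x.1 * cosSol w 1 + x.2 j * sinSol w 1 = z j * x.1) ∧
      ∑ j, ((z j : ℂ)⁻¹ * (-(w ^ 2 * (x.1 * sinSol w 1)) + x.2 j * cosSol w 1) - x.2 j) = 0 := by
  have hz : ∀ j, (z j : ℂ) ≠ 0 := fun j => Circle.coe_ne_zero _
  have hrep : ∀ j, IsH2Rep (bouquetSolution ι w x j) (w ^ 2 • bouquetSolution ι w x j)
      (fun y => x.1 * cosSol w y + x.2 j * sinSol w y)
      (fun y => -(w ^ 2 * (x.1 * sinSol w y)) + x.2 j * cosSol w y) := fun j =>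
    isH2Rep_cosEdge_add_sinEdge w x.1 (x.2 j)
  rw [LinearPMap.mem_eigenspaceAt_iff, (bouquet ι).mem_graph_iff]
  constructor
  · rintro ⟨u, v, huv, hc⟩
    rw [bouquet_vertexConditions_iff] at hc
    obtain ⟨⟨c, hc⟩, hk⟩ := hc
    have huv' : ∀ j, IsH2Rep (bouquetSolution ι w x j) (w ^ 2 • bouquetSolution ι w x j)
      (u j) (v j) := huv
    have h0 := fun j => (huv' j).unique (hrep j) (x := 0) ⟨le_rfl, zero_le_one⟩
    have h1 := fun j => (huv' j).unique (hrep j) (x := 1) ⟨zero_le_one, le_rfl⟩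
    simp only [cosSol_zero, sinSol_zero, mul_one, mul_zero, add_zero, zero_add, neg_zero] at h0
    refine ⟨fun j => ?_, ?_⟩
    · rw [← (h1 j).1, ← (h0 j).1, (hc j).1, ← (hc j).2]
      field_simp [hz j]
    · rw [← hk]
      exact Finset.sum_congr rfl fun j _ => by rw [(h1 j).2, (h0 j).2]
  · rintro ⟨h1, h2⟩
    refine ⟨_, _, hrep, ?_⟩
    rw [bouquet_vertexConditions_iff]
    refine ⟨⟨x.1, fun j => ⟨by simp [cosSol_zero, sinSol_zero], ?_⟩⟩, ?_⟩
    · rw [h1 j]; field_simp [hz j]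
    · rw [← h2]
      exact Finset.sum_congr rfl fun j _ => by simp [cosSol_zero, sinSol_zero]

/-- The initial values of eigenfunctions. -/
noncomputable def bouquetInitialValues (w : ℂ) : Submodule ℂ (ℂ × (ι → ℂ)) :=
  (((bouquet ι).twistedLaplacian z).eigenspaceAt (w ^ 2)).comap (bouquetSolution ι w)

theorem mem_bouquetInitialValues_iff (w : ℂ) (x : ℂ × (ι → ℂ)) :
    x ∈ bouquetInitialValues z w ↔
      (∀ j, x.1 * cosSol w 1 + x.2 j * sinSol w 1 = z j * x.1) ∧
      ∑ j, ((z j : ℂ)⁻¹ * (-(w ^ 2 * (x.1 * sinSol w 1)) + x.2 j * cosSol w 1) - x.2 j) = 0 :=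
  bouquetSolution_mem_eigenspaceAt_iff z w x

/-- Continuity at the single vertex makes all components start from one common value, so every
eigenfunction is given by its initial data and the problem is finite dimensional. -/
theorem rank_eigenspaceAt_bouquet [Nonempty ι] (w : ℂ) :
    Module.rank ℂ (((bouquet ι).twistedLaplacian z).eigenspaceAt (w ^ 2))
      = (Module.finrank ℂ (bouquetInitialValues z w) : Cardinal) := by
  have hle : ((bouquet ι).twistedLaplacian z).eigenspaceAt (w ^ 2)
      ≤ LinearMap.range (bouquetSolution ι w) := by
    intro f hf
    rw [LinearPMap.mem_eigenspaceAt_iff, (bouquet ι).mem_graph_iff] at hf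
    obtain ⟨u, v, huv, hc⟩ := hf
    rw [bouquet_vertexConditions_iff] at hc
    obtain ⟨⟨c, hc⟩, -⟩ := hc
    refine ⟨(c, fun j => v j 0), lp.ext (funext fun j => ?_)⟩
    have huv' : IsH2Rep (f j) (w ^ 2 • f j) (u j) (v j) := huv j
    rw [bouquetSolution_apply, huv'.eq_combination, (hc j).1]
  rw [Module.finrank_eq_rank, ← Submodule.map_comap_eq_self hle]
  exact (Submodule.equivMapOfInjective _ (bouquetSolution_injective w)
    (bouquetInitialValues z w)).rank_eq.symm

theorem sum_add_inv_circle : ∑ j, ((z j : ℂ) + (z j : ℂ)⁻¹) = 2 * (∑ j, (z j : ℂ).re : ℝ) := by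
  push_cast
  rw [Finset.mul_sum]
  refine Finset.sum_congr rfl fun j _ => ?_
  rw [Complex.inv_eq_conj (Circle.norm_coe _), Complex.add_conj]
  push_cast; rfl

/-- Away from the Dirichlet points the phase condition determines each slope from the common value.
Kirchhoff's condition is then the scalar dispersion relation r cos w = ∑ Re z_j times that value. -/
theorem mem_bouquetInitialValues_iff_of_ne {w : ℂ} (hs : sinSol w 1 ≠ 0) (x : ℂ × (ι → ℂ)) :
    x ∈ bouquetInitialValues z w ↔
      (∀ j, x.2 j = (sinSol w 1)⁻¹ * ((z j - cosSol w 1) * x.1)) ∧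
      (Fintype.card ι * cosSol w 1 - (∑ j, (z j : ℂ).re : ℝ)) * x.1 = 0 := by
  have hz : ∀ j, (z j : ℂ) ≠ 0 := fun j => Circle.coe_ne_zero _
  have e1 : (∀ j, x.1 * cosSol w 1 + x.2 j * sinSol w 1 = z j * x.1) ↔
      ∀ j, x.2 j = (sinSol w 1)⁻¹ * ((z j - cosSol w 1) * x.1) := by
    refine forall_congr' fun j => ?_
    rw [eq_inv_mul_iff_mul_eq₀ hs]
    constructor <;> intro h <;> linear_combination h
  rw [mem_bouquetInitialValues_iff, e1]
  refine and_congr_right fun h => ?_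
  have e2 : ∑ j, ((z j : ℂ)⁻¹ * (-(w ^ 2 * (x.1 * sinSol w 1)) + x.2 j * cosSol w 1) - x.2 j)
      = 2 * (sinSol w 1)⁻¹
        * ((Fintype.card ι * cosSol w 1 - (∑ j, (z j : ℂ).re : ℝ)) * x.1) := by
    have h3 := sum_add_inv_circle z
    calc _ = ∑ j, ((sinSol w 1)⁻¹ * x.1 * (2 * cosSol w 1 - ((z j : ℂ) + (z j : ℂ)⁻¹))) := by
          refine Finset.sum_congr rfl fun j _ => ?_
          rw [h j]
          have := hz j
          field_simp
          linear_combination -x.1 * cosSol_sq_add w 1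
      _ = _ := by
          rw [← Finset.mul_sum, Finset.sum_sub_distrib, h3, Finset.sum_const, nsmul_eq_mul,
            Finset.card_univ]
          ring
  rw [e2]
  simp [hs]

theorem rank_eigenspaceAt_eq_zero [Nonempty ι] {w : ℂ} (hs : sinSol w 1 ≠ 0)
    (hc : Fintype.card ι * cosSol w 1 ≠ (∑ j, (z j : ℂ).re : ℝ)) :
    Module.rank ℂ (((bouquet ι).twistedLaplacian z).eigenspaceAt (w ^ 2)) = 0 := by
  have : bouquetInitialValues z w = ⊥ := by
    rw [Submodule.eq_bot_iff]
    intro x hx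
    rw [mem_bouquetInitialValues_iff_of_ne z hs] at hx
    have h1 : x.1 = 0 := (mul_eq_zero.1 hx.2).resolve_left (sub_ne_zero.2 hc)
    exact Prod.ext h1 (funext fun j => by rw [hx.1 j, h1]; simp)
  rw [rank_eigenspaceAt_bouquet, this, finrank_bot, Nat.cast_zero]

theorem rank_eigenspaceAt_eq_one [Nonempty ι] {w : ℂ} (hs : sinSol w 1 ≠ 0)
    (hc : Fintype.card ι * cosSol w 1 = (∑ j, (z j : ℂ).re : ℝ)) :
    Module.rank ℂ (((bouquet ι).twistedLaplacian z).eigenspaceAt (w ^ 2)) = 1 := by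
  have : bouquetInitialValues z w
      = ℂ ∙ ((1, fun j => (sinSol w 1)⁻¹ * (z j - cosSol w 1)) : ℂ × (ι → ℂ)) := by
    ext x
    rw [mem_bouquetInitialValues_iff_of_ne z hs, Submodule.mem_span_singleton]
    constructor
    · rintro ⟨h, -⟩
      refine ⟨x.1, Prod.ext (by simp) (funext fun j => ?_)⟩
      rw [h j]; simp; ring
    · rintro ⟨c, rfl⟩
      refine ⟨fun j => by simp; ring, by rw [hc, sub_self, zero_mul]⟩
  rw [rank_eigenspaceAt_bouquet, this, finrank_span_singleton (by simp), Nat.cast_one]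

/-- All r + 1 initial data are admissible: the phase conditions hold identically and each Kirchhoff
summand vanishes. -/
theorem rank_eigenspaceAt_of_forall_eq [Nonempty ι] {w : ℂ} (hs : sinSol w 1 = 0)
    (h : ∀ j, (z j : ℂ) = cosSol w 1) :
    Module.rank ℂ (((bouquet ι).twistedLaplacian z).eigenspaceAt (w ^ 2))
      = (Fintype.card ι + 1 : ℕ) := by
  have : bouquetInitialValues z w = ⊤ := by
    rw [Submodule.eq_top_iff']
    intro x
    rw [mem_bouquetInitialValues_iff, hs]
    refine ⟨fun j => by rw [h j]; ring, Finset.sum_eq_zero fun j _ => ?_⟩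
    have : cosSol w 1 ≠ 0 := by rw [← h j]; exact Circle.coe_ne_zero _
    rw [h j]
    field_simp
    ring
  rw [rank_eigenspaceAt_bouquet, this, finrank_top, Module.finrank_prod, Module.finrank_self,
    Module.finrank_fintype_fun_eq_card, add_comm]

/-- A mismatched phase forces the common value to be 0. The r slopes then satisfy the Kirchhoff
condition alone, a linear functional that is nonzero by the same mismatch. -/
theorem rank_eigenspaceAt_of_exists_ne [Nonempty ι] {w : ℂ} (hs : sinSol w 1 = 0)
    (h : ∃ j, (z j : ℂ) ≠ cosSol w 1) :
    Module.rank ℂ (((bouquet ι).twistedLaplacian z).eigenspaceAt (w ^ 2))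
      = (Fintype.card ι - 1 : ℕ) := by
  classical
  obtain ⟨j₀, hj₀⟩ := h
  have hz : ∀ j, (z j : ℂ) ≠ 0 := fun j => Circle.coe_ne_zero _
  let ℓ : Module.Dual ℂ (ι → ℂ) :=
    ∑ j, ((z j : ℂ)⁻¹ * cosSol w 1 - 1) • LinearMap.proj j
  have hℓ : ∀ b, ℓ b = ∑ j, ((z j : ℂ)⁻¹ * cosSol w 1 - 1) * b j := by
    intro b
    simp [ℓ]
  have hℓ0 : ℓ ≠ 0 := by
    intro h0
    have h1 := hℓ (Pi.single j₀ 1)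
    rw [h0, Finset.sum_eq_single j₀ (fun b _ hb => by simp [hb]) (by simp)] at h1
    simp only [LinearMap.zero_apply, Pi.single_eq_same, mul_one] at h1
    have h2 : (z j₀ : ℂ)⁻¹ * cosSol w 1 = 1 := (sub_eq_zero.1 h1.symm)
    rw [inv_mul_eq_one₀ (hz j₀)] at h2
    exact hj₀ h2
  have hW : bouquetInitialValues z w
      = (LinearMap.ker ℓ).map (LinearMap.inr ℂ ℂ (ι → ℂ)) := by
    ext x
    rw [mem_bouquetInitialValues_iff, hs, Submodule.mem_map]
    have e : x.1 = 0 → (∑ j, ((z j : ℂ)⁻¹ * (-(w ^ 2 * (x.1 * 0)) + x.2 j * cosSol w 1) - x.2 j)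
        = ℓ x.2) := by
      intro hx
      rw [hℓ]
      exact Finset.sum_congr rfl fun j _ => by ring
    constructor
    · rintro ⟨h1, h2⟩
      have h3 := h1 j₀
      have hx : x.1 = 0 := by
        have : (z j₀ - cosSol w 1) * x.1 = 0 := by linear_combination -h3
        exact (mul_eq_zero.1 this).resolve_left (sub_ne_zero.2 hj₀)
      rw [e hx] at h2
      exact ⟨x.2, h2, Prod.ext hx.symm rfl⟩
    · rintro ⟨b, hb, rfl⟩
      exact ⟨fun j => by simp, by rw [e rfl]; exact hb⟩
  have hfin := Module.Dual.finrank_ker_add_one_of_ne_zero hℓ0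
  rw [Module.finrank_fintype_fun_eq_card] at hfin
  rw [rank_eigenspaceAt_bouquet, hW,
    ← (Submodule.equivMapOfInjective _ LinearMap.inr_injective (LinearMap.ker ℓ)).finrank_eq,
    ← hfin, Nat.add_sub_cancel]

end Bouquet

/-! ### The ordered eigenvalues of the Floquet operators -/

theorem Circle.eq_one_of_re_eq_one {ζ : Circle} (h : (ζ : ℂ).re = 1) : ζ = 1 := by
  have h1 := Circle.normSq_coe ζ
  rw [Complex.normSq_apply, h] at h1
  have h2 : (ζ : ℂ).im = 0 := by nlinarith
  exact Circle.ext (Complex.ext (by simpa using h) (by simpa using h2))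

theorem Circle.coe_eq_neg_one_of_re_eq {ζ : Circle} (h : (ζ : ℂ).re = -1) : (ζ : ℂ) = -1 := by
  have h1 := Circle.normSq_coe ζ
  rw [Complex.normSq_apply, h] at h1
  have h2 : (ζ : ℂ).im = 0 := by nlinarith
  exact Complex.ext (by simpa using h) (by simpa using h2)

theorem Circle.abs_re_le_one (ζ : Circle) : |(ζ : ℂ).re| ≤ 1 :=
  (Complex.abs_re_le_norm _).trans (Circle.norm_coe ζ).le

section BouquetCounting

variable {ι : Type*} [Fintype ι] (z : ι → Circle)

/-- The quasimomentum `κ ∈ [0, π]` with `r cos κ = ∑ Re z_j`. -/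
noncomputable def bouquetAngle : ℝ := Real.arccos ((∑ j, (z j : ℂ).re) / Fintype.card ι)

theorem bouquetAngle_nonneg : 0 ≤ bouquetAngle z := Real.arccos_nonneg _

theorem bouquetAngle_le_pi : bouquetAngle z ≤ Real.pi := Real.arccos_le_pi _

variable [Nonempty ι]

theorem card_mul_cos_bouquetAngle :
    Fintype.card ι * Real.cos (bouquetAngle z) = ∑ j, (z j : ℂ).re := by
  have hr : (0 : ℝ) < Fintype.card ι := Nat.cast_pos.2 Fintype.card_pos
  have h : |(∑ j, (z j : ℂ).re) / Fintype.card ι| ≤ 1 := by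
    rw [abs_div, abs_of_pos hr, div_le_one hr]
    refine (Finset.abs_sum_le_sum_abs _ _).trans
      ((Finset.sum_le_sum fun j _ => Circle.abs_re_le_one (z j)).trans ?_)
    simp
  rw [bouquetAngle, Real.cos_arccos (abs_le.1 h).1 (abs_le.1 h).2, mul_div_cancel₀ _ hr.ne']

theorem bouquetAngle_lt_pi (h : ∃ j, (z j : ℂ) ≠ -1) : bouquetAngle z < Real.pi := by
  refine lt_of_le_of_ne (bouquetAngle_le_pi z) fun hπ => ?_
  obtain ⟨j, hj⟩ := h
  have h1 := card_mul_cos_bouquetAngle z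
  rw [hπ, Real.cos_pi] at h1
  have h2 : ∑ _j : ι, (-1 : ℝ) < ∑ j, (z j : ℂ).re :=
    Finset.sum_lt_sum (fun i _ => (abs_le.1 (Circle.abs_re_le_one (z i))).1)
      ⟨j, Finset.mem_univ _, lt_of_le_of_ne (abs_le.1 (Circle.abs_re_le_one (z j))).1
        fun h => hj (Circle.coe_eq_neg_one_of_re_eq h.symm)⟩
  rw [← h1] at h2
  simp at h2

theorem bouquetAngle_eq_zero_iff : bouquetAngle z = 0 ↔ ∀ j, z j = 1 := by
  have h1 := card_mul_cos_bouquetAngle z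
  constructor
  · intro h0
    rw [h0, Real.cos_zero] at h1
    by_contra hne
    push Not at hne
    obtain ⟨j, hj⟩ := hne
    have h2 : ∑ j, (z j : ℂ).re < ∑ _j : ι, (1 : ℝ) :=
      Finset.sum_lt_sum (fun i _ => (abs_le.1 (Circle.abs_re_le_one (z i))).2)
        ⟨j, Finset.mem_univ _, lt_of_le_of_ne (abs_le.1 (Circle.abs_re_le_one (z j))).2
          fun h => hj (Circle.eq_one_of_re_eq_one h)⟩
    rw [← h1] at h2
    simp at h2
  · intro h
    have hr : (Fintype.card ι : ℝ) ≠ 0 := Nat.cast_ne_zero.2 Fintype.card_ne_zero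
    simp [bouquetAngle, h, hr]

/-- The multiplicity of a real number as an eigenvalue of the operator on the bouquet. -/
noncomputable def bouquetMultiplicity (s : ℝ) : Cardinal :=
  Module.rank ℂ (((bouquet ι).twistedLaplacian z).eigenspaceAt (s : ℂ))

/-- With s = (iy)² the dispersion relation would equate cosh y > 1 with a cosine. -/
theorem bouquetMultiplicity_of_neg {s : ℝ} (hs : s < 0) : bouquetMultiplicity z s = 0 := by
  set y := Real.sqrt (-s) with hy
  have hy0 : 0 < y := Real.sqrt_pos.2 (by linarith)
  have hw : (s : ℂ) = ((y : ℂ) * Complex.I) ^ 2 := by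
    rw [mul_pow, Complex.I_sq, ← Complex.ofReal_pow, hy, Real.sq_sqrt (by linarith)]
    push_cast; ring
  rw [bouquetMultiplicity, hw]
  refine rank_eigenspaceAt_eq_zero z ?_ ?_
  · rw [Ne, sinSol_one_eq_zero_iff, Complex.sin_mul_I, ← Complex.ofReal_sinh]
    rintro ⟨-, h⟩
    have h1 := (mul_eq_zero.1 h).resolve_right Complex.I_ne_zero
    exact (Real.sinh_pos_iff.2 hy0).ne' (by exact_mod_cast h1)
  · rw [cosSol_one, Complex.cos_mul_I, ← Complex.ofReal_cosh, ← card_mul_cos_bouquetAngle z]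
    intro h
    have h1 : (Fintype.card ι : ℝ) * Real.cosh y
        = Fintype.card ι * Real.cos (bouquetAngle z) := by exact_mod_cast h
    have hr : (0 : ℝ) < Fintype.card ι := Nat.cast_pos.2 Fintype.card_pos
    have h2 := mul_left_cancel₀ hr.ne' h1
    have h3 := Real.one_lt_cosh.2 hy0.ne'
    linarith [Real.cos_le_one (bouquetAngle z)]

/-- The case k = 0 is admitted because `sinSol 0 1 = 1`: zero is not a Dirichlet eigenvalue. -/
theorem sinSol_ofReal_one_ne_zero {k : ℝ} (hk : k = 0 ∨ Real.sin k ≠ 0) :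
    sinSol (k : ℂ) 1 ≠ 0 := by
  rw [Ne, sinSol_one_eq_zero_iff, ← Complex.ofReal_sin, Complex.ofReal_eq_zero,
    Ne, Complex.ofReal_eq_zero]
  rintro ⟨h1, h2⟩
  exact hk.elim h1 (fun h => h h2)

theorem bouquetMultiplicity_sq_eq_zero {k : ℝ} (hk : k = 0 ∨ Real.sin k ≠ 0)
    (hc : Real.cos k ≠ Real.cos (bouquetAngle z)) : bouquetMultiplicity z (k ^ 2) = 0 := by
  rw [bouquetMultiplicity, Complex.ofReal_pow]
  refine rank_eigenspaceAt_eq_zero z (sinSol_ofReal_one_ne_zero hk) ?_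
  rw [cosSol_one, ← Complex.ofReal_cos, ← card_mul_cos_bouquetAngle z]
  intro h
  have h1 : (Fintype.card ι : ℝ) * Real.cos k
      = Fintype.card ι * Real.cos (bouquetAngle z) := by exact_mod_cast h
  exact hc (mul_left_cancel₀ (Nat.cast_ne_zero.2 Fintype.card_ne_zero) h1)

theorem bouquetMultiplicity_sq_eq_one {k : ℝ} (hk : k = 0 ∨ Real.sin k ≠ 0)
    (hc : Real.cos k = Real.cos (bouquetAngle z)) : bouquetMultiplicity z (k ^ 2) = 1 := by
  rw [bouquetMultiplicity, Complex.ofReal_pow]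
  refine rank_eigenspaceAt_eq_one z (sinSol_ofReal_one_ne_zero hk) ?_
  rw [cosSol_one, ← Complex.ofReal_cos, ← card_mul_cos_bouquetAngle z, hc]
  push_cast; rfl

/-! ### Multiplicities in coordinates centred at even multiples of π -/

theorem cos_even_mul_pi_add (l : ℕ) (x : ℝ) :
    Real.cos (2 * (l : ℝ) * Real.pi + x) = Real.cos x := by
  rw [show 2 * (l : ℝ) * Real.pi + x = x + l * (2 * Real.pi) by ring,
    Real.cos_add_nat_mul_two_pi]

theorem sin_even_mul_pi_add (l : ℕ) (x : ℝ) :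
    Real.sin (2 * (l : ℝ) * Real.pi + x) = Real.sin x := by
  rw [show 2 * (l : ℝ) * Real.pi + x = x + l * (2 * Real.pi) by ring,
    Real.sin_add_nat_mul_two_pi]

/-- For |x| < π the only Dirichlet point is x = 0, and for l = 0 even that one is not exceptional.
-/
theorem even_mul_pi_add_eq_zero_or {l : ℕ} {x : ℝ} (hx : |x| < Real.pi) (h0 : x = 0 → l = 0) :
    2 * (l : ℝ) * Real.pi + x = 0 ∨ Real.sin (2 * (l : ℝ) * Real.pi + x) ≠ 0 := by
  rw [sin_even_mul_pi_add]
  by_cases h : x = 0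
  · left; rw [h0 h, h]; simp
  · right
    rw [Ne, Real.sin_eq_zero_iff_of_lt_of_lt (abs_lt.1 hx).1 (abs_lt.1 hx).2]
    exact h

theorem bouquetMultiplicity_eq_zero_of_abs_ne {l : ℕ} {x : ℝ} (hx : |x| < Real.pi)
    (h0 : x = 0 → l = 0) (hκ : |x| ≠ bouquetAngle z) :
    bouquetMultiplicity z ((2 * (l : ℝ) * Real.pi + x) ^ 2) = 0 := by
  refine bouquetMultiplicity_sq_eq_zero z (even_mul_pi_add_eq_zero_or hx h0) fun h => hκ ?_
  rw [cos_even_mul_pi_add, ← Real.cos_abs] at h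
  exact Real.injOn_cos ⟨abs_nonneg _, hx.le⟩ ⟨bouquetAngle_nonneg z, bouquetAngle_le_pi z⟩ h

theorem bouquetMultiplicity_eq_one_of_abs_eq {l : ℕ} {x : ℝ} (hx : |x| < Real.pi)
    (h0 : x = 0 → l = 0) (hκ : |x| = bouquetAngle z) :
    bouquetMultiplicity z ((2 * (l : ℝ) * Real.pi + x) ^ 2) = 1 := by
  refine bouquetMultiplicity_sq_eq_one z (even_mul_pi_add_eq_zero_or hx h0) ?_
  rw [cos_even_mul_pi_add, ← Real.cos_abs, hκ]

theorem bouquetMultiplicity_odd (h : ∃ j, (z j : ℂ) ≠ -1) (l : ℕ) :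
    bouquetMultiplicity z (((2 * (l : ℝ) + 1) * Real.pi) ^ 2) = (Fintype.card ι - 1 : ℕ) := by
  rw [bouquetMultiplicity, Complex.ofReal_pow]
  refine rank_eigenspaceAt_of_exists_ne z (sinSol_one_odd_mul_pi l) ?_
  rwa [cosSol_one_odd_mul_pi]

theorem sinSol_one_even_mul_pi {l : ℕ} (hl : l ≠ 0) :
    sinSol ((2 * (l : ℝ) * Real.pi : ℝ) : ℂ) 1 = 0 := by
  have hl' : (l : ℝ) ≠ 0 := Nat.cast_ne_zero.2 hl
  have hs := sin_even_mul_pi_add l 0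
  rw [add_zero, Real.sin_zero] at hs
  rw [sinSol_one_eq_zero_iff, ← Complex.ofReal_sin, hs]
  refine ⟨?_, Complex.ofReal_zero⟩
  rw [Ne, Complex.ofReal_eq_zero]
  have := Real.pi_pos
  positivity

theorem cosSol_one_even_mul_pi (l : ℕ) : cosSol ((2 * (l : ℝ) * Real.pi : ℝ) : ℂ) 1 = 1 := by
  have hc := cos_even_mul_pi_add l 0
  rw [add_zero, Real.cos_zero] at hc
  rw [cosSol_one, ← Complex.ofReal_cos, hc, Complex.ofReal_one]

theorem bouquetMultiplicity_even_of_angle_eq_zero {l : ℕ} (hl : l ≠ 0)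
    (h : bouquetAngle z = 0) :
    bouquetMultiplicity z ((2 * (l : ℝ) * Real.pi) ^ 2) = (Fintype.card ι + 1 : ℕ) := by
  rw [bouquetMultiplicity, Complex.ofReal_pow]
  refine rank_eigenspaceAt_of_forall_eq z (sinSol_one_even_mul_pi hl) fun j => ?_
  rw [cosSol_one_even_mul_pi, (bouquetAngle_eq_zero_iff z).1 h j, Circle.coe_one]

theorem bouquetMultiplicity_even_of_angle_ne_zero {l : ℕ} (hl : l ≠ 0)
    (h : bouquetAngle z ≠ 0) :
    bouquetMultiplicity z ((2 * (l : ℝ) * Real.pi) ^ 2) = (Fintype.card ι - 1 : ℕ) := by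
  rw [bouquetMultiplicity, Complex.ofReal_pow]
  refine rank_eigenspaceAt_of_exists_ne z (sinSol_one_even_mul_pi hl) ?_
  by_contra hall
  push Not at hall
  refine h ((bouquetAngle_eq_zero_iff z).2 fun j => Circle.ext ?_)
  rw [hall j, cosSol_one_even_mul_pi, Circle.coe_one]

theorem exists_eq_even_mul_pi_add_sq {l : ℕ} {s a b : ℝ}
    (hs1 : (2 * (l : ℝ) * Real.pi + a) ^ 2 < s) (hs2 : s < (2 * (l : ℝ) * Real.pi + b) ^ 2)
    (hb : 0 ≤ 2 * (l : ℝ) * Real.pi + b) :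
    ∃ x, a < x ∧ x < b ∧ s = (2 * (l : ℝ) * Real.pi + x) ^ 2 := by
  have hs0 : 0 ≤ s := (sq_nonneg _).trans hs1.le
  have h1 := Real.lt_sqrt_of_sq_lt hs1
  have h2 : Real.sqrt s < 2 * (l : ℝ) * Real.pi + b := by
    rcases hb.eq_or_lt with h | h
    · rw [← h] at hs2; norm_num at hs2; linarith
    · rwa [Real.sqrt_lt' h]
  refine ⟨Real.sqrt s - 2 * (l : ℝ) * Real.pi, by linarith, by linarith, ?_⟩
  rw [add_sub_cancel, Real.sq_sqrt hs0]

/-- Between two consecutive odd Dirichlet eigenvalues there are `r + 1` eigenvalues. -/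
theorem rankOn_Ioo_odd (h : ∃ j, (z j : ℂ) ≠ -1) (l : ℕ) :
    ((bouquet ι).twistedLaplacian z).rankOn
      (Set.Ioo (((2 * (l : ℝ) + 1) * Real.pi) ^ 2)
        (((2 * ((l + 1 : ℕ) : ℝ) + 1) * Real.pi) ^ 2)) = (Fintype.card ι + 1 : ℕ) := by
  set T := (bouquet ι).twistedLaplacian z
  set κ := bouquetAngle z with hκ
  have hκ0 : 0 ≤ κ := bouquetAngle_nonneg z
  have hκπ : κ < Real.pi := bouquetAngle_lt_pi z h
  have hπ := Real.pi_pos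
  have hl0 : (0 : ℝ) ≤ l := Nat.cast_nonneg l
  have hK : 2 * Real.pi ≤ 2 * ((l + 1 : ℕ) : ℝ) * Real.pi := by
    push_cast; nlinarith
  have e1 : (2 * (l : ℝ) + 1) * Real.pi = 2 * ((l + 1 : ℕ) : ℝ) * Real.pi + -Real.pi := by
    push_cast; ring
  have e2 : (2 * ((l + 1 : ℕ) : ℝ) + 1) * Real.pi
      = 2 * ((l + 1 : ℕ) : ℝ) * Real.pi + Real.pi := by ring
  rw [e1, e2]
  set K := 2 * ((l + 1 : ℕ) : ℝ) * Real.pi with hKdef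
  have hmem : ∀ x, |x| < Real.pi →
      (K + x) ^ 2 ∈ Set.Ioo ((K + -Real.pi) ^ 2) ((K + Real.pi) ^ 2) := by
    intro x hx
    rw [abs_lt] at hx
    exact ⟨pow_lt_pow_left₀ (by linarith) (by linarith) two_ne_zero,
      pow_lt_pow_left₀ (by linarith) (by linarith) two_ne_zero⟩
  have hrest : ∀ s ∈ Set.Ioo ((K + -Real.pi) ^ 2) ((K + Real.pi) ^ 2), s ≠ K ^ 2 →
      s ≠ (K + κ) ^ 2 → s ≠ (K + -κ) ^ 2 → bouquetMultiplicity z s = 0 := by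
    rintro s ⟨hs1, hs2⟩ h1 h2 h3
    obtain ⟨x, hx1, hx2, rfl⟩ := exists_eq_even_mul_pi_add_sq (l := l + 1)
      hs1 hs2 (by linarith)
    refine bouquetMultiplicity_eq_zero_of_abs_ne z (abs_lt.2 ⟨hx1, hx2⟩) (fun hx => ?_)
      fun hx => ?_
    · exact absurd (by rw [hx, add_zero]) h1
    · rcases abs_choice x with h' | h'
      · exact h2 (by rw [hκ, ← hx, h'])
      · exact h3 (by rw [hκ, ← hx, h', neg_neg])
  -- For κ = 0 everything sits at K² with multiplicity r + 1. For κ > 0 it splits into the simple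
  -- eigenvalues (K ± κ)² and K² with multiplicity r - 1; both cases give the same total.
  rcases hκ0.eq_or_lt with h0 | hpos
  · rw [T.rankOn_eq_of_subset (B := {K ^ 2}), T.rankOn_singleton]
    · exact bouquetMultiplicity_even_of_angle_eq_zero z l.succ_ne_zero h0.symm
    · rw [Set.singleton_subset_iff]
      simpa using hmem 0 (by simpa using hπ)
    · intro s hs hsB
      rw [Set.mem_singleton_iff] at hsB
      refine hrest s hs hsB ?_ ?_
      · rwa [← h0, add_zero]
      · rwa [← h0, neg_zero, add_zero]
  · have hn1 : K ^ 2 < (K + κ) ^ 2 := pow_lt_pow_left₀ (by linarith) (by linarith) two_ne_zero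
    have hn2 : (K + -κ) ^ 2 < K ^ 2 := pow_lt_pow_left₀ (by linarith) (by linarith) two_ne_zero
    have hκabs : |κ| = κ := abs_of_pos hpos
    rw [T.rankOn_eq_of_subset (B := insert ((K + -κ) ^ 2) (insert (K ^ 2) {(K + κ) ^ 2})),
      T.rankOn_insert, T.rankOn_insert, T.rankOn_singleton]
    · have m1 : bouquetMultiplicity z ((K + -κ) ^ 2) = 1 :=
        bouquetMultiplicity_eq_one_of_abs_eq z (by rwa [abs_neg, hκabs])
          (fun h => absurd h (by linarith)) (by rw [abs_neg, hκabs])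
      have m2 : bouquetMultiplicity z ((K + κ) ^ 2) = 1 :=
        bouquetMultiplicity_eq_one_of_abs_eq z (by rwa [hκabs])
          (fun h => absurd h hpos.ne') hκabs
      have m3 : bouquetMultiplicity z (K ^ 2) = (Fintype.card ι - 1 : ℕ) :=
        bouquetMultiplicity_even_of_angle_ne_zero z l.succ_ne_zero hpos.ne'
      have hcard : Fintype.card ι + 1 = 1 + ((Fintype.card ι - 1) + 1) := by
        have : 0 < Fintype.card ι := Fintype.card_pos
        omega
      rw [hcard]
      push_cast
      exact congrArg₂ (· + ·) m1 (congrArg₂ (· + ·) m3 m2)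
    · rw [Set.mem_singleton_iff]; exact hn1.ne
    · rw [Set.mem_insert_iff, Set.mem_singleton_iff]
      rintro (h | h) <;> linarith
    · rintro s (rfl | rfl | rfl)
      · exact hmem (-κ) (by rwa [abs_neg, hκabs])
      · simpa using hmem 0 (by simpa using hπ)
      · exact hmem κ (by rwa [hκabs])
    · intro s hs hsB
      simp only [Set.mem_insert_iff, Set.mem_singleton_iff, not_or] at hsB
      exact hrest s hs hsB.2.1 hsB.2.2 hsB.1

/-- Below π² the only eigenvalue is κ², which is simple, also for κ = 0. -/
theorem rankOn_Iio_pi_sq (h : ∃ j, (z j : ℂ) ≠ -1) :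
    ((bouquet ι).twistedLaplacian z).rankOn (Set.Iio (Real.pi ^ 2)) = 1 := by
  set κ := bouquetAngle z with hκ
  have hκ0 : 0 ≤ κ := bouquetAngle_nonneg z
  have hκπ : κ < Real.pi := bouquetAngle_lt_pi z h
  have hπ := Real.pi_pos
  rw [LinearPMap.rankOn_eq_of_subset _ (B := {κ ^ 2}), LinearPMap.rankOn_singleton]
  · have := bouquetMultiplicity_eq_one_of_abs_eq z (l := 0) (x := κ)
      (by rwa [abs_of_nonneg hκ0]) (fun _ => rfl) (abs_of_nonneg hκ0)
    rw [Nat.cast_zero, mul_zero, zero_mul, zero_add] at this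
    exact this
  · rw [Set.singleton_subset_iff]
    exact pow_lt_pow_left₀ hκπ hκ0 two_ne_zero
  · intro s hs hsB
    rw [Set.mem_Iio] at hs
    rw [Set.mem_singleton_iff] at hsB
    rcases lt_or_ge s 0 with hneg | hnn
    · exact bouquetMultiplicity_of_neg z hneg
    · have hx : |Real.sqrt s| = Real.sqrt s := abs_of_nonneg (Real.sqrt_nonneg s)
      have := bouquetMultiplicity_eq_zero_of_abs_ne z (l := 0) (x := Real.sqrt s)
        (by rw [hx, Real.sqrt_lt' hπ]; exact hs) (fun _ => rfl)
        (fun h => hsB (by rw [hκ, ← h, hx, Real.sq_sqrt hnn]))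
      rw [Nat.cast_zero, mul_zero, zero_mul, zero_add, Real.sq_sqrt hnn] at this
      exact this

/-- Each step in l adds r - 1 at an odd Dirichlet point and r + 1 in the open interval after it, 2r
in total whatever the phases. -/
theorem rankOn_Iio_odd (h : ∃ j, (z j : ℂ) ≠ -1) (l : ℕ) :
    ((bouquet ι).twistedLaplacian z).rankOn (Set.Iio (((2 * (l : ℝ) + 1) * Real.pi) ^ 2))
      = (2 * Fintype.card ι * l + 1 : ℕ) := by
  have hπ := Real.pi_pos
  induction l with
  | zero => simpa using rankOn_Iio_pi_sq z h
  | succ l ih =>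
    have hlt : ((2 * (l : ℝ) + 1) * Real.pi) ^ 2 < ((2 * ((l + 1 : ℕ) : ℝ) + 1) * Real.pi) ^ 2 := by
      refine pow_lt_pow_left₀ ?_ (by positivity) two_ne_zero
      push_cast; nlinarith
    rw [← Set.Iic_union_Ioo_eq_Iio hlt, LinearPMap.rankOn_union _ (by
        rw [Set.disjoint_left]
        rintro x hx1 hx2
        exact absurd hx1 (not_le.2 hx2.1)),
      rankOn_Ioo_odd z h l, ← Set.Iio_insert, LinearPMap.rankOn_insert _ (by simp), ih]
    have hm := bouquetMultiplicity_odd z h l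
    rw [bouquetMultiplicity] at hm
    rw [hm]
    have hcard : 0 < Fintype.card ι := Fintype.card_pos
    rw [← Nat.cast_add, ← Nat.cast_add]
    congr 1
    rw [Nat.mul_succ]
    omega

theorem eigenvalueCount_odd (h : ∃ j, (z j : ℂ) ≠ -1) (l : ℕ) :
    ((bouquet ι).twistedLaplacian z).eigenvalueCount (((2 * (l : ℝ) + 1) * Real.pi) ^ 2)
      = (2 * Fintype.card ι * l + Fintype.card ι : ℕ) := by
  have hm := bouquetMultiplicity_odd z h l
  rw [bouquetMultiplicity] at hm
  have hcard : 0 < Fintype.card ι := Fintype.card_pos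
  rw [← LinearPMap.rankOn_Iic, ← Set.Iio_insert, LinearPMap.rankOn_insert _ (by simp), hm,
    rankOn_Iio_odd z h l, ← Nat.cast_add]
  congr 1
  omega

/-- The `k`-th eigenvalue equals the odd Dirichlet eigenvalue `((2 l + 1) π)²` for exactly `r - 1`
consecutive indices, independent of the character. -/
theorem orderedEigenvalue_eq_odd_iff (h : ∃ j, (z j : ℂ) ≠ -1) (k l : ℕ) :
    ((bouquet ι).twistedLaplacian z).orderedEigenvalue k = ((2 * (l : ℝ) + 1) * Real.pi) ^ 2 ↔
      2 * Fintype.card ι * l + 1 ≤ k ∧ k < 2 * Fintype.card ι * l + Fintype.card ι := by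
  set T := (bouquet ι).twistedLaplacian z with hT
  set κ := bouquetAngle z with hκ
  have hκ0 : 0 ≤ κ := bouquetAngle_nonneg z
  have hκπ : κ < Real.pi := bouquetAngle_lt_pi z h
  have hπ := Real.pi_pos
  have hl0 : (0 : ℝ) ≤ 2 * (l : ℝ) * Real.pi := by positivity
  set S := {t : ℝ | (k : Cardinal) < T.eigenvalueCount t} with hS
  set t₀ := ((2 * (l : ℝ) + 1) * Real.pi) ^ 2 with ht₀
  have ht₀pos : 0 < t₀ := by positivity
  have hbdd : BddBelow S := by
    refine ⟨0, fun t ht => ?_⟩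
    by_contra hneg
    push Not at hneg
    have hz : T.eigenvalueCount t = 0 := by
      rw [← LinearPMap.rankOn_Iic]
      exact T.rankOn_eq_zero fun s hs => bouquetMultiplicity_of_neg z (lt_of_le_of_lt hs hneg)
    rw [hS, Set.mem_ofPred_eq, hz] at ht
    exact absurd ht (not_lt.2 bot_le)
  have hbelow : ∀ t < t₀, T.eigenvalueCount t ≤ (2 * Fintype.card ι * l + 1 : ℕ) := by
    intro t ht
    rw [← LinearPMap.rankOn_Iic, ← rankOn_Iio_odd z h l]
    exact T.rankOn_mono fun s hs => lt_of_le_of_lt hs ht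
  -- All 2rl + 1 eigenvalues below t₀ are already counted at e < t₀, so an index k ≤ 2rl has its
  -- ordered eigenvalue at most e.
  set e := (2 * (l : ℝ) * Real.pi + κ) ^ 2 with he
  have het : e < t₀ := pow_lt_pow_left₀ (by linarith) (by linarith) two_ne_zero
  have hecount : T.eigenvalueCount e = (2 * Fintype.card ι * l + 1 : ℕ) := by
    rw [← LinearPMap.rankOn_Iic, ← rankOn_Iio_odd z h l]
    refine (T.rankOn_eq_of_subset (A := Set.Iio t₀) (B := Set.Iic e)
      (fun s hs => lt_of_le_of_lt hs het) fun s hs hs' => ?_).symm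
    rw [Set.mem_Iic, not_le] at hs'
    rw [Set.mem_Iio, ht₀, show (2 * (l : ℝ) + 1) * Real.pi = 2 * (l : ℝ) * Real.pi + Real.pi by ring]
      at hs
    obtain ⟨x, hx1, hx2, rfl⟩ := exists_eq_even_mul_pi_add_sq hs' hs (by linarith)
    have hx0 : 0 < x := lt_of_le_of_lt hκ0 hx1
    exact bouquetMultiplicity_eq_zero_of_abs_ne z (by rwa [abs_of_pos hx0])
      (fun h0 => absurd h0 hx0.ne') (by rw [abs_of_pos hx0]; exact hx1.ne')
  -- There is no eigenvalue strictly between t₀ and f, so an index k ≥ 2rl + r has its ordered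
  -- eigenvalue at least f, if the defining set is nonempty.
  set f := (2 * ((l + 1 : ℕ) : ℝ) * Real.pi + -κ) ^ 2 with hf
  have e1 : (2 * (l : ℝ) + 1) * Real.pi = 2 * ((l + 1 : ℕ) : ℝ) * Real.pi + -Real.pi := by
    push_cast; ring
  have hl1 : 0 ≤ 2 * ((l + 1 : ℕ) : ℝ) * Real.pi + -Real.pi := by rw [← e1]; positivity
  have htf : t₀ < f := by
    rw [ht₀, e1]
    exact pow_lt_pow_left₀ (by linarith) hl1 two_ne_zero
  have habove : ∀ t < f, T.eigenvalueCount t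
      ≤ (2 * Fintype.card ι * l + Fintype.card ι : ℕ) := by
    intro t ht
    rw [← eigenvalueCount_odd z h l, ← LinearPMap.rankOn_Iic, ← LinearPMap.rankOn_Iic,
      ← T.rankOn_eq_of_subset (A := Set.Iio f) (B := Set.Iic t₀)
        (fun s hs => lt_of_le_of_lt hs htf)]
    · exact T.rankOn_mono fun s hs => lt_of_le_of_lt hs ht
    · intro s hs hs'
      rw [Set.mem_Iic, not_le, ht₀, e1] at hs'
      obtain ⟨x, hx1, hx2, rfl⟩ := exists_eq_even_mul_pi_add_sq hs' hs (by linarith)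
      have hx0 : x < 0 := by linarith
      exact bouquetMultiplicity_eq_zero_of_abs_ne z (by rw [abs_of_neg hx0]; linarith)
        (fun h0 => absurd h0 hx0.ne) (by rw [abs_of_neg hx0]; exact fun h => by linarith)
  show sInf S = t₀ ↔ _
  constructor
  · intro heq
    by_contra hk
    rw [not_and_or, not_le, not_lt] at hk
    rcases hk with hk | hk
    · have : e ∈ S := by
        rw [hS, Set.mem_ofPred_eq, hecount]
        exact_mod_cast hk
      linarith [csInf_le hbdd this]
    -- If S were empty, its infimum would be 0 by convention, which differs from t₀ > 0.
    · rcases S.eq_empty_or_nonempty with hemp | hne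
      · rw [hemp, Real.sInf_empty] at heq
        exact ht₀pos.ne heq
      · have : f ≤ sInf S := by
          refine le_csInf hne fun t ht => ?_
          by_contra hlt
          push Not at hlt
          have h1 : (k : Cardinal) < _ := lt_of_lt_of_le ht (habove t hlt)
          have h2 : k < 2 * Fintype.card ι * l + Fintype.card ι := by exact_mod_cast h1
          omega
        linarith
  · rintro ⟨hk1, hk2⟩
    have hmem : t₀ ∈ S := by
      rw [hS, Set.mem_ofPred_eq, eigenvalueCount_odd z h l]
      exact_mod_cast hk2
    refine le_antisymm (csInf_le hbdd hmem) (le_csInf ⟨_, hmem⟩ fun t ht => ?_)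
    by_contra hlt
    push Not at hlt
    have h1 : (k : Cardinal) < _ := lt_of_lt_of_le ht (hbelow t hlt)
    have h2 : k < 2 * Fintype.card ι * l + 1 := by exact_mod_cast h1
    omega

end BouquetCounting

/-! ### The bands of the Cayley graph -/

section Bands

variable {r₀ a : ℕ} {p m : Fin a → ℕ}

/-- On a generator of odd order p the value is a p-th root of unity, and (-1)^p = -1. -/
theorem exists_character_ne_neg_one (hm : ∀ i, 0 < m i) (hodd : ∃ i, Odd (p i))
    (χ : AddChar (FGAbelian r₀ p m) Circle) :
    ∃ j, ((χ (canonicalGen r₀ p m j) : Circle) : ℂ) ≠ -1 := by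
  obtain ⟨i, hi⟩ := hodd
  refine ⟨Sum.inr ⟨i, ⟨0, hm i⟩⟩, fun h => ?_⟩
  have h1 : χ (canonicalGen r₀ p m (Sum.inr ⟨i, ⟨0, hm i⟩⟩)) ^ p i = 1 := by
    rw [← AddChar.map_nsmul_eq_pow, nsmul_canonicalGen_inr, AddChar.map_zero_eq_one]
  have h2 := congrArg (fun ζ : Circle => (ζ : ℂ)) h1
  simp only [Circle.coe_pow, Circle.coe_one] at h2
  rw [h, hi.neg_one_pow] at h2
  norm_num at h2

theorem finrank_eigenspaceAt_floquet (hr₀ : 0 < r₀) (hm : ∀ i, 0 < m i) (hodd : ∃ i, Odd (p i))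
    (l : ℕ) (χ : AddChar (FGAbelian r₀ p m) Circle) :
    Module.finrank ℂ ((floquetLaplacian (canonicalGen r₀ p m) χ).eigenspaceAt
      (((2 * (l : ℝ) + 1) ^ 2 * Real.pi ^ 2 : ℝ) : ℂ)) = r₀ + (∑ i, m i) - 1 := by
  have : Nonempty (GenIndex r₀ m) := ⟨Sum.inl ⟨0, hr₀⟩⟩
  have h := bouquetMultiplicity_odd (fun j => χ (canonicalGen r₀ p m j))
    (exists_character_ne_neg_one hm hodd χ) l
  rw [mul_pow, card_genIndex] at h
  exact Module.finrank_eq_of_rank_eq h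

/-- The indices k with k-th eigenvalue at the odd Dirichlet point form the same interval of length r
- 1 for every character, so testing the trivial character decides whether a band is this single
point. -/
theorem encard_flat_bands (hr₀ : 0 < r₀) (hm : ∀ i, 0 < m i) (hodd : ∃ i, Odd (p i)) (l : ℕ) :
    {k : ℕ | spectralBand (canonicalGen r₀ p m) k
      = {(2 * (l : ℝ) + 1) ^ 2 * Real.pi ^ 2}}.encard = ((r₀ + (∑ i, m i) - 1 : ℕ) : ℕ∞) := by
  have : Nonempty (GenIndex r₀ m) := ⟨Sum.inl ⟨0, hr₀⟩⟩
  set r := Fintype.card (GenIndex r₀ m) with hr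
  have hset : {k : ℕ | spectralBand (canonicalGen r₀ p m) k
      = {(2 * (l : ℝ) + 1) ^ 2 * Real.pi ^ 2}}
      = ((Finset.Ico (2 * r * l + 1) (2 * r * l + r) : Finset ℕ) : Set ℕ) := by
    ext k
    have hiff : ∀ χ : AddChar (FGAbelian r₀ p m) Circle,
        (floquetLaplacian (canonicalGen r₀ p m) χ).orderedEigenvalue k
          = (2 * (l : ℝ) + 1) ^ 2 * Real.pi ^ 2 ↔ 2 * r * l + 1 ≤ k ∧ k < 2 * r * l + r := by
      intro χ
      rw [← mul_pow]
      exact orderedEigenvalue_eq_odd_iff (fun j => χ (canonicalGen r₀ p m j))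
        (exists_character_ne_neg_one hm hodd χ) k l
    rw [Set.mem_ofPred_eq, Finset.coe_Ico, Set.mem_Ico, spectralBand]
    constructor
    · intro h
      have : (floquetLaplacian (canonicalGen r₀ p m) 1).orderedEigenvalue k
          ∈ ({(2 * (l : ℝ) + 1) ^ 2 * Real.pi ^ 2} : Set ℝ) := by
        rw [← h]; exact ⟨1, rfl⟩
      exact (hiff 1).1 this
    · intro h
      rw [Set.eq_singleton_iff_unique_mem]
      refine ⟨⟨1, (hiff 1).2 h⟩, ?_⟩
      rintro _ ⟨χ, rfl⟩
      exact (hiff χ).2 h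
  rw [hset, Set.encard_coe_eq_coe_finsetCard, Nat.card_Ico, hr, card_genIndex]
  congr 1
  omega

end Bands

/-! ### The theorem -/

theorem mainTheorem5 (r₀ a : ℕ) (p m : Fin a → ℕ) (hr₀ : 0 < r₀)
    (hp : ∀ i, 0 < p i) (hm : ∀ i, 0 < m i) :
    ((∃ i, Odd (p i)) →
      (∃ α β : ℕ → ℝ,
        (∀ l : ℕ,
          IsSpectralGap (cayleyGraph (canonicalGen r₀ p m)).kirchhoffLaplacian.unboundedSpectrum
            (α l) ((2 * (l : ℝ) + 1) ^ 2 * Real.pi ^ 2) ∧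
          IsSpectralGap (cayleyGraph (canonicalGen r₀ p m)).kirchhoffLaplacian.unboundedSpectrum
            ((2 * (l : ℝ) + 1) ^ 2 * Real.pi ^ 2) (β l)) ∧
        StrictMono (fun l : ℕ => (2 * (l : ℝ) + 1) ^ 2 * Real.pi ^ 2 - α l) ∧
        StrictMono (fun l : ℕ => β l - (2 * (l : ℝ) + 1) ^ 2 * Real.pi ^ 2) ∧
        Filter.Tendsto (fun l : ℕ => (2 * (l : ℝ) + 1) ^ 2 * Real.pi ^ 2 - α l)
          Filter.atTop Filter.atTop ∧
        Filter.Tendsto (fun l : ℕ => β l - (2 * (l : ℝ) + 1) ^ 2 * Real.pi ^ 2)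
          Filter.atTop Filter.atTop) ∧
      ∀ l : ℕ,
        {k : ℕ | spectralBand (canonicalGen r₀ p m) k
            = {(2 * (l : ℝ) + 1) ^ 2 * Real.pi ^ 2}}.encard = ((r₀ + (∑ i, m i) - 1 : ℕ) : ℕ∞) ∧
        ∀ χ : AddChar (FGAbelian r₀ p m) Circle,
          Module.finrank ℂ ((floquetLaplacian (canonicalGen r₀ p m) χ).eigenspaceAt
            (((2 * (l : ℝ) + 1) ^ 2 * Real.pi ^ 2 : ℝ) : ℂ)) = r₀ + (∑ i, m i) - 1) ∧
    ((∀ i, Even (p i)) →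
      (cayleyGraph (canonicalGen r₀ p m)).kirchhoffLaplacian.unboundedSpectrum
        = (fun x : ℝ => (x : ℂ)) '' Set.Ici 0) :=
  ⟨fun hodd => ⟨exists_spectral_gaps hr₀ hp hm hodd, fun l =>
    ⟨encard_flat_bands hr₀ hm hodd l, finrank_eigenspaceAt_floquet hr₀ hm hodd l⟩⟩,
    unboundedSpectrum_eq_of_even hr₀ hp⟩
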